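/- **Conventions.** A *smooth étale groupoid* $G$ is a groupoid whose objects $G_0$ and arrows $G_1$ are smooth (Hausdorff) manifolds, with smooth structure maps, and whose source and target maps are local diffeomorphisms; $G_r$ is the manifold of composable strings of $r$ arrows. $G$ is *Leray* if every $G_r$, $r\ge 0$, is a disjoint union of contractible open sets. Morphisms of groupoids are smooth functors. For $p\ge 1$ let $\mathbb C^\times(p)$ be the complex $\mathbb C^\times\xrightarrow{d\log}\mathcal A^1\xrightarrow{d}\cdots\xrightarrow{d}\mathcal A^{p-1}$ of smooth $\mathbb C^\times$-valued functions and complex-valued forms (write $\mathcal A^0$ for $\mathbb C^\times$). For a groupoid with smooth structure, $$\check C^m(G,\mathbb C^\times(p))=\bigoplus_{r+l=m,\ 0\le l<p}\Gamma(G_r,\mathcal A^l),\qquad m\ge 0,$$ with differential $D=\delta+(-1)^{m+1}d$ on $\check C^m$, where $\delta$ is the alternating sum of the pull-backs along the faces $G_{r+1}\to G_r$. $H^m(G,\mathbb C^\times(p))$ is the cohomology of this complex (Deligne cohomology), and a $(q-1)$-gerbe with connective structure is a $q$-cocycle of $\check C^*(G,\mathbb C^\times(q+1))$. A cochain is *normalized*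 if its pull-backs along all degeneracies (insertions of an identity arrow) are trivial. An *admissible cover* $W$ of the circle is a subdivision $0=\alpha_0<\alpha_1<\dots<\alpha_N=1$, extended to $\mathbb Z$ by $\alpha_{i+N}=\alpha_i+1$, with an $\varepsilon>0$ such that $2\varepsilon\le\alpha_{i+1}-\alpha_i$ for all $i$; let $I_i=[\alpha_i,\alpha_{i+1}]$ and $V_i=(\alpha_i-\varepsilon,\alpha_{i+1}+\varepsilon)$. The groupoid $S^1_W$ has objects $(x,V_i)$ with $x\in V_i$, and arrows $((x,V_i\cap V_j),m):(x,V_i)\to(x+m,V_{j+mN})$, $m\in\mathbb Z$. The objects of $LG(W)$ are the smooth functors $\psi:S^1_W\to G$, and an arrow $\psi\to\phi$ is a smooth map $\Lambda$ from the arrows of $S^1_W$ to $G_1$ with $\Lambda(r)=\psi(r)\cdot\Lambda(\mathsf e\mathsf t(r))=\Lambda(\mathsf e\mathsf s(r))\cdot\phi(r)$, composition being pointwise. The *loop groupoid* is $LG=\operatorname{colim}_W LG(W)$ over refinements. Families in $LG(W)$ parametrized by $\mathbb R^d$ are smooth if they are jointly smooth in the parameter and the point of $S^1_W$; smooth functions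 and forms on the spaces of strings of $LG(W)$ are given by compatible smooth functions and forms on the parameter spaces of all smooth families, and functions, forms and cochains on $LG$ are families of such on all $LG(W)$, compatible under refinement. For a string $\Lambda=(\Lambda^1,\dots,\Lambda^r)$ of arrows of $LG(W)$ joining loops $\psi^0,\dots,\psi^r$, let $\Lambda_i:V_i\to G_r$ be its restriction to the identity arrows over $V_i$, and for $0\le j\le r$, $0\le i<N$ put $$\vartheta_j\Lambda(\alpha_{i+1})=\bigl(\Lambda^1_i,\dots,\Lambda^j_i,\ \psi^j,\ \Lambda^{j+1}_{i+1},\dots,\Lambda^r_{i+1}\bigr)(\alpha_{i+1})\in G_{r+1},$$ where the arrow $\psi^j(\alpha_{i+1})$ is the value of $\psi^j$ on the arrow of $S^1_W$ from $(\alpha_{i+1},V_i)$ to $(\alpha_{i+1},V_{i+1})$, and, for $i=N-1$, on the arrow from $(1,V_{N-1})$ to $(0,V_0)$ (indices $i+1$ are then read modulo $N$, and $\alpha_N=1$ as $0$). **Theorem.** Let $n\ge 1$. (a) For every Leray smooth étale groupoid $G$, every admissible cover $W$ and every $m\ge 0$, there is a homomorphism $\tau^W:\check C^{m+1}(G,\mathbb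 C^\times(n+1))\to\check C^{m}(LG(W),\mathbb C^\times(n))$ sending $(h,\theta^1,\theta^2,\dots)$ to $(F,\Delta^1,\Delta^2,\dots)$ with $$F(\Lambda)=\exp\Bigl(\sum_{i=0}^{N-1}\int_{I_i}\Lambda_i^*\theta^1\Bigr)\prod_{i=0}^{N-1}\prod_{j=0}^{m}h\bigl(\vartheta_j\Lambda(\alpha_{i+1})\bigr)^{(-1)^{j+m+1}},$$ $$\langle\Delta^l,(\Xi^1,\dots,\Xi^l)\rangle=\sum_{i=0}^{N-1}\int_{I_i}\theta^{l+1}\Bigl(\tfrac{d\Lambda_i}{dt},\Xi^1_i,\dots,\Xi^l_i\Bigr)dt+\sum_{i=0}^{N-1}\sum_{j=0}^{m-l}(-1)^{j+m+1}\bigl\langle\theta^l,(\vartheta_j\Xi^1(\alpha_{i+1}),\dots,\vartheta_j\Xi^l(\alpha_{i+1}))\bigr\rangle$$ for tangent vectors $\Xi^a$ at $\Lambda$, $1\le l<n$, $l\le m$. These maps form a cochain map of degree $-1$, natural in $G$ with respect to all morphisms of groupoids. (b) There is a cochain map of degree $-1$, natural in the Leray groupoid $G$, $$\tau:\check C^*(G,\mathbb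 C^\times(n+1))\longrightarrow\check C^{*-1}(LG,\mathbb C^\times(n)),$$ whose restriction to each $LG(W)$ is given on normalized cochains by the formulas of (a). For $*=n$ it sends $(n-1)$-gerbes with connective structure over $G$ to $(n-2)$-gerbes with connective structure over $LG$. It induces transgression homomorphisms $$H^*(G,\mathbb C^\times(n+1))\longrightarrow H^{*-1}(LG,\mathbb C^\times(n)),$$ and for every $W$ and every cocycle $x$ (normalized or not) the restriction of $\tau x$ to $LG(W)$ differs from $\tau^W x$ by a coboundary. Here all groups in degree $-1$ are $0$, so that being a cochain map in degree $0$ means $\tau(Dx)=0$, $\tau^W(Dx)=0$ for $x\in\check C^0$. -/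

import Mathlib

universe u v w

noncomputable section

namespace LoopDeligne

open Set Diffeology
open scoped Manifold ContDiff Topology

/-- The Euclidean space `ℝⁿ`. -/
abbrev E (n : ℕ) : Type := EuclideanSpace ℝ (Fin n)

/-! ### Diffeologies -/

/-- The coarsest diffeology for which all maps `f i` are smooth. -/
@[reducible]
def inducedDiffeology {X : Type u} {ι : Type w} {Y : ι → Type v} [∀ i, DiffeologicalSpace (Y i)]
    (f : ∀ i, X → Y i) : DiffeologicalSpace X where
  plots n := {p | ∀ i, IsPlot (f i ∘ p)}
  constant_plots x := fun i => isPlot_const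
  plot_reparam hp hf := fun i => isPlot_reparam (hp i) hf
  locality {n p} hp := fun i => DiffeologicalSpace.locality fun x => by
    obtain ⟨U, hU, hx, h⟩ := hp x
    exact ⟨U, hU, hx, fun hf hf' => h hf hf' i⟩

/-- The functional diffeology on a space `F` of smooth maps, where `ev : F → X → Y` is evaluation:
`P : ℝᵏ → F` is a plot if and only if `(c, x) ↦ ev (P c) x` is smooth on `ℝᵏ × X`. -/
@[reducible]
def functionalDiffeology {F : Type u} {X : Type v} {Y : Type w} [DiffeologicalSpace X]
    [DiffeologicalSpace Y] (ev : F → X → Y) (hev : ∀ a, DSmooth (ev a)) : DiffeologicalSpace F where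
  plots k := {P | ∀ (n : ℕ) (f : E n → E k) (q : E n → X), ContDiff ℝ ∞ f → IsPlot q →
    IsPlot fun c => ev (P (f c)) (q c)}
  constant_plots a := fun n f q _ hq => hev a n q hq
  plot_reparam hp hf := fun n g q hg hq => hp n _ q (hf.comp hg) hq
  locality {k P} hP := fun n f q hf hq => DiffeologicalSpace.locality fun x => by
    obtain ⟨U, hU, hx, h⟩ := hP (f x)
    refine ⟨f ⁻¹' U, hU.preimage hf.continuous, hx, fun {m g} hg hg' => ?_⟩
    exact h (f := f ∘ g) hg (hf.comp hg') m id (q ∘ g) contDiff_id (isPlot_reparam hq hg')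

/-- The diffeology whose plots are the common plots of `d₁` and `d₂`. -/
@[reducible]
def meetDiffeology {X : Type u} (d₁ d₂ : DiffeologicalSpace X) : DiffeologicalSpace X where
  plots n := d₁.plots n ∩ d₂.plots n
  constant_plots x := ⟨d₁.constant_plots x, d₂.constant_plots x⟩
  plot_reparam hp hf := ⟨d₁.plot_reparam hp.1 hf, d₂.plot_reparam hp.2 hf⟩
  locality hp := by
    refine ⟨d₁.locality fun x => ?_, d₂.locality fun x => ?_⟩
    · obtain ⟨U, hU, hx, h⟩ := hp x
      exact ⟨U, hU, hx, fun hf hf' => (h hf hf').1⟩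
    · obtain ⟨U, hU, hx, h⟩ := hp x
      exact ⟨U, hU, hx, fun hf hf' => (h hf hf').2⟩

/-! ### Smooth groupoids -/

/-- A diffeological groupoid: a small groupoid whose objects and arrows form diffeological spaces
and all of whose structure maps are smooth. The composite of `g : x → y` and `h : y → z` is
written in the order of the path, `mul g h : x → z`. -/
structure DGrpd where
  Ob : Type u
  Ar : Type u
  [dOb : DiffeologicalSpace Ob]
  [dAr : DiffeologicalSpace Ar]
  /-- source -/
  s : Ar → Ob
  /-- target -/
  t : Ar → Ob
  /-- identity arrows -/
  e : Ob → Ar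
  /-- inversion -/
  inv : Ar → Ar
  /-- composition -/
  mul : ∀ g h : Ar, t g = s h → Ar
  s_e : ∀ x, s (e x) = x
  t_e : ∀ x, t (e x) = x
  s_inv : ∀ g, s (inv g) = t g
  t_inv : ∀ g, t (inv g) = s g
  s_mul : ∀ g h H, s (mul g h H) = s g
  t_mul : ∀ g h H, t (mul g h H) = t h
  e_mul : ∀ x g (H : t (e x) = s g), mul (e x) g H = g
  mul_e : ∀ g x (H : t g = s (e x)), mul g (e x) H = g
  mul_inv : ∀ g, mul g (inv g) (s_inv g).symm = e (s g)
  inv_mul : ∀ g, mul (inv g) g (t_inv g) = e (t g)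
  assoc : ∀ g h k (H : t g = s h) (K : t h = s k),
    mul (mul g h H) k ((t_mul g h H).trans K) = mul g (mul h k K) (H.trans (s_mul h k K).symm)
  smooth_s : DSmooth s
  smooth_t : DSmooth t
  smooth_e : DSmooth e
  smooth_inv : DSmooth inv
  smooth_mul : ∀ {n : ℕ} {p q : E n → Ar} (H : ∀ c, t (p c) = s (q c)), IsPlot p → IsPlot q →
    IsPlot fun c => mul (p c) (q c) (H c)

attribute [instance] DGrpd.dOb DGrpd.dAr

/-- A smooth functor (morphism of groupoids). -/
@[ext]
structure DFunctor (S : DGrpd.{v}) (G : DGrpd.{u}) where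
  ob : S.Ob → G.Ob
  ar : S.Ar → G.Ar
  smooth_ob : DSmooth ob
  smooth_ar : DSmooth ar
  s_ar : ∀ r, G.s (ar r) = ob (S.s r)
  t_ar : ∀ r, G.t (ar r) = ob (S.t r)
  map_e : ∀ x, ar (S.e x) = G.e (ob x)
  map_mul : ∀ r r' (H : S.t r = S.s r'),
    ar (S.mul r r' H) = G.mul (ar r) (ar r') (by rw [t_ar, s_ar, H])

/-- An arrow `Ψ → Φ` between smooth functors `Ψ, Φ : S → G`: a smooth map `Λ` from the arrows of
`S` to the arrows of `G` such that `Λ r` goes from `Ψ (s r)` to `Φ (t r)` and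
`Λ r = Ψ r · Λ (e (t r)) = Λ (e (s r)) · Φ r`. -/
@[ext]
structure DTrans (S : DGrpd.{v}) (G : DGrpd.{u}) where
  src : DFunctor S G
  tgt : DFunctor S G
  map : S.Ar → G.Ar
  smooth_map : DSmooth map
  s_map : ∀ r, G.s (map r) = src.ob (S.s r)
  t_map : ∀ r, G.t (map r) = tgt.ob (S.t r)
  eq_left : ∀ r, map r = G.mul (src.ar r) (map (S.e (S.t r))) (by rw [src.t_ar, s_map, S.s_e])
  eq_right : ∀ r, map r = G.mul (map (S.e (S.s r))) (tgt.ar r) (by rw [tgt.s_ar, t_map, S.t_e])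

instance (S : DGrpd.{v}) (G : DGrpd.{u}) : DiffeologicalSpace (DFunctor S G) :=
  meetDiffeology (functionalDiffeology DFunctor.ob DFunctor.smooth_ob)
    (functionalDiffeology DFunctor.ar DFunctor.smooth_ar)

instance (S : DGrpd.{v}) (G : DGrpd.{u}) : DiffeologicalSpace (DTrans S G) :=
  meetDiffeology (functionalDiffeology DTrans.map DTrans.smooth_map)
    (inducedDiffeology fun b : Bool => if b then DTrans.src else DTrans.tgt)

namespace DGrpd

variable (G : DGrpd.{u})

lemma mul_congr {g g' h h' : G.Ar} (hg : g = g') (hh : h = h') (H : G.t g = G.s h) :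
    G.mul g h H = G.mul g' h' (by rw [← hg, ← hh, H]) := by
  subst hg hh; rfl

end DGrpd

namespace DTrans

variable {S : DGrpd.{v}} {G : DGrpd.{u}}

/-- The value of a composite `Λ · Ω` on a composite arrow. -/
lemma map_mul_map (Λ Ω : DTrans S G) (h : Λ.tgt = Ω.src) (r r' : S.Ar) (H : S.t r = S.s r') :
    G.mul (Λ.map (S.e (S.s (S.mul r r' H)))) (Ω.map (S.mul r r' H))
      (by rw [Λ.t_map, Ω.s_map, S.t_e, h]) =
    G.mul (Λ.map r) (Ω.map r') (by rw [Λ.t_map, Ω.s_map, H, h]) := by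
  have e1 : Ω.map (S.mul r r' H) = G.mul (Ω.src.ar r) (Ω.map r')
      (by rw [Ω.src.t_ar, Ω.s_map, H]) := by
    rw [Ω.eq_left, G.mul_congr (Ω.src.map_mul r r' H)
      (congrArg (fun x => Ω.map (S.e x)) (S.t_mul r r' H)), G.assoc]
    exact G.mul_congr rfl (Ω.eq_left r').symm _
  rw [G.mul_congr (congrArg (fun x => Λ.map (S.e x)) (S.s_mul r r' H)) e1, ← G.assoc]
  · refine G.mul_congr ?_ rfl _
    rw [Λ.eq_right r]
    exact G.mul_congr rfl (by rw [h]) _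
  · rw [Λ.t_map, Ω.src.s_ar, S.t_e, h]

end DTrans

namespace DGrpd

variable (G : DGrpd.{u})

lemma inv_mul_cancel_left (g h : G.Ar) (H : G.t g = G.s h)
    (H' : G.t (G.inv g) = G.s (G.mul g h H)) : G.mul (G.inv g) (G.mul g h H) H' = h := by
  rw [← G.assoc (G.inv g) g h (G.t_inv g) H, G.mul_congr (G.inv_mul g) rfl, G.e_mul]

lemma mul_inv_cancel_right (g h : G.Ar) (H : G.t g = G.s h)
    (H' : G.t (G.mul g h H) = G.s (G.inv h)) : G.mul (G.mul g h H) (G.inv h) H' = g := by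
  rw [G.assoc g h (G.inv h) H (G.s_inv h).symm, G.mul_congr rfl (G.mul_inv h), ]
  exact G.mul_e _ _ _

lemma inv_mul_eq_mul_inv {a b c d : G.Ar} (hab : G.t a = G.s b) (hcd : G.t c = G.s d)
    (h : G.mul a b hab = G.mul c d hcd) (h₁ : G.t (G.inv c) = G.s a) (h₂ : G.t d = G.s (G.inv b)) :
    G.mul (G.inv c) a h₁ = G.mul d (G.inv b) h₂ := by
  have e1 : d = G.mul (G.inv c) (G.mul a b hab)
      (by rw [G.s_mul]; exact h₁) := by
    rw [G.mul_congr rfl h, G.inv_mul_cancel_left]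
  rw [G.mul_congr e1 rfl, ← G.mul_congr (G.assoc (G.inv c) a b h₁ hab) rfl,
    G.mul_inv_cancel_right]
  rw [G.t_mul, G.s_inv]

end DGrpd

namespace DTrans

variable {S : DGrpd.{v}} {G : DGrpd.{u}}

/-- The identity transformation of `Ψ`. -/
def id (Ψ : DFunctor S G) : DTrans S G where
  src := Ψ
  tgt := Ψ
  map := Ψ.ar
  smooth_map := Ψ.smooth_ar
  s_map := Ψ.s_ar
  t_map := Ψ.t_ar
  eq_left := fun r => by rw [G.mul_congr rfl (Ψ.map_e _), G.mul_e]
  eq_right := fun r => by rw [G.mul_congr (Ψ.map_e _) rfl, G.e_mul]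

/-- The inverse transformation, `Λ⁻¹ r = Λ (e (s r))⁻¹ · Ψ r`. -/
def inv (Λ : DTrans S G) : DTrans S G where
  src := Λ.tgt
  tgt := Λ.src
  map := fun r => G.mul (G.inv (Λ.map (S.e (S.s r)))) (Λ.src.ar r)
    (by rw [G.t_inv, Λ.s_map, Λ.src.s_ar, S.s_e])
  smooth_map := fun n p hp => G.smooth_mul _
    (G.smooth_inv _ _ (Λ.smooth_map _ _ (S.smooth_e _ _ (S.smooth_s _ _ hp))))
    (Λ.src.smooth_ar _ _ hp)
  s_map := fun r => by rw [G.s_mul, G.s_inv, Λ.t_map, S.t_e]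
  t_map := fun r => by rw [G.t_mul, Λ.src.t_ar]
  eq_left := fun r => by
    rw [G.mul_congr rfl (G.mul_congr rfl (Λ.src.map_e (S.t r)) _),
      G.mul_congr rfl (G.mul_e _ _ _), G.mul_congr rfl (congrArg
        (fun x => G.inv (Λ.map (S.e x))) (S.s_e (S.t r)))]
    exact G.inv_mul_eq_mul_inv _ _ ((Λ.eq_left r).symm.trans (Λ.eq_right r)) _ _
  eq_right := fun r => by
    refine G.mul_congr ?_ rfl _
    rw [G.mul_congr rfl (Λ.src.map_e (S.s r)), G.mul_e, S.s_e]

/-- The composite transformation, `(Λ · Ω) r = Λ (e (s r)) · Ω r`. -/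
def comp (Λ Ω : DTrans S G) (H : Λ.tgt = Ω.src) : DTrans S G where
  src := Λ.src
  tgt := Ω.tgt
  map := fun r => G.mul (Λ.map (S.e (S.s r))) (Ω.map r) (by rw [Λ.t_map, Ω.s_map, S.t_e, H])
  smooth_map := fun n p hp => G.smooth_mul _
    (Λ.smooth_map _ _ (S.smooth_e _ _ (S.smooth_s _ _ hp))) (Ω.smooth_map _ _ hp)
  s_map := fun r => by rw [G.s_mul, Λ.s_map, S.s_e]
  t_map := fun r => by rw [G.t_mul, Ω.t_map]
  eq_left := fun r => by
    have h1 : G.t (Λ.map (S.e (S.s r))) = G.s (Ω.src.ar r) := by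
      rw [Λ.t_map, S.t_e, Ω.src.s_ar, H]
    have h2 : G.t (Ω.src.ar r) = G.s (Ω.map (S.e (S.t r))) := by
      rw [Ω.src.t_ar, Ω.s_map, S.s_e]
    have h3 : G.t (Λ.src.ar r) = G.s (Λ.map (S.e (S.t r))) := by
      rw [Λ.src.t_ar, Λ.s_map, S.s_e]
    have h4 : G.t (Λ.map (S.e (S.t r))) = G.s (Ω.map (S.e (S.t r))) := by
      rw [Λ.t_map, Ω.s_map, S.s_e, S.t_e, H]
    rw [G.mul_congr rfl (Ω.eq_left r), ← G.assoc _ _ _ h1 h2,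
      G.mul_congr rfl (G.mul_congr (congrArg (fun x => Λ.map (S.e x)) (S.s_e (S.t r))) rfl _),
      ← G.assoc _ _ _ h3 h4]
    refine G.mul_congr ?_ rfl _
    rw [← Λ.eq_left r, Λ.eq_right r]
    exact G.mul_congr rfl (by rw [H]) _
  eq_right := fun r => by
    have h1 : G.t (Λ.map (S.e (S.s r))) = G.s (Ω.map (S.e (S.s r))) := by
      rw [Λ.t_map, Ω.s_map, S.s_e, S.t_e, H]
    have h2 : G.t (Ω.map (S.e (S.s r))) = G.s (Ω.tgt.ar r) := by
      rw [Ω.t_map, Ω.tgt.s_ar, S.t_e]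
    rw [G.mul_congr rfl (Ω.eq_right r), ← G.assoc _ _ _ h1 h2]
    exact G.mul_congr (G.mul_congr (by rw [S.s_e]) rfl _) rfl _

lemma isPlot_map_comp {n : ℕ} {P : E n → DTrans S G} (hP : IsPlot P) {q : E n → S.Ar}
    (hq : IsPlot q) : IsPlot fun c => (P c).map (q c) :=
  hP.1 n _root_.id q contDiff_id hq

end DTrans

/-- The groupoid of smooth functors `S → G` and their transformations. -/
@[reducible]
def funGrpd (S : DGrpd.{v}) (G : DGrpd.{u}) : DGrpd.{max u v} where
  Ob := DFunctor S G
  Ar := DTrans S G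
  dOb := inferInstance
  dAr := inferInstance
  s := DTrans.src
  t := DTrans.tgt
  e := DTrans.id
  inv := DTrans.inv
  mul := DTrans.comp
  s_e _ := rfl
  t_e _ := rfl
  s_inv _ := rfl
  t_inv _ := rfl
  s_mul _ _ _ := rfl
  t_mul _ _ _ := rfl
  e_mul Ψ Λ H := by
    have H : Ψ = Λ.src := H
    refine DTrans.ext H rfl (funext fun r => ?_)
    subst H
    exact (G.mul_congr (Λ.src.map_e _) rfl _).trans (G.e_mul _ _ _)
  mul_e Λ Ψ H := by
    have H : Λ.tgt = Ψ := H
    refine DTrans.ext rfl H.symm (funext fun r => ?_)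
    subst H
    exact (Λ.eq_right r).symm
  mul_inv Λ := by
    refine DTrans.ext rfl rfl (funext fun r => ?_)
    change G.mul (Λ.map (S.e (S.s r))) (G.mul (G.inv (Λ.map (S.e (S.s r)))) (Λ.src.ar r) _) _ =
      Λ.src.ar r
    rw [← G.assoc _ _ _ (by rw [G.s_inv]) (by rw [G.t_inv, Λ.s_map, Λ.src.s_ar, S.s_e]),
      G.mul_congr (G.mul_inv _) rfl, G.e_mul]
  inv_mul Λ := by
    refine DTrans.ext rfl rfl (funext fun r => ?_)
    have h : Λ.inv.map (S.e (S.s r)) = G.inv (Λ.map (S.e (S.s r))) := by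
      change G.mul (G.inv (Λ.map (S.e (S.s (S.e (S.s r)))))) (Λ.src.ar (S.e (S.s r))) _ = _
      rw [G.mul_congr rfl (Λ.src.map_e _), G.mul_e, S.s_e]
    change G.mul (Λ.inv.map (S.e (S.s r))) (Λ.map r) _ = Λ.tgt.ar r
    rw [G.mul_congr h (Λ.eq_right r), G.inv_mul_cancel_left]
  assoc Λ Ω Γ H K := by
    refine DTrans.ext rfl rfl (funext fun r => ?_)
    have H : Λ.tgt = Ω.src := H
    have K : Ω.tgt = Γ.src := K
    have h1 : G.t (Λ.map (S.e (S.s r))) = G.s (Ω.map (S.e (S.s r))) := by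
      rw [Λ.t_map, Ω.s_map, S.t_e, S.s_e, H]
    have h2 : G.t (Ω.map (S.e (S.s r))) = G.s (Γ.map r) := by
      rw [Ω.t_map, Γ.s_map, S.t_e, K]
    change G.mul (G.mul (Λ.map (S.e (S.s (S.e (S.s r))))) (Ω.map (S.e (S.s r))) _) (Γ.map r) _ =
      G.mul (Λ.map (S.e (S.s r))) (G.mul (Ω.map (S.e (S.s r))) (Γ.map r) _) _
    rw [← G.assoc _ _ _ h1 h2]
    exact G.mul_congr (G.mul_congr (by rw [S.s_e]) rfl _) rfl _
  smooth_s := fun n p hp => hp.2 true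
  smooth_t := fun n p hp => hp.2 false
  smooth_e := fun n p hp => ⟨hp.2, fun b => by cases b <;> exact hp⟩
  smooth_inv := fun n p hp => by
    have hs : IsPlot fun c => (p c).src := hp.2 true
    have ht : IsPlot fun c => (p c).tgt := hp.2 false
    refine ⟨fun m f q hf hq => ?_, fun b => by cases b <;> assumption⟩
    exact G.smooth_mul _ (G.smooth_inv _ _ (hp.1 m f _ hf
      (S.smooth_e _ _ (S.smooth_s _ _ hq)))) (hs.2 m f q hf hq)
  smooth_mul := fun {n p q} H hp hq => by
    have hs : IsPlot fun c => (p c).src := hp.2 true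
    have ht : IsPlot fun c => (q c).tgt := hq.2 false
    refine ⟨fun m f r hf hr => ?_, fun b => by cases b <;> assumption⟩
    exact G.smooth_mul _ (hp.1 m f _ hf (S.smooth_e _ _ (S.smooth_s _ _ hr))) (hq.1 m f r hf hr)

namespace DFunctor

/-- The composite `F ∘ Ψ` of smooth functors. -/
def comp {S : DGrpd.{v}} {G : DGrpd.{u}} {H : DGrpd.{w}} (F : DFunctor G H) (Ψ : DFunctor S G) :
    DFunctor S H where
  ob := fun x => F.ob (Ψ.ob x)
  ar := fun r => F.ar (Ψ.ar r)
  smooth_ob := F.smooth_ob.comp Ψ.smooth_ob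
  smooth_ar := F.smooth_ar.comp Ψ.smooth_ar
  s_ar := fun r => by rw [F.s_ar, Ψ.s_ar]
  t_ar := fun r => by rw [F.t_ar, Ψ.t_ar]
  map_e := fun x => by rw [Ψ.map_e, F.map_e]
  map_mul := fun r r' H => by rw [Ψ.map_mul, F.map_mul]

/-- Precomposition with `ρ : S → T`, as a functor between functor groupoids. -/
def precomp {S : DGrpd.{v}} {T : DGrpd.{w}} (ρ : DFunctor S T) (G : DGrpd.{u}) :
    DFunctor (funGrpd T G) (funGrpd S G) where
  ob Ψ := Ψ.comp ρ
  ar Λ :=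
    { src := Λ.src.comp ρ
      tgt := Λ.tgt.comp ρ
      map := fun r => Λ.map (ρ.ar r)
      smooth_map := Λ.smooth_map.comp ρ.smooth_ar
      s_map := fun r => by rw [Λ.s_map, ρ.s_ar]; rfl
      t_map := fun r => by rw [Λ.t_map, ρ.t_ar]; rfl
      eq_left := fun r => by
        rw [Λ.eq_left (ρ.ar r)]
        exact G.mul_congr rfl (by rw [ρ.map_e, ρ.t_ar]) _
      eq_right := fun r => by
        rw [Λ.eq_right (ρ.ar r)]
        exact G.mul_congr (by rw [ρ.map_e, ρ.s_ar]) rfl _ }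
  smooth_ob n p hp := ⟨fun m f q hf hq => hp.1 m f _ hf (ρ.smooth_ob _ _ hq),
    fun m f q hf hq => hp.2 m f _ hf (ρ.smooth_ar _ _ hq)⟩
  smooth_ar n p hp := by
    have hs : IsPlot fun c => (p c).src := hp.2 true
    have ht : IsPlot fun c => (p c).tgt := hp.2 false
    refine ⟨fun m f q hf hq => hp.1 m f _ hf (ρ.smooth_ar _ _ hq), fun b => ?_⟩
    cases b
    · exact ⟨fun m f q hf hq => ht.1 m f _ hf (ρ.smooth_ob _ _ hq),
        fun m f q hf hq => ht.2 m f _ hf (ρ.smooth_ar _ _ hq)⟩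
    · exact ⟨fun m f q hf hq => hs.1 m f _ hf (ρ.smooth_ob _ _ hq),
        fun m f q hf hq => hs.2 m f _ hf (ρ.smooth_ar _ _ hq)⟩
  s_ar _ := rfl
  t_ar _ := rfl
  map_e _ := rfl
  map_mul Λ Ω H := by
    refine DTrans.ext rfl rfl (funext fun r => ?_)
    have h : T.e (T.s (ρ.ar r)) = ρ.ar (S.e (S.s r)) := by rw [ρ.map_e, ρ.s_ar]
    exact G.mul_congr (congrArg (DTrans.map Λ) h) rfl _

/-- Postcomposition with `F : G → H`, as a functor between functor groupoids. -/
def postcomp (S : DGrpd.{v}) {G : DGrpd.{u}} {H : DGrpd.{w}} (F : DFunctor G H) :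
    DFunctor (funGrpd S G) (funGrpd S H) where
  ob Ψ := F.comp Ψ
  ar Λ :=
    { src := F.comp Λ.src
      tgt := F.comp Λ.tgt
      map := fun r => F.ar (Λ.map r)
      smooth_map := F.smooth_ar.comp Λ.smooth_map
      s_map := fun r => by rw [F.s_ar, Λ.s_map]; rfl
      t_map := fun r => by rw [F.t_ar, Λ.t_map]; rfl
      eq_left := fun r => by
        rw [Λ.eq_left r, F.map_mul]; rfl
      eq_right := fun r => by
        rw [Λ.eq_right r, F.map_mul]; rfl }
  smooth_ob n p hp := ⟨fun m f q hf hq => F.smooth_ob _ _ (hp.1 m f q hf hq),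
    fun m f q hf hq => F.smooth_ar _ _ (hp.2 m f q hf hq)⟩
  smooth_ar n p hp := by
    have hs : IsPlot fun c => (p c).src := hp.2 true
    have ht : IsPlot fun c => (p c).tgt := hp.2 false
    refine ⟨fun m f q hf hq => F.smooth_ar _ _ (hp.1 m f q hf hq), fun b => ?_⟩
    cases b
    · exact ⟨fun m f q hf hq => F.smooth_ob _ _ (ht.1 m f q hf hq),
        fun m f q hf hq => F.smooth_ar _ _ (ht.2 m f q hf hq)⟩
    · exact ⟨fun m f q hf hq => F.smooth_ob _ _ (hs.1 m f q hf hq),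
        fun m f q hf hq => F.smooth_ar _ _ (hs.2 m f q hf hq)⟩
  s_ar _ := rfl
  t_ar _ := rfl
  map_e _ := rfl
  map_mul Λ Ω H := by
    refine DTrans.ext rfl rfl (funext fun r => ?_)
    exact F.map_mul _ _ _

end DFunctor

/-! ### Composable strings -/

/-- The space `𝒢_k` of composable strings of `k` arrows `x₀ → x₁ → ⋯ → x_k`. A string is recorded
through all its partial composites `arr a b : x_a → x_b` (`arr a b` with `a > b` is the inverse of
`arr b a`), so the string itself is `(arr 0 1, …, arr (k-1) k)`; for `k = 0` it is an object. -/
@[ext]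
structure Simplex (G : DGrpd.{u}) (k : ℕ) where
  ob : Fin (k + 1) → G.Ob
  arr : Fin (k + 1) → Fin (k + 1) → G.Ar
  s_arr : ∀ a b, G.s (arr a b) = ob a
  t_arr : ∀ a b, G.t (arr a b) = ob b
  mul_arr : ∀ a b c, G.mul (arr a b) (arr b c) (by rw [t_arr, s_arr]) = arr a c

namespace Simplex

/-- A family of strings is smooth if all its arrows are. -/
instance (G : DGrpd.{u}) (k : ℕ) : DiffeologicalSpace (Simplex G k) :=
  inducedDiffeology fun (ab : Fin (k + 1) × Fin (k + 1)) (σ : Simplex G k) => σ.arr ab.1 ab.2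

variable {G : DGrpd.{u}} {k j : ℕ}

/-- The operation on strings induced by a map of vertices. Omitting the vertex `l` gives the
`l`-th face, repeating the vertex `l` gives the `l`-th degeneracy. -/
def reindex (f : Fin (j + 1) → Fin (k + 1)) (σ : Simplex G k) : Simplex G j where
  ob a := σ.ob (f a)
  arr a b := σ.arr (f a) (f b)
  s_arr _ _ := σ.s_arr _ _
  t_arr _ _ := σ.t_arr _ _
  mul_arr _ _ _ := σ.mul_arr _ _ _

lemma smooth_reindex (f : Fin (j + 1) → Fin (k + 1)) :
    DSmooth (reindex f : Simplex G k → Simplex G j) :=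
  fun _ _ hp ab => hp (f ab.1, f ab.2)

/-- The faces: `(g₂, …)`, `(g₁, …, g_l g_{l+1}, …)`, `(g₁, …, g_k)` of `(g₁, …, g_{k+1})`. -/
def face (l : Fin (k + 2)) : Simplex G (k + 1) → Simplex G k := reindex l.succAbove

/-- The degeneracies, which insert an identity arrow at the vertex `l`. -/
def degen (l : Fin (k + 1)) : Simplex G k → Simplex G (k + 1) := reindex l.predAbove

lemma smooth_face (l : Fin (k + 2)) : DSmooth (face l : Simplex G (k + 1) → Simplex G k) :=
  smooth_reindex _

lemma smooth_degen (l : Fin (k + 1)) : DSmooth (degen l : Simplex G k → Simplex G (k + 1)) :=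
  smooth_reindex _

/-- The image of a string under a functor. -/
def map {H : DGrpd.{v}} (F : DFunctor G H) (k : ℕ) (σ : Simplex G k) : Simplex H k where
  ob a := F.ob (σ.ob a)
  arr a b := F.ar (σ.arr a b)
  s_arr a b := by rw [F.s_ar, σ.s_arr]
  t_arr a b := by rw [F.t_ar, σ.t_arr]
  mul_arr a b c := by rw [← F.map_mul _ _ (by rw [σ.t_arr, σ.s_arr]), σ.mul_arr]

lemma smooth_map {H : DGrpd.{v}} (F : DFunctor G H) (k : ℕ) : DSmooth (map F k) :=
  fun _ _ hp ab => F.smooth_ar _ _ (hp ab)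

/-- The constant string of length `k` at an object. -/
def const (k : ℕ) (x : G.Ob) : Simplex G k where
  ob _ := x
  arr _ _ := G.e x
  s_arr _ _ := G.s_e x
  t_arr _ _ := G.t_e x
  mul_arr _ _ _ := G.mul_e _ _ _

/-- The string of length `k` through the source and the target of the arrow `g` whose vertex `a`
lies at the target if `c a` holds and at the source otherwise. -/
def ofArrow (g : G.Ar) (k : ℕ) (c : Fin (k + 1) → Bool) : Simplex G k where
  ob a := if c a then G.t g else G.s g
  arr a b := if c a then (if c b then G.e (G.t g) else G.inv g)
    else (if c b then g else G.e (G.s g))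
  s_arr a b := by cases c a <;> cases c b <;> simp [G.s_e, G.s_inv]
  t_arr a b := by cases c a <;> cases c b <;> simp [G.t_e, G.t_inv]
  mul_arr a b d := by
    cases ha : c a <;> cases hb : c b <;> cases hd : c d <;>
      simp [G.e_mul, G.mul_e, G.mul_inv, G.inv_mul]

/-- Evaluation of a string of transformations `Λ¹, …, Λʲ` of functors `S → G` along a string `ξ`
in `S`: the vertex `a` of the result is the value at `ξ.ob a` of the `f a`-th functor. -/
def eval {S : DGrpd.{v}} (f : Fin (k + 1) → Fin (j + 1)) (ξ : Simplex S k)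
    (Λ : Simplex (funGrpd S G) j) : Simplex G k where
  ob a := DFunctor.ob (Λ.ob (f a)) (ξ.ob a)
  arr a b := DTrans.map (Λ.arr (f a) (f b)) (ξ.arr a b)
  s_arr a b := by
    rw [DTrans.s_map, ξ.s_arr]
    exact congrArg (fun Ψ : DFunctor S G => Ψ.ob (ξ.ob a)) (Λ.s_arr (f a) (f b))
  t_arr a b := by
    rw [DTrans.t_map, ξ.t_arr]
    exact congrArg (fun Ψ : DFunctor S G => Ψ.ob (ξ.ob b)) (Λ.t_arr (f a) (f b))
  mul_arr a b c := by
    have h : DTrans.tgt (Λ.arr (f a) (f b)) = DTrans.src (Λ.arr (f b) (f c)) :=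
      (Λ.t_arr (f a) (f b)).trans (Λ.s_arr (f b) (f c)).symm
    have H : S.t (ξ.arr a b) = S.s (ξ.arr b c) := by rw [ξ.t_arr, ξ.s_arr]
    have h1 := congrArg (fun Ω : DTrans S G => Ω.map (S.mul _ _ H)) (Λ.mul_arr (f a) (f b) (f c))
    refine (DTrans.map_mul_map _ _ h _ _ H).symm.trans (h1.trans ?_)
    exact congrArg _ (ξ.mul_arr a b c)

lemma isPlot_eval {S : DGrpd.{v}} (f : Fin (k + 1) → Fin (j + 1)) {n : ℕ} {ξ : E n → Simplex S k}
    {P : E n → Simplex (funGrpd S G) j} (hξ : IsPlot ξ) (hP : IsPlot P) :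
    IsPlot fun c => eval f (ξ c) (P c) :=
  fun ab => DTrans.isPlot_map_comp (hP (f ab.1, f ab.2)) (hξ ab)

lemma isPlot_const_comp {n : ℕ} {q : E n → G.Ob} (k : ℕ) (hq : IsPlot q) :
    IsPlot fun c => const k (q c) :=
  fun _ => G.smooth_e _ _ hq

end Simplex

/-! ### Differential forms and smooth `ℂˣ`-valued functions -/

section Forms

variable (X : Type u) [DiffeologicalSpace X]

/-- Complex-valued differential `k`-forms on a diffeological space: a form assigns to every plot
`p : ℝⁿ → X` a smooth `k`-form `p^* θ` on `ℝⁿ`, in such a way that `(p ∘ f)^* θ = f^* (p^* θ)` for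
all smooth `f : ℝᵐ → ℝⁿ`. On a smooth manifold these are the usual differential forms. -/
def DForm (k : ℕ) :
    AddSubgroup (∀ n : ℕ, {p : E n → X // IsPlot p} → E n → (E n [⋀^Fin k]→L[ℝ] ℂ)) where
  carrier := {θ | (∀ n p, ContDiff ℝ ∞ (θ n p)) ∧
    ∀ (m n : ℕ) (p : {p : E n → X // IsPlot p}) (f : E m → E n) (hf : ContDiff ℝ ∞ f) (c : E m),
      θ m ⟨p.1 ∘ f, isPlot_reparam p.2 hf⟩ c =
        (θ n p (f c)).compContinuousLinearMap (fderiv ℝ f c)}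
  zero_mem' := ⟨fun _ _ => contDiff_const, fun _ _ _ _ _ _ => by ext; simp⟩
  add_mem' ha hb := ⟨fun n p => (ha.1 n p).add (hb.1 n p), fun m n p f hf c => by
    ext; simp [ha.2 m n p f hf c, hb.2 m n p f hf c]⟩
  neg_mem' ha := ⟨fun n p => (ha.1 n p).neg, fun m n p f hf c => by
    ext; simp [ha.2 m n p f hf c]⟩

/-- The group of smooth maps `X → ℂˣ`. -/
def SmoothUnits : Subgroup (X → ℂˣ) where
  carrier := {f | ∀ (n : ℕ) (p : E n → X), IsPlot p → ContDiff ℝ ∞ fun c => (f (p c) : ℂ)}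
  one_mem' := fun _ _ _ => contDiff_const
  mul_mem' ha hb := fun n p hp => by simpa using (ha n p hp).mul (hb n p hp)
  inv_mem' ha := fun n p hp => by
    simp only [Pi.inv_apply, Units.val_inv_eq_inv_val]
    exact (ha n p hp).inv fun c => Units.ne_zero _

variable {X} {Y : Type v} [DiffeologicalSpace Y] {Z : Type w} [DiffeologicalSpace Z]

namespace DForm

/-- The exterior derivative. -/
def d (k : ℕ) : DForm X k →+ DForm X (k + 1) where
  toFun θ := ⟨fun n p => extDeriv (θ.1 n p), fun n p => by
      exact (ContinuousAlternatingMap.alternatizeUncurryFinCLM ℝ (E n) ℂ).contDiff.comp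
        ((θ.2.1 n p).fderiv_right (m := ∞) (by simp)), fun m n p f hf c => by
      rw [← extDeriv_pullback (r := ∞) ((θ.2.1 n p).differentiable (by simp) _) hf.contDiffAt
        (by simp only [minSmoothness_of_isRCLikeNormedField]; exact ENat.LEInfty.out)]
      exact congrArg (fun F => extDeriv F c) (funext fun c => θ.2.2 m n p f hf c)⟩
  map_zero' := by
    ext1; funext n p c
    change extDeriv (fun _ => (0 : E n [⋀^Fin k]→L[ℝ] ℂ)) c = 0
    rw [extDeriv, fderiv_fun_const]
    exact map_zero (ContinuousAlternatingMap.alternatizeUncurryFinCLM ℝ (E n) ℂ)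
  map_add' a b := by
    ext1; funext n p c
    exact extDeriv_add ((a.2.1 n p).differentiable (by simp) _)
      ((b.2.1 n p).differentiable (by simp) _)

/-- The pull-back of a form along a smooth map. -/
def pullback (k : ℕ) (g : X → Y) (hg : DSmooth g) : DForm Y k →+ DForm X k where
  toFun θ := ⟨fun n p => θ.1 n ⟨g ∘ p.1, hg _ _ p.2⟩, fun _ _ => θ.2.1 _ _,
    fun m n p f hf c => θ.2.2 m n ⟨g ∘ p.1, hg _ _ p.2⟩ f hf c⟩
  map_zero' := rfl
  map_add' _ _ := rfl

end DForm

namespace SmoothUnits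

/-- The logarithmic derivative `f ↦ df / f`. -/
def dlog : Additive (SmoothUnits X) →+ DForm X 1 where
  toFun f := ⟨fun n p c => ContinuousAlternatingMap.ofSubsingleton ℝ (E n) ℂ (0 : Fin 1)
      ((f.toMul.1 (p.1 c) : ℂ)⁻¹ • fderiv ℝ (fun c => (f.toMul.1 (p.1 c) : ℂ)) c),
    fun n p => by
      have h := f.toMul.2 n p.1 p.2
      exact (ContinuousAlternatingMap.ofSubsingletonLIE (𝕜 := ℝ) (E := E n) (F := ℂ) (0 : Fin 1)).contDiff.comp
        ((h.inv fun c => Units.ne_zero _).smul (h.fderiv_right (m := ∞) (by simp))),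
    fun m n p g hg c => by
      have h : DifferentiableAt ℝ (fun c => (f.toMul.1 (p.1 c) : ℂ)) (g c) :=
        (f.toMul.2 n p.1 p.2).differentiable (by simp) _
      have h' := fderiv_comp c h (hg.differentiable (by simp) c)
      ext v
      change (f.toMul.1 (p.1 (g c)) : ℂ)⁻¹ •
        fderiv ℝ ((fun c => (f.toMul.1 (p.1 c) : ℂ)) ∘ g) c (v 0) =
        (f.toMul.1 (p.1 (g c)) : ℂ)⁻¹ •
        fderiv ℝ (fun c => (f.toMul.1 (p.1 c) : ℂ)) (g c) (fderiv ℝ g c (v 0))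
      rw [h']
      rfl⟩
  map_zero' := by
    ext n p c v
    change ((1 : ℂˣ) : ℂ)⁻¹ • fderiv ℝ (fun _ => (1 : ℂ)) c (v 0) = 0
    simp
  map_add' a b := by
    ext n p c v
    have ha : DifferentiableAt ℝ (fun c => (a.toMul.1 (p.1 c) : ℂ)) c :=
      (a.toMul.2 n p.1 p.2).differentiable (by simp) _
    have hb : DifferentiableAt ℝ (fun c => (b.toMul.1 (p.1 c) : ℂ)) c :=
      (b.toMul.2 n p.1 p.2).differentiable (by simp) _
    have h1 : (a.toMul.1 (p.1 c) : ℂ) ≠ 0 := Units.ne_zero _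
    have h2 : (b.toMul.1 (p.1 c) : ℂ) ≠ 0 := Units.ne_zero _
    change ((a.toMul.1 (p.1 c) : ℂ) * b.toMul.1 (p.1 c))⁻¹ •
      fderiv ℝ (fun c => (a.toMul.1 (p.1 c) : ℂ) * b.toMul.1 (p.1 c)) c (v 0) =
      (a.toMul.1 (p.1 c) : ℂ)⁻¹ • fderiv ℝ (fun c => (a.toMul.1 (p.1 c) : ℂ)) c (v 0) +
      (b.toMul.1 (p.1 c) : ℂ)⁻¹ • fderiv ℝ (fun c => (b.toMul.1 (p.1 c) : ℂ)) c (v 0)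
    rw [fderiv_fun_mul ha hb]
    simp
    field_simp
    ring

/-- The pull-back of a `ℂˣ`-valued function along a smooth map. -/
def pullback (g : X → Y) (hg : DSmooth g) :
    Additive (SmoothUnits Y) →+ Additive (SmoothUnits X) :=
  MonoidHom.toAdditive
    { toFun := fun f => ⟨fun x => f.1 (g x), fun _ _ hp => f.2 _ _ (hg _ _ hp)⟩
      map_one' := rfl
      map_mul' := fun _ _ => rfl }

end SmoothUnits

variable (X) in
/-- The groups of sections of the complex `ℂˣ → 𝒜¹ → 𝒜² → ⋯`. -/
def Deligne : ℕ → Type u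
  | 0 => Additive (SmoothUnits X)
  | l + 1 => DForm X (l + 1)

namespace Deligne

instance : ∀ l, AddCommGroup (Deligne X l)
  | 0 => inferInstanceAs (AddCommGroup (Additive (SmoothUnits X)))
  | l + 1 => inferInstanceAs (AddCommGroup (DForm X (l + 1)))

/-- The differentials `dlog : ℂˣ → 𝒜¹` and `d : 𝒜ˡ → 𝒜ˡ⁺¹`. -/
def d : ∀ l, Deligne X l →+ Deligne X (l + 1)
  | 0 => SmoothUnits.dlog
  | l + 1 => DForm.d (l + 1)

/-- Pull-back along a smooth map. -/
def pullback (g : X → Y) (hg : DSmooth g) : ∀ l, Deligne Y l →+ Deligne X l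
  | 0 => SmoothUnits.pullback g hg
  | l + 1 => DForm.pullback (l + 1) g hg

lemma d_pullback (g : X → Y) (hg : DSmooth g) : ∀ (l : ℕ) (x : Deligne Y l),
    d l (pullback g hg l x) = pullback g hg (l + 1) (d l x)
  | 0, _ => rfl
  | _ + 1, _ => rfl

lemma pullback_pullback (g : X → Y) (hg : DSmooth g) (h : Y → Z) (hh : DSmooth h) :
    ∀ (l : ℕ) (x : Deligne Z l),
      pullback g hg l (pullback h hh l x) = pullback (h ∘ g) (hh.comp hg) l x
  | 0, _ => rfl
  | _ + 1, _ => rfl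

/-- The value at `x` of a `ℂˣ`-valued function. -/
def value (f : Deligne X 0) (x : X) : ℂˣ := (Additive.toMul (α := SmoothUnits X) f).1 x

/-- The value `(p^* θ)_c (v₁, …, v_l)` of a form along a plot `p`. -/
def eval {l : ℕ} (θ : Deligne X (l + 1)) {n : ℕ} (p : E n → X) (hp : IsPlot p) (c : E n)
    (v : Fin (l + 1) → E n) : ℂ := (θ : DForm X (l + 1)).1 n ⟨p, hp⟩ c v

end Deligne

end Forms

/-! ### The Čech–Deligne complex -/

/-- Bidegrees `(k, l)` of total degree `m` with `l < p`. -/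
abbrev Bideg (p m : ℕ) : Type := {q : ℕ × ℕ // q.1 + q.2 = m ∧ q.2 < p}

/-- The group `Č^m(𝒢, ℂˣ(p))` of the total complex of the double complex `Γ(𝒢_k, 𝒜ˡ)`, `k ≥ 0`,
`0 ≤ l < p`, of the truncated complex `ℂˣ(p) : ℂˣ → 𝒜¹ → ⋯ → 𝒜ᵖ⁻¹`, where `𝒜⁰` stands for
`ℂˣ`. -/
abbrev Cochain (G : DGrpd.{u}) (p m : ℕ) : Type u :=
  ∀ q : Bideg p m, Deligne (Simplex G q.1.1) q.1.2

namespace Cochain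

variable {G : DGrpd.{u}} {p m : ℕ}

/-- The Čech differential `δ = ∑ₗ (-1)ˡ δₗ`. -/
def cech (G : DGrpd.{u}) (k l : ℕ) :
    Deligne (Simplex G k) l →+ Deligne (Simplex G (k + 1)) l :=
  ∑ i : Fin (k + 2), (-1 : ℤ) ^ (i : ℕ) •
    Deligne.pullback (Simplex.face i) (Simplex.smooth_face i) l

/-- The component of `δ x` in a given bidegree. -/
def horizontal (x : Cochain G p m) :
    ∀ q : Bideg p (m + 1), Deligne (Simplex G q.1.1) q.1.2
  | ⟨(0, _), _⟩ => 0
  | ⟨(k + 1, l), h⟩ => cech G k l (x ⟨(k, l), by simp only at h ⊢; omega⟩)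

/-- The component of `d x` in a given bidegree. -/
def vertical (x : Cochain G p m) :
    ∀ q : Bideg p (m + 1), Deligne (Simplex G q.1.1) q.1.2
  | ⟨(_, 0), _⟩ => 0
  | ⟨(k, l + 1), h⟩ => Deligne.d l (x ⟨(k, l), by simp only at h ⊢; omega⟩)

/-- The differential `δ + (-1)^(m+1) d` on cochains of degree `m`. -/
def D (G : DGrpd.{u}) (p m : ℕ) : Cochain G p m →+ Cochain G p (m + 1) where
  toFun x q := horizontal x q + (-1 : ℤ) ^ (m + 1) • vertical x q
  map_zero' := by
    funext ⟨⟨k, l⟩, h⟩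
    cases k <;> cases l <;> simp [horizontal, vertical]
  map_add' x y := by
    funext ⟨⟨k, l⟩, h⟩
    cases k <;> cases l <;> simp [horizontal, vertical]; abel

/-- Pull-back of cochains along a functor. -/
def pullback {H : DGrpd.{v}} (F : DFunctor G H) (p m : ℕ) : Cochain H p m →+ Cochain G p m where
  toFun x q := Deligne.pullback (Simplex.map F q.1.1) (Simplex.smooth_map F q.1.1) q.1.2 (x q)
  map_zero' := funext fun _ => map_zero _
  map_add' _ _ := funext fun _ => map_add _ _ _

/-- A cochain is normalized if its pull-backs along all degeneracies vanish. -/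
def IsNormalized (x : Cochain G p m) : Prop :=
  ∀ (k l : ℕ) (h : k + 1 + l = m ∧ l < p) (i : Fin (k + 1)),
    Deligne.pullback (Simplex.degen i) (Simplex.smooth_degen i) l (x ⟨(k + 1, l), h⟩) = 0

lemma cech_pullback {H : DGrpd.{v}} (F : DFunctor G H) (k l : ℕ) (x : Deligne (Simplex H k) l) :
    cech G k l (Deligne.pullback (Simplex.map F k) (Simplex.smooth_map F k) l x) =
      Deligne.pullback (Simplex.map F (k + 1)) (Simplex.smooth_map F (k + 1)) l (cech H k l x) := by
  simp only [cech, AddMonoidHom.finsetSum_apply, AddMonoidHom.smul_apply, map_sum, map_zsmul,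
    Deligne.pullback_pullback]
  rfl

/-- The differential commutes with the pull-back along functors. -/
lemma D_pullback {H : DGrpd.{v}} (F : DFunctor G H) (x : Cochain H p m) :
    D G p m (pullback F p m x) = pullback F p (m + 1) (D H p m x) := by
  funext ⟨⟨k, l⟩, h⟩
  cases k <;> cases l <;>
    simp [D, horizontal, vertical, pullback, cech_pullback, Deligne.d_pullback]

end Cochain

/-! ### Cohomology -/

section Cohomology

variable {C : ℕ → Type u} [∀ m, AddCommGroup (C m)] (d : ∀ m, C m →+ C (m + 1))

/-- The coboundaries of degree `m` of a complex `C⁰ → C¹ → ⋯`. -/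
def coboundaries : ∀ m, AddSubgroup (C m)
  | 0 => ⊥
  | m + 1 => (d m).range

/-- The cohomology of a complex `C⁰ → C¹ → ⋯`: cocycles modulo coboundaries. -/
abbrev Cohomology (m : ℕ) : Type u := (d m).ker ⧸ (coboundaries d m).addSubgroupOf (d m).ker

end Cohomology

/-! ### Smooth étale groupoids -/

/-- A smooth étale groupoid: objects and arrows form smooth (Hausdorff) manifolds, and source and
target are local diffeomorphisms (hence so are all the other structure maps). -/
structure SmoothEtaleGroupoid extends DGrpd.{u} where
  dim : ℕ
  [topOb : TopologicalSpace Ob]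
  [topAr : TopologicalSpace Ar]
  [t2Ob : T2Space Ob]
  [t2Ar : T2Space Ar]
  [chartOb : ChartedSpace (E dim) Ob]
  [chartAr : ChartedSpace (E dim) Ar]
  [mfdOb : IsManifold (𝓡 dim) ∞ Ob]
  [mfdAr : IsManifold (𝓡 dim) ∞ Ar]
  /-- The smooth families of objects are those of the manifold of objects. -/
  isPlot_ob : ∀ {n : ℕ} (p : E n → Ob), IsPlot p ↔ ContMDiff (𝓡 n) (𝓡 dim) ∞ p
  /-- The smooth families of arrows are those of the manifold of arrows. -/
  isPlot_ar : ∀ {n : ℕ} (p : E n → Ar), IsPlot p ↔ ContMDiff (𝓡 n) (𝓡 dim) ∞ p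
  etale_s : IsLocalDiffeomorph (𝓡 dim) (𝓡 dim) ∞ s
  etale_t : IsLocalDiffeomorph (𝓡 dim) (𝓡 dim) ∞ t

/-- A Leray groupoid: a smooth étale groupoid all of whose spaces `𝒢_k` of composable strings are
disjoint unions of contractible open sets. The topology on the manifold `𝒢_k` is recovered as the
finest one for which all smooth families are continuous. -/
structure LerayGroupoid extends SmoothEtaleGroupoid.{u} where
  leray : ∀ k : ℕ, ∃ (ι : Type u) (U : ι → Set (Simplex toDGrpd k)),
    (∀ i, @IsOpen _ dTopology (U i)) ∧ Pairwise (Function.onFun Disjoint U) ∧ ⋃ i, U i = univ ∧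
    ∀ i, @ContractibleSpace (U i) (@instTopologicalSpaceSubtype _ (· ∈ U i) dTopology)

/-! ### The circle and the loop groupoid -/

/-- An admissible cover of the circle whose division points contain the base point: a subdivision
`0 = α₀ < α₁ < ⋯ < α_N = 1`, extended to all of `ℝ` by `α_{i+N} = α_i + 1`, and a number `ε > 0`
so small that the intervals `V_i = (α_i - ε, α_{i+1} + ε)` have only the double intersections
`V_{i-1} ∩ V_i = (α_i - ε, α_i + ε)`. -/
structure AdmissibleCover where
  N : ℕ
  pt : ℤ → ℝ
  pt_zero : pt 0 = 0
  pt_add : ∀ i, pt (i + N) = pt i + 1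
  ε : ℝ
  ε_pos : 0 < ε
  sep : ∀ i, pt i + 2 * ε ≤ pt (i + 1)

namespace AdmissibleCover

variable (W W' : AdmissibleCover)

/-- The interval `V_i`. -/
def V (i : ℤ) : Set ℝ := Ioo (W.pt i - W.ε) (W.pt (i + 1) + W.ε)

lemma pt_add_mul (i m : ℤ) : W.pt (i + m * W.N) = W.pt i + m := by
  induction m using Int.induction_on with
  | zero => simp
  | succ k ih =>
    have := W.pt_add (i + k * W.N)
    push_cast at ih ⊢
    rw [show i + ((k : ℤ) + 1) * W.N = i + k * W.N + W.N by ring, this, ih]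
    ring
  | pred k ih =>
    have := W.pt_add (i + (-(k : ℤ) - 1) * W.N)
    rw [show i + (-(k : ℤ) - 1) * W.N + W.N = i + -(k : ℤ) * W.N by ring, ih] at this
    push_cast at this ⊢
    linarith

lemma mem_V_add {i : ℤ} {x : ℝ} (hx : x ∈ W.V i) (m : ℤ) : x + m ∈ W.V (i + m * W.N) := by
  have h := W.pt_add_mul i m
  have h' := W.pt_add_mul (i + 1) m
  rw [show i + 1 + m * W.N = i + m * W.N + 1 by ring] at h'
  simp only [V, mem_Ioo] at hx ⊢
  rw [h, h']
  constructor <;> linarith [hx.1, hx.2]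

lemma pt_lt (i : ℤ) : W.pt i < W.pt (i + 1) := by linarith [W.sep i, W.ε_pos]

/-- The points of the disjoint union `ℝ^W_0` of the intervals `V_i`. -/
@[ext]
structure Pt where
  i : ℤ
  x : ℝ
  mem : x ∈ W.V i

/-- The arrows `((x, V_i ∩ V_j), m) : (x, V_i) → (x + m, V_{j+mN})`, i.e. the points of
`ℝ^W_1 × ℤ`. -/
@[ext]
structure Arr where
  i : ℤ
  j : ℤ
  m : ℤ
  x : ℝ
  mem_i : x ∈ W.V i
  mem_j : x ∈ W.V j

/-- The smooth structure of a disjoint union of intervals: in a smooth family the index, being a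
smooth integer, is constant. -/
instance : DiffeologicalSpace W.Pt :=
  inducedDiffeology fun (a : Fin 2) (z : W.Pt) => (![(z.i : ℝ), z.x] a : ℝ)

instance : DiffeologicalSpace W.Arr :=
  inducedDiffeology fun (a : Fin 4) (z : W.Arr) => (![(z.i : ℝ), z.j, z.m, z.x] a : ℝ)

/-- The groupoid `S¹_W` of an admissible cover of the circle. -/
def circle : DGrpd.{0} where
  Ob := W.Pt
  Ar := W.Arr
  dOb := inferInstance
  dAr := inferInstance
  s r := ⟨r.i, r.x, r.mem_i⟩
  t r := ⟨r.j + r.m * W.N, r.x + r.m, W.mem_V_add r.mem_j r.m⟩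
  e z := ⟨z.i, z.i, 0, z.x, z.mem, z.mem⟩
  inv r := ⟨r.j + r.m * W.N, r.i + r.m * W.N, -r.m, r.x + r.m, W.mem_V_add r.mem_j r.m,
    W.mem_V_add r.mem_i r.m⟩
  mul r r' H := ⟨r.i, r'.j - r.m * W.N, r.m + r'.m, r.x, r.mem_i, by
    have h : r.x + r.m = r'.x := congrArg Pt.x H
    have := W.mem_V_add r'.mem_j (-r.m)
    rw [← h] at this
    simpa [sub_eq_add_neg] using this⟩
  s_e z := rfl
  t_e z := by ext <;> simp
  s_inv r := rfl
  t_inv r := by ext <;> simp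
  s_mul r r' H := rfl
  t_mul r r' H := by
    have h : r.x + r.m = r'.x := congrArg Pt.x H
    ext
    · simp; ring
    · simp [← h]; ring
  e_mul z r H := by
    have h : z.x + (0 : ℤ) = r.x := congrArg Pt.x H
    have h' : z.i + 0 * W.N = r.i := congrArg Pt.i H
    ext <;> simp_all
  mul_e r z H := by
    have h : r.j + r.m * W.N = z.i := congrArg Pt.i H
    ext <;> simp [← h]
  mul_inv r := by ext <;> simp
  inv_mul r := by ext <;> simp
  assoc r r' r'' H K := by ext <;> simp <;> ring
  smooth_s n p hp := fun a => by
    fin_cases a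
    exacts [hp 0, hp 3]
  smooth_t n p hp := fun a => by
    have hj : ContDiff ℝ ∞ fun c => ((p c).j : ℝ) := (hp 1).contDiff
    have hm : ContDiff ℝ ∞ fun c => ((p c).m : ℝ) := (hp 2).contDiff
    have hx : ContDiff ℝ ∞ fun c => (p c).x := (hp 3).contDiff
    apply ContDiff.isPlot
    fin_cases a <;> simp [Function.comp_def] <;> fun_prop
  smooth_e n p hp := fun a => by
    fin_cases a
    exacts [hp 0, hp 0, by simpa [Function.comp_def] using isPlot_const, hp 1]
  smooth_inv n p hp := fun a => by
    have hi : ContDiff ℝ ∞ fun c => ((p c).i : ℝ) := (hp 0).contDiff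
    have hj : ContDiff ℝ ∞ fun c => ((p c).j : ℝ) := (hp 1).contDiff
    have hm : ContDiff ℝ ∞ fun c => ((p c).m : ℝ) := (hp 2).contDiff
    have hx : ContDiff ℝ ∞ fun c => (p c).x := (hp 3).contDiff
    apply ContDiff.isPlot
    fin_cases a <;> simp [Function.comp_def] <;> fun_prop
  smooth_mul {n p q} H hp hq := fun a => by
    have hi : ContDiff ℝ ∞ fun c => ((p c).i : ℝ) := (hp 0).contDiff
    have hm : ContDiff ℝ ∞ fun c => ((p c).m : ℝ) := (hp 2).contDiff
    have hx : ContDiff ℝ ∞ fun c => (p c).x := (hp 3).contDiff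
    have hj' : ContDiff ℝ ∞ fun c => ((q c).j : ℝ) := (hq 1).contDiff
    have hm' : ContDiff ℝ ∞ fun c => ((q c).m : ℝ) := (hq 2).contDiff
    apply ContDiff.isPlot
    fin_cases a <;> simp [Function.comp_def] <;> fun_prop

/-- `W'` is a refinement of `W`: each interval of the subdivision of `W'` lies in an interval of
that of `W` (its number is `idx i`), and `ε' ≤ ε`. -/
structure Refinement (W W' : AdmissibleCover) where
  idx : ℤ → ℤ
  le_pt : ∀ i, W.pt (idx i) ≤ W'.pt i
  pt_le : ∀ i, W'.pt (i + 1) ≤ W.pt (idx i + 1)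
  ε_le : W'.ε ≤ W.ε

variable {W W'}

lemma strictMono_pt (W : AdmissibleCover) : StrictMono W.pt :=
  strictMono_int_of_lt_succ fun i => W.pt_lt i

namespace Refinement

lemma idx_add (ρ : Refinement W W') (i m : ℤ) :
    ρ.idx (i + m * W'.N) = ρ.idx i + m * W.N := by
  have h1 := W'.pt_add_mul i m
  have h2 := W'.pt_add_mul (i + 1) m
  have h3 := W.pt_add_mul (ρ.idx i) m
  have h4 := W.pt_add_mul (ρ.idx i + 1) m
  have h5 := ρ.le_pt (i + m * W'.N)
  have h6 := ρ.pt_le (i + m * W'.N)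
  have h7 := W'.pt_lt (i + m * W'.N)
  have h8 := W'.pt_lt i
  have h9 := ρ.le_pt i
  have h10 := ρ.pt_le i
  rw [show i + 1 + m * W'.N = i + m * W'.N + 1 by ring] at h2
  rw [show ρ.idx i + 1 + m * W.N = ρ.idx i + m * W.N + 1 by ring] at h4
  have a : ρ.idx (i + m * W'.N) < ρ.idx i + m * W.N + 1 :=
    W.strictMono_pt.lt_iff_lt.1 (by linarith)
  have b : ρ.idx i + m * W.N < ρ.idx (i + m * W'.N) + 1 :=
    W.strictMono_pt.lt_iff_lt.1 (by linarith)
  omega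

lemma mem_V (ρ : Refinement W W') {i : ℤ} {x : ℝ} (hx : x ∈ W'.V i) : x ∈ W.V (ρ.idx i) :=
  ⟨by linarith [hx.1, ρ.le_pt i, ρ.ε_le], by linarith [hx.2, ρ.pt_le i, ρ.ε_le]⟩

/-- In a smooth family the index is constant. -/
lemma eq_of_contDiff {n : ℕ} {f : E n → ℤ} (hf : ContDiff ℝ ∞ fun c => (f c : ℝ)) (c c' : E n) :
    f c = f c' := by
  have : Continuous f := Int.isClosedEmbedding_coe_real.isInducing.continuous_iff.2 hf.continuous
  exact PreconnectedSpace.constant inferInstance this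

lemma contDiff_idx {n : ℕ} {f : E n → ℤ} (hf : ContDiff ℝ ∞ fun c => (f c : ℝ)) (g : ℤ → ℤ) :
    ContDiff ℝ ∞ fun c => (g (f c) : ℝ) := by
  have : (fun c => (g (f c) : ℝ)) = fun _ => (g (f 0) : ℝ) :=
    funext fun c => by rw [eq_of_contDiff hf c 0]
  rw [this]
  exact contDiff_const

/-- The natural morphism `S¹_{W'} → S¹_W` of a refinement. -/
def functor (ρ : Refinement W W') : DFunctor W'.circle W.circle where
  ob z := (⟨ρ.idx z.i, z.x, ρ.mem_V z.mem⟩ : W.Pt)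
  ar r := (⟨ρ.idx r.i, ρ.idx r.j, r.m, r.x, ρ.mem_V r.mem_i, ρ.mem_V r.mem_j⟩ : W.Arr)
  smooth_ob n p hp := fun a => by
    have hi := contDiff_idx (hp 0).contDiff ρ.idx
    fin_cases a
    exacts [hi.isPlot, hp 1]
  smooth_ar n p hp := fun a => by
    have hi := contDiff_idx (hp 0).contDiff ρ.idx
    have hj := contDiff_idx (hp 1).contDiff ρ.idx
    fin_cases a
    exacts [hi.isPlot, hj.isPlot, hp 2, hp 3]
  s_ar r := rfl
  t_ar r := Pt.ext (ρ.idx_add r.j r.m).symm rfl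
  map_e z := rfl
  map_mul r r' H := by
    refine Arr.ext rfl ?_ rfl rfl
    have := ρ.idx_add r'.j (-r.m)
    change ρ.idx (r'.j - r.m * W'.N) = ρ.idx r'.j - r.m * W.N
    rw [show r'.j - r.m * W'.N = r'.j + -r.m * W'.N by ring, this]
    ring

end Refinement

end AdmissibleCover

/-- The loop groupoid `L𝒢(W)` of an admissible cover `W` of the circle. -/
abbrev loopGrpd (W : AdmissibleCover) (G : DGrpd.{u}) : DGrpd.{u} := funGrpd W.circle G

/-- The inclusion `L𝒢(W) → L𝒢(W')` of a refinement. -/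
abbrev loopIncl {W W' : AdmissibleCover} (ρ : W.Refinement W') (G : DGrpd.{u}) :
    DFunctor (loopGrpd W G) (loopGrpd W' G) :=
  DFunctor.precomp ρ.functor G

/-- The functor `L𝒢(W) → Lℋ(W)` induced by `F : 𝒢 → ℋ`. -/
abbrev loopMap (W : AdmissibleCover) {G H : DGrpd.{u}} (F : DFunctor G H) :
    DFunctor (loopGrpd W G) (loopGrpd W H) :=
  DFunctor.postcomp W.circle F

/-- The group `Č^m(L𝒢, ℂˣ(p))` of the loop groupoid `L𝒢 = colim_W L𝒢(W)`. Forms and functions on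
the spaces of strings of this union are compatible families of forms and functions on the spaces
of strings of the groupoids `L𝒢(W)`. -/
def LoopCochain (G : DGrpd.{u}) (p m : ℕ) :
    AddSubgroup (∀ W : AdmissibleCover, Cochain (loopGrpd W G) p m) where
  carrier := {x | ∀ (W W' : AdmissibleCover) (ρ : W.Refinement W'),
    Cochain.pullback (loopIncl ρ G) p m (x W') = x W}
  zero_mem' := fun _ _ _ => map_zero _
  add_mem' ha hb := fun W W' ρ => by
    rw [Pi.add_apply, Pi.add_apply, map_add, ha W W' ρ, hb W W' ρ]
  neg_mem' ha := fun W W' ρ => by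
    rw [Pi.neg_apply, Pi.neg_apply, map_neg, ha W W' ρ]

namespace LoopCochain

/-- The differential of the complex of the loop groupoid. -/
def D (G : DGrpd.{u}) (p m : ℕ) : LoopCochain G p m →+ LoopCochain G p (m + 1) where
  toFun x := ⟨fun W => Cochain.D _ p m (x.1 W), fun W W' ρ => by
    rw [← Cochain.D_pullback, x.2 W W' ρ]⟩
  map_zero' := Subtype.ext (funext fun _ => map_zero _)
  map_add' _ _ := Subtype.ext (funext fun _ => map_add _ _ _)

/-- Restriction to the loop groupoid of a cover. -/
def restrict (G : DGrpd.{u}) (p m : ℕ) (W : AdmissibleCover) :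
    LoopCochain G p m →+ Cochain (loopGrpd W G) p m where
  toFun x := x.1 W
  map_zero' := rfl
  map_add' _ _ := rfl

end LoopCochain

namespace LoopCochain

/-- Pull-back along the morphism of loop groupoids induced by `F : 𝒢 → ℋ`. -/
def pullback {G H : DGrpd.{u}} (F : DFunctor G H) (p m : ℕ) :
    LoopCochain H p m →+ LoopCochain G p m where
  toFun x := ⟨fun W => Cochain.pullback (loopMap W F) p m (x.1 W), fun W W' ρ => by
    funext q
    have h := congrFun (x.2 W W' ρ) q
    change Deligne.pullback _ (Simplex.smooth_map _ _) _
      (Deligne.pullback _ (Simplex.smooth_map _ _) _ (x.1 W' q)) = _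
    rw [Deligne.pullback_pullback]
    change _ = Deligne.pullback (Simplex.map (loopMap W F) q.1.1) (Simplex.smooth_map _ _) _ (x.1 W q)
    rw [← h]
    change _ = Deligne.pullback _ (Simplex.smooth_map _ _) _
      (Deligne.pullback _ (Simplex.smooth_map _ _) _ (x.1 W' q))
    rw [Deligne.pullback_pullback]
    rfl⟩
  map_zero' := Subtype.ext (funext fun _ => map_zero _)
  map_add' _ _ := Subtype.ext (funext fun _ => map_add _ _ _)

end LoopCochain

/-! ### Transgression -/

/-- The projection `(t, c) ↦ c` of `ℝ × ℝᵈ`. -/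
def tail {d : ℕ} (w : E (d + 1)) : E d := WithLp.toLp 2 fun a => w a.succ

/-- The point `(t, c)` of `ℝ × ℝᵈ`. -/
def cons {d : ℕ} (t : ℝ) (c : E d) : E (d + 1) := WithLp.toLp 2 (Fin.cons t fun a => c a)

lemma contDiff_tail {d : ℕ} : ContDiff ℝ ∞ (tail : E (d + 1) → E d) :=
  contDiff_euclidean.2 fun a => by simp only [tail]; fun_prop

namespace AdmissibleCover

variable (W : AdmissibleCover)

/-- A bump function around `[α_i, α_{i+1}]`, supported in the closure of `V_i`. -/
def bump (i : ℤ) : ContDiffBump ((W.pt i + W.pt (i + 1)) / 2) where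
  rIn := (W.pt (i + 1) - W.pt i) / 2
  rOut := (W.pt (i + 1) - W.pt i) / 2 + W.ε
  rIn_pos := by linarith [W.pt_lt i]
  rIn_lt_rOut := by linarith [W.ε_pos]

/-- A smooth map `ℝ → V_i` which is the identity on `[α_i, α_{i+1}]`. -/
def clamp (i : ℤ) (t : ℝ) : ℝ :=
  (W.pt i + W.pt (i + 1)) / 2 + (t - (W.pt i + W.pt (i + 1)) / 2) * W.bump i t

lemma contDiff_clamp (i : ℤ) : ContDiff ℝ ∞ (W.clamp i) := by
  unfold clamp
  exact contDiff_const.add ((contDiff_id.sub contDiff_const).mul (W.bump i).contDiff)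

lemma clamp_eq {i : ℤ} {t : ℝ} (ht : t ∈ Icc (W.pt i) (W.pt (i + 1))) : W.clamp i t = t := by
  have : W.bump i t = 1 := by
    apply ContDiffBump.one_of_mem_closedBall
    rw [Metric.mem_closedBall, Real.dist_eq, abs_le]
    constructor <;> simp only [bump] <;> linarith [ht.1, ht.2]
  rw [clamp, this]
  ring

lemma clamp_mem (i : ℤ) (t : ℝ) : W.clamp i t ∈ W.V i := by
  have hε := W.ε_pos
  have hi := W.pt_lt i
  have h : |(t - (W.pt i + W.pt (i + 1)) / 2) * W.bump i t| <
      (W.pt (i + 1) - W.pt i) / 2 + W.ε := by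
    by_cases ht : |t - (W.pt i + W.pt (i + 1)) / 2| < (W.pt (i + 1) - W.pt i) / 2 + W.ε
    · rw [abs_mul, abs_of_nonneg (W.bump i).nonneg]
      exact (mul_le_of_le_one_right (abs_nonneg _) (W.bump i).le_one).trans_lt ht
    · have : W.bump i t = 0 := (W.bump i).zero_of_le_dist (by
        rw [Real.dist_eq]; exact not_lt.1 ht)
      rw [this, mul_zero, abs_zero]
      linarith
  rw [abs_lt] at h
  constructor <;> simp only [clamp] <;> linarith [h.1, h.2]

/-- The arrow of `S¹_W` over the division point `α_{i+1}`, from `(α_{i+1}, V_i)` to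
`(α_{i+1}, V_{i+1})` if `i + 1 < N`, and from `(1, V_{N-1})` to `(0, V_0)` if `i + 1 = N`. -/
def junction (i : ℕ) : W.circle.Ar :=
  (⟨i, i + 1, if i + 1 = W.N then -1 else 0, W.pt (i + 1),
    ⟨by linarith [W.pt_lt i, W.ε_pos], by linarith [W.ε_pos]⟩,
    ⟨by linarith [W.ε_pos], by linarith [W.pt_lt (i + 1), W.ε_pos]⟩⟩ : W.Arr)

end AdmissibleCover

section Transgression

variable (W : AdmissibleCover) {G : DGrpd.{u}} {r d : ℕ}

/-- For a smooth family `P` of strings `Λ` of `r` arrows of `L𝒢(W)`, the smooth family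
`(t, c) ↦ (P c)_i(t)` of strings of `𝒢`, where `Λ_i : V_i → 𝒢_r` is the restriction of `Λ` to the
identity arrows over `V_i`. The time is clamped to `V_i`, which changes nothing for
`t ∈ [α_i, α_{i+1}]`. -/
def sweep (P : E d → Simplex (loopGrpd W G) r) (i : ℤ) (w : E (d + 1)) : Simplex G r :=
  Simplex.eval _root_.id
    (Simplex.const r (⟨i, W.clamp i (w 0), W.clamp_mem i _⟩ : W.circle.Ob)) (P (tail w))

lemma isPlot_sweep {P : E d → Simplex (loopGrpd W G) r} (hP : IsPlot P) (i : ℤ) :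
    IsPlot (sweep W P i) := by
  refine Simplex.isPlot_eval _ (Simplex.isPlot_const_comp r fun a => ?_)
    (isPlot_reparam hP contDiff_tail)
  have h : ContDiff ℝ ∞ fun w : E (d + 1) => W.clamp i (w 0) :=
    (W.contDiff_clamp i).comp (by fun_prop)
  fin_cases a
  exacts [isPlot_const (X := ℝ) (x := (i : ℝ)), h.isPlot]

/-- `∑ᵢ ∫_{I_i} θ (dΛ_i/dt, Ξ¹_i, …, Ξˡ_i) dt` over the intervals `I_i = [α_i, α_{i+1}]` of `[0, 1]`,
for a family `P` of strings `Λ` at the parameter `c` and the tangent vectors `Ξ^a` given by the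
derivatives of `P` in the directions `v a`. -/
def loopIntegral {l : ℕ} (θ : Deligne (Simplex G r) (l + 1)) (P : E d → Simplex (loopGrpd W G) r)
    (hP : IsPlot P) (c : E d) (v : Fin l → E d) : ℂ :=
  ∑ i ∈ Finset.range W.N, ∫ t in (W.pt i)..(W.pt (i + 1)),
    θ.eval (sweep W P i) (isPlot_sweep W hP i) (cons t c)
      (Fin.cons (cons 1 0) fun a => cons 0 (v a))

/-- The string `ϑ_j Λ (α_{i+1}) = (Λ¹_i, …, Λʲ_i, ψʲ, Λʲ⁺¹_{i+1}, …, Λʳ_{i+1})(α_{i+1})`, where `ψʲ` is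
the `j`-th of the loops joined by `Λ`. -/
def prism (i : ℕ) (j : Fin (r + 1)) (Λ : Simplex (loopGrpd W G) r) : Simplex G (r + 1) :=
  Simplex.eval j.predAbove
    (Simplex.ofArrow (W.junction i) (r + 1) fun a => decide (j.castSucc < a)) Λ

lemma isPlot_prism {P : E d → Simplex (loopGrpd W G) r} (hP : IsPlot P) (i : ℕ) (j : Fin (r + 1)) :
    IsPlot fun c => prism W i j (P c) :=
  Simplex.isPlot_eval _ (isPlot_const (x := Simplex.ofArrow (W.junction i) (r + 1) fun a => decide (j.castSucc < a))) hP

/-- `y = τ x`: the cochain `y = (F, Δ¹, Δ², …)` of `L𝒢(W)` of degree `m` is the transgression of the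
cochain `x = (h, θ¹, θ², …)` of `𝒢` of degree `m + 1`, that is
`F(Λ) = exp (∑ᵢ ∫_{I_i} Λ_i^* θ¹) ∏ᵢ ∏ⱼ h(ϑ_j Λ(α_{i+1}))^((-1)^(j+m+1))` and
`⟨Δˡ, (Ξ¹, …, Ξˡ)⟩ = ∑ᵢ ∫_{I_i} θˡ⁺¹(dΛ_i/dt, Ξ¹_i, …, Ξˡ_i) dt +
∑ᵢ ∑ⱼ (-1)^(j+m+1) ⟨θˡ, (ϑ_j Ξ¹(α_{i+1}), …, ϑ_j Ξˡ(α_{i+1}))⟩`. -/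
structure IsTransgression {n m : ℕ} (x : Cochain G (n + 1) (m + 1))
    (y : Cochain (loopGrpd W G) n m) : Prop where
  function : ∀ (r : ℕ) (h : r + 0 = m ∧ 0 < n) (Λ : Simplex (loopGrpd W G) r),
    (Deligne.value (y ⟨(r, 0), h⟩) Λ : ℂ) =
      Complex.exp (loopIntegral W (l := 0) (x ⟨(r, 1), by simp only; omega⟩) (fun _ : E 0 => Λ)
        isPlot_const 0 Fin.elim0) *
      ((∏ i ∈ Finset.range W.N, ∏ j : Fin (r + 1),
        Deligne.value (x ⟨(r + 1, 0), by simp only; omega⟩) (prism W i j Λ) ^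
          ((-1 : ℤ) ^ ((j : ℕ) + (m + 1))) : ℂˣ) : ℂ)
  form : ∀ (r l : ℕ) (h : r + (l + 1) = m ∧ l + 1 < n) (d : ℕ)
    (P : E d → Simplex (loopGrpd W G) r) (hP : IsPlot P) (c : E d) (v : Fin (l + 1) → E d),
    Deligne.eval (y ⟨(r, l + 1), h⟩) P hP c v =
      loopIntegral W (l := l + 1) (x ⟨(r, l + 2), by simp only; omega⟩) P hP c v +
      ∑ i ∈ Finset.range W.N, ∑ j : Fin (r + 1), (-1 : ℂ) ^ ((j : ℕ) + (m + 1)) *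
        Deligne.eval (x ⟨(r + 1, l + 1), by simp only; omega⟩) (fun c => prism W i j (P c))
          (isPlot_prism W hP i j) c v

end Transgression

/-! ### Cochain maps of degree `-1` and gerbes -/

section CochainMap

variable {C : ℕ → Type u} [∀ m, AddCommGroup (C m)] {C' : ℕ → Type v} [∀ m, AddCommGroup (C' m)]

/-- `f` is a cochain map of degree `-1` between complexes in degrees `≥ 0`. -/
structure IsCochainMap (d : ∀ m, C m →+ C (m + 1)) (d' : ∀ m, C' m →+ C' (m + 1))
    (f : ∀ m, C (m + 1) →+ C' m) : Prop where
  zero : ∀ x : C 0, f 0 (d 0 x) = 0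
  succ : ∀ (m : ℕ) (x : C (m + 1)), f (m + 1) (d (m + 1) x) = d' m (f m x)

/-- `f` maps cocycles to cocycles and induces `T` on cohomology classes. -/
def Induces {d : ∀ m, C m →+ C (m + 1)} {d' : ∀ m, C' m →+ C' (m + 1)}
    (f : ∀ m, C (m + 1) →+ C' m) (T : ∀ m, Cohomology d (m + 1) →+ Cohomology d' m) : Prop :=
  ∀ (m : ℕ) (z : (d (m + 1)).ker), ∃ h : f m z ∈ (d' m).ker,
    T m (QuotientAddGroup.mk z) = QuotientAddGroup.mk ⟨f m z, h⟩

end CochainMap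

/-- The `(k-1)`-gerbes with connective structure over `𝒢`: the `k`-cocycles of `Č(𝒢, ℂˣ(k+1))`. -/
def gerbes (G : DGrpd.{u}) (k : ℕ) : AddSubgroup (Cochain G (k + 1) k) :=
  (Cochain.D G (k + 1) k).ker

/-- The `(k-1)`-gerbes with connective structure over the loop groupoid `L𝒢`. -/
def loopGerbes (G : DGrpd.{u}) (k : ℕ) : AddSubgroup (LoopCochain G (k + 1) k) :=
  (LoopCochain.D G (k + 1) k).ker

/-- The Deligne cohomology `H^m(𝒢, ℂˣ(p))`, computed by the Čech complex. -/
abbrev DeligneCohomology (G : DGrpd.{u}) (p m : ℕ) : Type u := Cohomology (Cochain.D G p) m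

/-- The Deligne cohomology `H^m(L𝒢, ℂˣ(p))` of the loop groupoid. -/
abbrev LoopDeligneCohomology (G : DGrpd.{u}) (p m : ℕ) : Type u :=
  Cohomology (C := fun m => LoopCochain G p m) (LoopCochain.D G p) m

end LoopDeligne

end

open LoopDeligne

noncomputable section

namespace LoopDeligne

open Set Diffeology
open scoped Manifold ContDiff Topology

/-! ### Integrals depending on parameters -/

section ParametricIntegral

variable {H V : Type} [NormedAddCommGroup H] [NormedSpace ℝ H] [ProperSpace H]
  [NormedAddCommGroup V] [NormedSpace ℝ V]

/-! The map `τ^W` is a sum of two operators: integration over the arcs `I_i`, and the signed sums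
`∑ⱼ (-1)ʲ ϑ_j^*` at the division points. Each of them is a homotopy between two evaluations of
loops, one for `d` and one for `δ`.

Stokes' theorem along the evaluation homotopy gives `∫ d + d ∫ =` (value at the end of the arc) `-`
(value at its start); see `fiberIntegral_d_succ`. In the bottom degree integrals are exponentiated,
and `exp ∫ dlog h` is the quotient of the end values of `h` (`fiberIntegral_d_zero`). The operators
`ϑ_j` decompose the prism `Δʳ × Δ¹` over the junction arrow, so `P δ + δ P =` (value at the target)
`-` (value at the source); see `prismOp_cech_succ`. Junction `i` runs from the end of arc `i` to the
start of arc `i + 1`, and the last one winds back to the start of arc `0`, so all boundary values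
around the circle cancel (`sum_boundary`). Since `∫` commutes with `δ` and `P` with `d`, the signs
`(-1)^(m+1)` turn this cancellation into `τ D = D τ` (`transgression_D`).

Under refinement the integrals are additive, but every new division point contributes a prism over
an identity arrow. There `ϑ_j` is a degeneracy, so this term vanishes on normalized cochains
(`prismOp_e`), but not in general. Therefore `τ` is defined as `τ^W` after a projection `N` onto
normalized cochains, which gives a family compatible with refinements (`pullback_transgression`).

The projection is the Dold–Kan projector of the cosimplicial group of forms on the spaces of
strings. It is natural, commutes with `δ` and `d`, fixes normalized cochains, and is homotopic to
the identity. On a cocycle `x` the homotopy yields `N x - x = D y`, and applying `τ^W` shows that `τ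
x` and `τ^W x` differ by a coboundary over `L𝒢(W)` (`restrict_loopTransgression_sub_mem`). -/

lemma hasFDerivAt_intervalIntegral {F : H → ℝ → V} (hF : ContDiff ℝ 1 (Function.uncurry F))
    (a b : ℝ) (x : H) :
    HasFDerivAt (fun x => ∫ t in a..b, F x t) (∫ t in a..b, fderiv ℝ (fun x => F x t) x) x := by
  have hG : Continuous (Function.uncurry fun (x : H) (t : ℝ) => fderiv ℝ (fun x => F x t) x) := by
    have h : ContDiff ℝ 0 fun z : H × ℝ => fderiv ℝ (fun x => F x z.2) z.1 :=
      ContDiff.fderiv (m := 1) (f := fun (z : H × ℝ) x => F x z.2)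
        (hF.comp (contDiff_snd.prodMk (contDiff_snd.comp contDiff_fst))) contDiff_fst (by simp)
    exact h.continuous
  have hFc : ∀ x, Continuous (F x) := fun x =>
    hF.continuous.comp (f := fun t : ℝ => (x, t)) (by fun_prop)
  have hGc : ∀ x, Continuous fun t => fderiv ℝ (fun x => F x t) x := fun x =>
    hG.comp (f := fun t : ℝ => (x, t)) (by fun_prop)
  -- The partial derivative is jointly continuous, hence bounded on the compact set (closed unit
  -- ball at `x`) × `[a, b]`. This constant is the dominating function.
  obtain ⟨C, hC⟩ := ((isCompact_closedBall x 1).prod (isCompact_uIcc (a := a) (b := b))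
    ).exists_bound_of_continuousOn hG.continuousOn
  refine intervalIntegral.hasFDerivAt_integral_of_dominated_of_fderiv_le (bound := fun _ => C)
    (Metric.ball_mem_nhds x one_pos) (Filter.Eventually.of_forall fun y =>
      (hFc y).aestronglyMeasurable) ((hFc x).intervalIntegrable _ _)
    (hGc x).aestronglyMeasurable
    (Filter.Eventually.of_forall fun t ht y hy => hC (y, t) ⟨Metric.ball_subset_closedBall hy,
      uIoc_subset_uIcc ht⟩) intervalIntegrable_const
    (Filter.Eventually.of_forall fun t _ y _ => ?_)
  have h : ContDiff ℝ 1 fun x => F x t := hF.comp (f := fun x : H => (x, t)) (by fun_prop)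
  exact (h.differentiable (by simp) y).hasFDerivAt

/-- Induction by differentiating under the integral. The target `V` is quantified after `n` because
the derivative takes values in `H →L[ℝ] V`. -/
lemma contDiff_intervalIntegral_nat (n : ℕ) : ∀ {V : Type} [NormedAddCommGroup V]
    [NormedSpace ℝ V] {F : H → ℝ → V}, ContDiff ℝ n (Function.uncurry F) → ∀ a b : ℝ,
    ContDiff ℝ n fun x => ∫ t in a..b, F x t := by
  induction n with
  | zero =>
    intro V _ _ F hF a b
    exact contDiff_zero.2 (intervalIntegral.continuous_parametric_intervalIntegral_of_continuous'
      hF.continuous a b)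
  | succ n ih =>
    intro V _ _ F hF a b
    push_cast at hF ⊢
    have h1 : ContDiff ℝ 1 (Function.uncurry F) := hF.of_le (by simp)
    refine (contDiff_succ_iff_fderiv (n := n)).2
      ⟨fun x => (hasFDerivAt_intervalIntegral h1 a b x).differentiableAt, by simp, ?_⟩
    have : (fderiv ℝ fun x => ∫ t in a..b, F x t) =
        fun x => ∫ t in a..b, fderiv ℝ (fun x => F x t) x :=
      funext fun x => (hasFDerivAt_intervalIntegral h1 a b x).fderiv
    rw [this]
    refine ih ?_ a b
    exact ContDiff.fderiv (m := n + 1) (f := fun (z : H × ℝ) x => F x z.2)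
      (hF.comp (contDiff_snd.prodMk (contDiff_snd.comp contDiff_fst))) contDiff_fst le_rfl

lemma contDiff_intervalIntegral {F : H → ℝ → V} (hF : ContDiff ℝ ∞ (Function.uncurry F))
    (a b : ℝ) : ContDiff ℝ ∞ fun x => ∫ t in a..b, F x t :=
  contDiff_infty.2 fun n => contDiff_intervalIntegral_nat n (contDiff_infty.1 hF n) a b

end ParametricIntegral

/-! ### The splitting `ℝᵈ⁺¹ = ℝ × ℝᵈ` -/

/-- The inclusion `v ↦ (0, v)`. -/
def consL (d : ℕ) : E d →L[ℝ] E (d + 1) :=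
  LinearMap.toContinuousLinearMap
    { toFun := cons 0
      map_add' := fun x y => by
        ext a; refine Fin.cases ?_ (fun a => ?_) a <;> simp [cons]
      map_smul' := fun c x => by
        ext a; refine Fin.cases ?_ (fun a => ?_) a <;> simp [cons] }

@[simp] lemma consL_apply {d : ℕ} (v : E d) : consL d v = cons 0 v := rfl

lemma cons_eq {d : ℕ} (t : ℝ) (c : E d) : cons t c = t • cons 1 0 + consL d c := by
  ext a; refine Fin.cases ?_ (fun a => ?_) a <;> simp [cons]

lemma contDiff_cons {d : ℕ} {n : WithTop ℕ∞} : ContDiff ℝ n fun z : E d × ℝ => cons z.2 z.1 := by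
  have : (fun z : E d × ℝ => cons z.2 z.1) = fun z => z.2 • cons 1 0 + consL d z.1 :=
    funext fun z => cons_eq _ _
  rw [this]
  fun_prop

lemma hasFDerivAt_cons {d : ℕ} (t : ℝ) (c : E d) : HasFDerivAt (cons t) (consL d) c := by
  have : (cons t : E d → E (d + 1)) = fun c => t • cons 1 0 + consL d c := funext (cons_eq t)
  rw [this]
  exact (consL d).hasFDerivAt.const_add _

/-- Contraction of a form on `ℝ × ℝᵈ` with the unit vector of `ℝ`, restricted to `ℝᵈ`. -/
def contract (d l : ℕ) : (E (d + 1) [⋀^Fin (l + 1)]→L[ℝ] ℂ) →L[ℝ] (E d [⋀^Fin l]→L[ℝ] ℂ) :=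
  (ContinuousAlternatingMap.compContinuousLinearMapCLM (consL d)).comp
    ((ContinuousLinearMap.apply ℝ (E (d + 1) [⋀^Fin l]→L[ℝ] ℂ) (cons 1 0)).comp
      ContinuousAlternatingMap.curryLeftLI.toContinuousLinearMap)

lemma contract_apply {d l : ℕ} (η : E (d + 1) [⋀^Fin (l + 1)]→L[ℝ] ℂ) (v : Fin l → E d) :
    contract d l η v = η (Fin.cons (cons 1 0) fun a => cons 0 (v a)) := rfl

open ContinuousAlternatingMap in
/-- Cartan's formula for the contraction with a constant vector field. -/
lemma contract_alternatizeUncurryFin {d l : ℕ}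
    (A : E (d + 1) →L[ℝ] E (d + 1) [⋀^Fin (l + 1)]→L[ℝ] ℂ) :
    contract d (l + 1) (alternatizeUncurryFin A) +
      alternatizeUncurryFin ((contract d l).comp (A.comp (consL d))) =
    (A (cons 1 0)).compContinuousLinearMap (consL d) := by
  ext v
  simp only [ContinuousAlternatingMap.add_apply, contract_apply, alternatizeUncurryFin_apply]
  rw [Fin.sum_univ_succ]
  simp only [Fin.val_zero, pow_zero, one_smul, Fin.cons_zero, Fin.cons_succ, Fin.val_succ,
    Fin.removeNth_zero, Fin.tail_cons, ContinuousLinearMap.comp_apply, consL_apply, contract_apply,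
    ContinuousAlternatingMap.compContinuousLinearMap_apply]
  -- The term in which the unit vector is the direction of differentiation is the right-hand side.
  -- In the others it is an argument of the form: it precedes `v i`, which shifts the sign by one,
  -- so they cancel against the second sum.
  rw [add_assoc, ← Finset.sum_add_distrib, Finset.sum_eq_zero, add_zero]
  · rfl
  · intro i _
    have : i.succ.removeNth (Fin.cons (cons 1 0) fun a => cons 0 (v a) : Fin (l + 2) → E (d + 1)) =
        Fin.cons (cons 1 0) fun a => cons 0 (i.removeNth v a) := by
      ext1 a
      refine Fin.cases ?_ (fun a => ?_) a <;> simp [Fin.removeNth]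
    rw [this, pow_succ]
    simp

/-! ### Forms and plots -/

section FormsOnHomotopies

variable {X : Type u} [DiffeologicalSpace X] {Y : Type v} [DiffeologicalSpace Y]
  {X' : Type u} [DiffeologicalSpace X'] {Y' : Type v} [DiffeologicalSpace Y']

namespace DForm

lemma ext' {k : ℕ} {θ η : DForm X k} (h : ∀ n p c, θ.1 n p c = η.1 n p c) : θ = η :=
  Subtype.ext (funext fun n => funext fun p => funext fun c => h n p c)

/-- Forms are local. -/
lemma apply_congr {k n : ℕ} (θ : DForm X k) (p q : {p : E n → X // IsPlot p}) (c : E n)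
    (h : p.1 =ᶠ[𝓝 c] q.1) : θ.1 n p c = θ.1 n q c := by
  obtain ⟨r, hr, hball⟩ := Metric.eventually_nhds_iff_ball.1 h
  -- The map `f` sends the whole space into the ball where `p` and `q` agree and is the identity
  -- near `c`. Thus `p ∘ f = q ∘ f`, while pulling back along `f` changes nothing at `c`.
  let b : ContDiffBump c := ⟨r / 2, r, by linarith, by linarith⟩
  let f : E n → E n := fun x => c + b x • (x - c)
  have hf : ContDiff ℝ ∞ f := contDiff_const.add (b.contDiff.smul (contDiff_id.sub contDiff_const))
  have hfid : f =ᶠ[𝓝 c] id := by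
    filter_upwards [b.eventuallyEq_one] with x hx
    simp [f, hx]
  have hfc : f c = c := by simp [f]
  have hf' : fderiv ℝ f c = ContinuousLinearMap.id ℝ (E n) := by
    rw [hfid.fderiv_eq, fderiv_id]
  have hpq : p.1 ∘ f = q.1 ∘ f := by
    funext x
    refine hball (f x) ?_
    by_cases hx : dist x c < r
    · rw [Metric.mem_ball, dist_eq_norm]
      simp only [f, add_sub_cancel_left, norm_smul, Real.norm_of_nonneg b.nonneg]
      exact (mul_le_of_le_one_left (norm_nonneg _) b.le_one).trans_lt (by rwa [← dist_eq_norm])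
    · have : b x = 0 := b.zero_of_le_dist (not_lt.1 hx)
      simp [f, this, hr]
  have h1 := θ.2.2 n n p f hf c
  have h2 := θ.2.2 n n q f hf c
  rw [hf', hfc] at h1 h2
  have h3 : θ.1 n ⟨p.1 ∘ f, isPlot_reparam p.2 hf⟩ c =
      θ.1 n ⟨q.1 ∘ f, isPlot_reparam q.2 hf⟩ c := by
    simp only [hpq]
  exact h1.symm.trans (h3.trans h2)

/-- Naturality under the constant map `E 0 → E n` shows that a `0`-form is determined by its values
on points, i.e. is an honest function on `X`. -/
lemma apply_const (θ : DForm X 0) {n : ℕ} (p : {p : E n → X // IsPlot p}) (c : E n) :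
    θ.1 0 ⟨fun _ => p.1 c, isPlot_const⟩ 0 Fin.elim0 = θ.1 n p c Fin.elim0 := by
  have := θ.2.2 0 n p (fun _ => c) contDiff_const 0
  refine (congrArg (fun η : E 0 [⋀^Fin 0]→L[ℝ] ℂ => η Fin.elim0) this).trans ?_
  exact congrArg (θ.1 n p c) (Subsingleton.elim (α := Fin 0 → E n) _ _)

/-- The exponential of a function. -/
def exp : DForm X 0 →+ Deligne X 0 where
  toFun θ := Additive.ofMul (α := SmoothUnits X)
    ⟨fun x => Units.mk0 (Complex.exp (θ.1 0 ⟨fun _ => x, isPlot_const⟩ 0 Fin.elim0))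
        (Complex.exp_ne_zero _), fun n p hp => by
      have h : ∀ c, θ.1 0 ⟨fun _ => p c, isPlot_const⟩ 0 Fin.elim0 =
          θ.1 n ⟨p, hp⟩ c Fin.elim0 := apply_const θ ⟨p, hp⟩
      simp only [Units.val_mk0, h]
      exact Complex.contDiff_exp.comp
        ((ContinuousAlternatingMap.apply ℝ (E n) ℂ Fin.elim0).contDiff.comp (θ.2.1 n ⟨p, hp⟩))⟩
  map_zero' := by
    refine congrArg _ (Subtype.ext (funext fun x => Units.ext ?_))
    exact Complex.exp_zero
  map_add' a b := by
    refine congrArg _ (Subtype.ext (funext fun x => Units.ext ?_))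
    exact Complex.exp_add _ _

lemma value_exp (θ : DForm X 0) (x : X) :
    ((exp θ).value x : ℂ) = Complex.exp (θ.1 0 ⟨fun _ => x, isPlot_const⟩ 0 Fin.elim0) := rfl

/-- The chain rule. It lets the exponentiated integral of a `1`-form enter Stokes' theorem like the
integrals of higher degree. -/
lemma dlog_exp (θ : DForm X 0) : Deligne.d 0 (exp θ) = (DForm.d 0 θ : DForm X 1) := by
  refine ext' fun n p c => ?_
  ext v
  have hd : DifferentiableAt ℝ (θ.1 n p) c := (θ.2.1 n p).differentiable (by simp) c
  have h : (fun c => ((exp θ).value (p.1 c) : ℂ)) =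
      fun c => Complex.exp (θ.1 n p c Fin.elim0) :=
    funext fun c => by rw [value_exp, apply_const]
  change ((exp θ).value (p.1 c) : ℂ)⁻¹ • fderiv ℝ (fun c => ((exp θ).value (p.1 c) : ℂ)) c (v 0) =
    extDeriv (θ.1 n p) c v
  rw [extDeriv_apply hd, h, value_exp, apply_const]
  have hd' : DifferentiableAt ℝ (fun c => θ.1 n p c Fin.elim0) c :=
    (ContinuousAlternatingMap.apply ℝ (E n) ℂ Fin.elim0).differentiableAt.comp c hd
  rw [(hd'.hasFDerivAt.cexp).fderiv]
  have : (0 : Fin 1).removeNth v = Fin.elim0 := Subsingleton.elim (α := Fin 0 → E n) _ _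
  simp [this, Complex.exp_ne_zero]

end DForm

/-! ### Fibre integration along a homotopy -/

/-- `s : ℝ × X → Y` is a smooth homotopy. -/
def SmoothHomotopy (s : ℝ → X → Y) : Prop :=
  ∀ (d : ℕ) (P : E d → X), IsPlot P → IsPlot fun w : E (d + 1) => s (w 0) (P (tail w))

namespace SmoothHomotopy

variable {s : ℝ → X → Y}

lemma dSmooth (hs : SmoothHomotopy s) (t : ℝ) : DSmooth (s t) := fun d P hP =>
  isPlot_reparam (hs d P hP) (f := cons t)
    ((contDiff_cons (n := ∞)).comp (f := fun c : E d => (c, t)) (contDiff_id.prodMk contDiff_const))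

/-- The plot `(t, c) ↦ s t (P c)`. -/
def plot (hs : SmoothHomotopy s) {d : ℕ} (P : {p : E d → X // IsPlot p}) :
    {p : E (d + 1) → Y // IsPlot p} := ⟨_, hs d P.1 P.2⟩

variable (hs : SmoothHomotopy s)

lemma contDiff_integrand {l n : ℕ} (θ : DForm Y (l + 1)) (p : {p : E n → X // IsPlot p}) :
    ContDiff ℝ ∞ (Function.uncurry fun (c : E n) (t : ℝ) =>
      contract n l (θ.1 (n + 1) (hs.plot p) (cons t c))) :=
  (contract n l).contDiff.comp ((θ.2.1 _ _).comp contDiff_cons)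

lemma intervalIntegrable {l n : ℕ} (θ : DForm Y (l + 1)) (p : {p : E n → X // IsPlot p})
    (c : E n) (a b : ℝ) : IntervalIntegrable
      (fun t => contract n l (θ.1 (n + 1) (hs.plot p) (cons t c))) MeasureTheory.volume a b :=
  ((hs.contDiff_integrand θ p).continuous.comp (f := fun t : ℝ => (c, t))
    (by fun_prop)).intervalIntegrable a b

/-- The differential of `f` times the identity of `ℝ`. -/
lemma contract_comp {m n l : ℕ} {f : E m → E n} (hf : ContDiff ℝ ∞ f) (t : ℝ) (c : E m)
    (η : E (n + 1) [⋀^Fin (l + 1)]→L[ℝ] ℂ) :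
    contract m l (η.compContinuousLinearMap
      (fderiv ℝ (fun w : E (m + 1) => cons (w 0) (f (tail w))) (cons t c))) =
    (contract n l η).compContinuousLinearMap (fderiv ℝ f c) := by
  let p0 : E (m + 1) →L[ℝ] ℝ := EuclideanSpace.proj 0
  let tl : E (m + 1) →L[ℝ] E m := LinearMap.toContinuousLinearMap
    { toFun := tail
      map_add' := fun _ _ => rfl
      map_smul' := fun _ _ => rfl }
  have hfd : HasFDerivAt f (fderiv ℝ f c) (tl (cons t c)) :=
    (hf.differentiable (by simp) c).hasFDerivAt
  have h1 : HasFDerivAt (fun w : E (m + 1) => cons (w 0) (f (tail w)))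
      (p0.smulRight (cons 1 0) + (consL n).comp ((fderiv ℝ f c).comp tl)) (cons t c) := by
    have : (fun w : E (m + 1) => cons (w 0) (f (tail w))) =
        fun w => p0 w • cons 1 0 + consL n (f (tl w)) := funext fun w => cons_eq _ _
    rw [this]
    exact (p0.hasFDerivAt.smul_const _).add
      ((consL n).hasFDerivAt.comp _ (hfd.comp _ tl.hasFDerivAt))
  rw [h1.fderiv]
  ext v
  simp only [contract_apply, ContinuousAlternatingMap.compContinuousLinearMap_apply]
  congr 1
  funext a
  -- The derivative of `id × f` fixes the unit vector `cons 1 0`, which occupies slot `0`, and acts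
  -- by `fderiv ℝ f c` on the vectors `cons 0 (v a)` in the other slots.
  refine Fin.cases ?_ (fun a => ?_) a
  · have e1 : tl (cons 1 (0 : E m)) = 0 := rfl
    have e2 : p0 (cons 1 (0 : E m)) = 1 := rfl
    simp [e1, e2, -consL_apply]
  · have e1 : tl (cons 0 (v a)) = v a := rfl
    have e2 : p0 (cons 0 (v a)) = 0 := rfl
    simp [e1, e2]

/-- Integration of forms over `[a, b]` along a homotopy. -/
def integral (a b : ℝ) (l : ℕ) : DForm Y (l + 1) →+ DForm X l where
  toFun θ := ⟨fun n p c => ∫ t in a..b, contract n l (θ.1 (n + 1) (hs.plot p) (cons t c)),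
    fun n p => contDiff_intervalIntegral (hs.contDiff_integrand θ p) a b,
    fun m n p f hf c => by
      let L : (E n [⋀^Fin l]→L[ℝ] ℂ) →L[ℝ] (E m [⋀^Fin l]→L[ℝ] ℂ) :=
        ContinuousAlternatingMap.compContinuousLinearMapCLM (fderiv ℝ f c)
      refine Eq.trans ?_ (L.intervalIntegral_comp_comm (hs.intervalIntegrable θ p (f c) a b))
      refine intervalIntegral.integral_congr fun t _ => ?_
      let f' : E (m + 1) → E (n + 1) := fun w => cons (w 0) (f (tail w))
      have hf' : ContDiff ℝ ∞ f' := (contDiff_cons (n := ∞)).comp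
        (f := fun w : E (m + 1) => (f (tail w), w 0)) ((hf.comp contDiff_tail).prodMk (by fun_prop))
      have h := θ.2.2 (m + 1) (n + 1) (hs.plot p) f' hf' (cons t c)
      -- Reparametrizing `p` by `f` reparametrizes the homotopy plot by `id × f`, definitionally.
      have e : (⟨(hs.plot p).1 ∘ f', isPlot_reparam (hs.plot p).2 hf'⟩ :
        {p : E (m + 1) → Y // IsPlot p}) = hs.plot ⟨p.1 ∘ f, isPlot_reparam p.2 hf⟩ := rfl
      rw [e] at h
      change contract m l (θ.1 (m + 1) (hs.plot ⟨p.1 ∘ f, isPlot_reparam p.2 hf⟩) (cons t c)) =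
        (contract n l (θ.1 (n + 1) (hs.plot p) (cons t (f c)))).compContinuousLinearMap
          (fderiv ℝ f c)
      rw [h, contract_comp hf]
      rfl⟩
  map_zero' := DForm.ext' fun n p c => by
    change ∫ t in a..b, contract n l 0 = 0
    simp
  map_add' θ η := DForm.ext' fun n p c => by
    refine Eq.trans ?_ (intervalIntegral.integral_add (hs.intervalIntegrable θ p c a b)
      (hs.intervalIntegrable η p c a b))
    exact intervalIntegral.integral_congr fun t _ => map_add (contract n l) _ _

lemma integral_apply {a b : ℝ} {l : ℕ} (θ : DForm Y (l + 1)) {n : ℕ}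
    (p : {p : E n → X // IsPlot p}) (c : E n) (v : Fin l → E n) :
    (hs.integral a b l θ).1 n p c v = ∫ t in a..b,
      θ.1 (n + 1) (hs.plot p) (cons t c) (Fin.cons (cons 1 0) fun i => cons 0 (v i)) :=
  ((ContinuousAlternatingMap.apply ℝ (E n) ℂ v).intervalIntegral_comp_comm
    (hs.intervalIntegrable θ p c a b)).symm

lemma integral_add_adjacent (a b c : ℝ) {l : ℕ} (θ : DForm Y (l + 1)) :
    hs.integral a b l θ + hs.integral b c l θ = hs.integral a c l θ :=
  DForm.ext' fun _ p x => intervalIntegral.integral_add_adjacent_intervals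
    (hs.intervalIntegrable θ p x a b) (hs.intervalIntegrable θ p x b c)

/-- Integration commutes with pull-backs along maps which intertwine the homotopies over `[a, b]`. -/
lemma integral_pullback {s' : ℝ → X' → Y'} (hs' : SmoothHomotopy s') {f : X → X'} (hf : DSmooth f)
    {g : Y → Y'} (hg : DSmooth g) {a b : ℝ} (hab : a ≤ b)
    (h : ∀ t ∈ Icc a b, ∀ x, g (s t x) = s' t (f x)) {l : ℕ} (θ : DForm Y' (l + 1)) :
    hs.integral a b l (DForm.pullback (l + 1) g hg θ) =
      DForm.pullback l f hf (hs'.integral a b l θ) := by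
  refine DForm.ext' fun n p c => ?_
  refine intervalIntegral.integral_congr_ae ?_
  -- The homotopies are only known to correspond over `[a, b]`, and a form at `t` sees a
  -- neighbourhood of `t`. So the comparison is made on the open interval, leaving out the null set
  -- of end points.
  have hne : ∀ᵐ t ∂(MeasureTheory.volume : MeasureTheory.Measure ℝ), t ≠ b :=
    MeasureTheory.Measure.ae_ne _ _
  filter_upwards [hne] with t htb ht
  rw [uIoc_of_le hab] at ht
  have ht' : t ∈ Ioo a b := ⟨ht.1, lt_of_le_of_ne ht.2 htb⟩
  refine congrArg (contract n l) ?_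
  refine DForm.apply_congr θ _ _ _ ?_
  have hU : {w : E (n + 1) | w 0 ∈ Ioo a b} ∈ 𝓝 (cons t c) :=
    (isOpen_Ioo.preimage (by fun_prop : Continuous fun w : E (n + 1) => w 0)).mem_nhds ht'
  filter_upwards [hU] with w hw
  exact h _ (Ioo_subset_Icc_self hw) _

open ContinuousAlternatingMap in
/-- Stokes' theorem for integration over `[a, b]`. -/
lemma integral_d (a b : ℝ) {l : ℕ} (θ : DForm Y (l + 1)) :
    hs.integral a b (l + 1) (DForm.d (l + 1) θ) + DForm.d l (hs.integral a b l θ) =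
      DForm.pullback (l + 1) (s b) (hs.dSmooth b) θ -
        DForm.pullback (l + 1) (s a) (hs.dSmooth a) θ := by
  refine DForm.ext' fun n p c => ?_
  set η : E (n + 1) → E (n + 1) [⋀^Fin (l + 1)]→L[ℝ] ℂ := θ.1 (n + 1) (hs.plot p) with hη
  have hηs : ContDiff ℝ ∞ η := θ.2.1 _ _
  have hηd : ∀ w, HasFDerivAt η (fderiv ℝ η w) w := fun w =>
    (hηs.differentiable (by simp) w).hasFDerivAt
  have hη'c : Continuous (fderiv ℝ η) := hηs.continuous_fderiv (by simp)
  have hcons : Continuous fun t : ℝ => cons t c :=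
    (contDiff_cons (n := 0)).continuous.comp (f := fun t : ℝ => (c, t)) (by fun_prop)
  -- The form at a fixed time is the restriction of `η` to the slice `{t} × E n`.
  have hend : ∀ t, θ.1 n ⟨s t ∘ p.1, hs.dSmooth t _ _ p.2⟩ c =
      (η (cons t c)).compContinuousLinearMap (consL n) := fun t => by
    have h := θ.2.2 n (n + 1) (hs.plot p) (cons t) ((contDiff_cons (n := ∞)).comp
      (f := fun c : E n => (c, t)) (contDiff_id.prodMk contDiff_const)) c
    rw [(hasFDerivAt_cons t c).fderiv] at h
    exact h
  let R : (E (n + 1) [⋀^Fin (l + 1)]→L[ℝ] ℂ) →L[ℝ] (E n [⋀^Fin (l + 1)]→L[ℝ] ℂ) :=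
    compContinuousLinearMapCLM (consL n)
  have hFTC : ∫ t in a..b, R (fderiv ℝ η (cons t c) (cons 1 0)) =
      R (η (cons b c)) - R (η (cons a c)) := by
    refine intervalIntegral.integral_eq_sub_of_hasDerivAt (f := fun t => R (η (cons t c)))
      (fun t _ => ?_) ?_
    · have h1 : HasDerivAt (fun t : ℝ => cons t c) (cons 1 0) t := by
        have : (fun t : ℝ => cons t c) = fun t => t • cons 1 0 + consL n c :=
          funext fun t => cons_eq t c
        rw [this]
        simpa using ((hasDerivAt_id t).smul_const (cons 1 (0 : E n))).add_const (consL n c)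
      exact R.hasFDerivAt.comp_hasDerivAt t ((hηd _).comp_hasDerivAt t h1)
    · exact (R.continuous.comp ((hη'c.comp hcons).clm_apply continuous_const)).intervalIntegrable ..
  have hext : ∀ w, extDeriv η w = alternatizeUncurryFin (fderiv ℝ η w) := fun w => rfl
  have hD : fderiv ℝ (fun c => ∫ t in a..b, contract n l (η (cons t c))) c =
      ∫ t in a..b, (contract n l).comp ((fderiv ℝ η (cons t c)).comp (consL n)) := by
    rw [(hasFDerivAt_intervalIntegral ((hs.contDiff_integrand θ p).of_le (by simp)) a b c).fderiv]
    refine intervalIntegral.integral_congr fun t _ => ?_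
    exact ((contract n l).hasFDerivAt.comp c ((hηd _).comp c (hasFDerivAt_cons t c))).fderiv
  have hDc : ContDiff ℝ 0 fun t => (contract n l).comp ((fderiv ℝ η (cons t c)).comp (consL n)) :=
    contDiff_const.clm_comp (((hηs.fderiv_right (m := 0) (by simp)).comp
      ((contDiff_cons (n := 0)).comp (f := fun t : ℝ => (c, t)) (by fun_prop))).clm_comp
        contDiff_const)
  have hE : extDeriv (fun c => ∫ t in a..b, contract n l (η (cons t c))) c =
      ∫ t in a..b, alternatizeUncurryFin
        ((contract n l).comp ((fderiv ℝ η (cons t c)).comp (consL n))) := by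
    change alternatizeUncurryFinCLM ℝ (E n) ℂ _ = _
    rw [hD]
    exact (ContinuousLinearMap.intervalIntegral_comp_comm (𝕜 := ℝ) (μ := MeasureTheory.volume)
      (E := E n →L[ℝ] E n [⋀^Fin l]→L[ℝ] ℂ) (alternatizeUncurryFinCLM ℝ (E n) ℂ)
      (hDc.continuous.intervalIntegrable a b)).symm
  change (∫ t in a..b, contract n (l + 1) (extDeriv η (cons t c))) +
    extDeriv (fun c => ∫ t in a..b, contract n l (η (cons t c))) c =
    θ.1 n ⟨s b ∘ p.1, _⟩ c - θ.1 n ⟨s a ∘ p.1, _⟩ c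
  rw [hend, hend, hE]
  -- By Cartan's formula the two integrands add up pointwise to the time derivative of the
  -- restriction `R η`. The fundamental theorem of calculus `hFTC` does the rest.
  refine (intervalIntegral.integral_add (μ := MeasureTheory.volume) ?_ ?_).symm.trans (Eq.trans ?_ hFTC)
  · exact ((contract n (l + 1)).continuous.comp
      ((alternatizeUncurryFinCLM ℝ (E (n + 1)) ℂ).continuous.comp
        (hη'c.comp hcons))).intervalIntegrable ..
  · have h : ContDiff ℝ 0 fun t => alternatizeUncurryFin
        ((contract n l).comp ((fderiv ℝ η (cons t c)).comp (consL n))) :=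
      ContDiff.comp (g := alternatizeUncurryFinCLM ℝ (E n) ℂ)
        (ContinuousLinearMap.contDiff (𝕜 := ℝ) (E := E n →L[ℝ] E n [⋀^Fin l]→L[ℝ] ℂ) _) hDc
    exact h.continuous.intervalIntegrable a b
  · exact intervalIntegral.integral_congr fun t _ => contract_alternatizeUncurryFin _

end SmoothHomotopy

end FormsOnHomotopies

/-! ### Sections of the complex `ℂˣ → 𝒜¹ → 𝒜² → ⋯` -/

namespace Deligne

variable {X : Type u} [DiffeologicalSpace X] {Y : Type v} [DiffeologicalSpace Y]

/-- The value at `x` as a homomorphism. -/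
def valueHom (x : X) : Deligne X 0 →+ Additive ℂˣ where
  toFun f := Additive.ofMul (f.value x)
  map_zero' := rfl
  map_add' _ _ := rfl

/-- The value along a plot as a homomorphism. -/
def evalHom {l n : ℕ} (p : E n → X) (hp : IsPlot p) (c : E n) (v : Fin (l + 1) → E n) :
    Deligne X (l + 1) →+ ℂ where
  toFun θ := Deligne.eval θ p hp c v
  map_zero' := rfl
  map_add' _ _ := rfl

lemma ext_value {f g : Deligne X 0} (h : ∀ x, f.value x = g.value x) : f = g :=
  Additive.toMul.injective (Subtype.ext (funext h))

lemma pullback_congr {g g' : X → Y} (h : g = g') (hg : DSmooth g) (hg' : DSmooth g') (l : ℕ)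
    (θ : Deligne Y l) : pullback g hg l θ = pullback g' hg' l θ := by
  subst h; rfl

lemma pullback_id : ∀ (l : ℕ) (θ : Deligne X l), pullback id dSmooth_id l θ = θ
  | 0, _ => rfl
  | _ + 1, _ => rfl

end Deligne

/-- The product `exp (-∫ g'/g) · g` has derivative zero, hence is constant. No branch of the
logarithm has to be chosen. -/
lemma exp_integral_logDeriv {g g' : ℝ → ℂ} (hg : ∀ t, HasDerivAt g (g' t) t) (h0 : ∀ t, g t ≠ 0)
    (hc : Continuous fun t => (g t)⁻¹ * g' t) (a b : ℝ) :
    Complex.exp (∫ t in a..b, (g t)⁻¹ * g' t) = g b / g a := by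
  have hF : ∀ t, HasDerivAt (fun t => Complex.exp (-∫ u in a..t, (g u)⁻¹ * g' u) * g t) 0 t := by
    intro t
    have h1 := (hc.integral_hasStrictDerivAt a t).hasDerivAt
    have h2 := (h1.neg.cexp.mul (hg t))
    refine h2.congr_deriv ?_
    have := h0 t
    simp only [Pi.neg_apply]
    field_simp
    ring
  have h := is_const_of_deriv_eq_zero (fun t => (hF t).differentiableAt)
    (fun t => (hF t).deriv) b a
  simp only [intervalIntegral.integral_same, neg_zero, Complex.exp_zero, one_mul,
    Complex.exp_neg] at h
  rw [← h]
  have := Complex.exp_ne_zero (∫ t in a..b, (g t)⁻¹ * g' t)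
  have := h0 b
  field_simp

/-! ### Fibre integration with values in `ℂˣ` in the bottom degree -/

namespace SmoothHomotopy

variable {X : Type u} [DiffeologicalSpace X] {Y : Type v} [DiffeologicalSpace Y]
  {X' : Type u} [DiffeologicalSpace X'] {Y' : Type v} [DiffeologicalSpace Y']
  {s : ℝ → X → Y} (hs : SmoothHomotopy s)

/-- Integration of sections of `ℂˣ → 𝒜¹ → 𝒜² → ⋯` over `[a, b]` along a homotopy: the integral of
a `1`-form is exponentiated. -/
def fiberIntegral (a b : ℝ) : ∀ l, Deligne Y (l + 1) →+ Deligne X l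
  | 0 => DForm.exp.comp (hs.integral a b 0)
  | l + 1 => hs.integral a b (l + 1)

lemma value_fiberIntegral (a b : ℝ) (θ : Deligne Y 1) (x : X) :
    ((hs.fiberIntegral a b 0 θ).value x : ℂ) = Complex.exp (∫ t in a..b,
      θ.eval (hs.plot (d := 0) ⟨fun _ => x, isPlot_const⟩).1 (hs.plot _).2 (cons t 0)
        (Fin.cons (cons 1 0) fun i => cons 0 (Fin.elim0 i))) :=
  congrArg Complex.exp (hs.integral_apply _ _ _ _)

lemma eval_fiberIntegral (a b : ℝ) {l : ℕ} (θ : Deligne Y (l + 2)) {n : ℕ} (P : E n → X)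
    (hP : IsPlot P) (c : E n) (v : Fin (l + 1) → E n) :
    (hs.fiberIntegral a b (l + 1) θ).eval P hP c v = ∫ t in a..b,
      θ.eval (hs.plot ⟨P, hP⟩).1 (hs.plot _).2 (cons t c)
        (Fin.cons (cons 1 0) fun i => cons 0 (v i)) :=
  hs.integral_apply _ _ _ _

lemma fiberIntegral_add_adjacent (a b c : ℝ) : ∀ (l : ℕ) (θ : Deligne Y (l + 1)),
    hs.fiberIntegral a b l θ + hs.fiberIntegral b c l θ = hs.fiberIntegral a c l θ
  | 0, θ => (map_add DForm.exp _ _).symm.trans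
      (congrArg DForm.exp (hs.integral_add_adjacent a b c θ))
  | _ + 1, θ => hs.integral_add_adjacent a b c θ

/-- With different `f` and `g` this yields compatibility with faces, naturality in the groupoid, and
the comparison of two covers. For the last, equality only over `[a, b]` is essential, since the
clamps differ outside. -/
lemma fiberIntegral_pullback {s' : ℝ → X' → Y'} (hs' : SmoothHomotopy s') {f : X → X'}
    (hf : DSmooth f) {g : Y → Y'} (hg : DSmooth g) {a b : ℝ} (hab : a ≤ b)
    (h : ∀ t ∈ Icc a b, ∀ x, g (s t x) = s' t (f x)) : ∀ (l : ℕ) (θ : Deligne Y' (l + 1)),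
    hs.fiberIntegral a b l (Deligne.pullback g hg (l + 1) θ) =
      Deligne.pullback f hf l (hs'.fiberIntegral a b l θ)
  | 0, θ => congrArg DForm.exp (hs.integral_pullback hs' hf hg hab h θ)
  | _ + 1, θ => hs.integral_pullback hs' hf hg hab h θ

/-- Stokes in the bottom degree: a function has no fibre integral, so the term `d ∫` is absent. What
remains is the multiplicative fundamental theorem `exp_integral_logDeriv`. -/
lemma fiberIntegral_d_zero (a b : ℝ) (θ : Deligne Y 0) :
    hs.fiberIntegral a b 0 (Deligne.d 0 θ) =
      Deligne.pullback (s b) (hs.dSmooth b) 0 θ - Deligne.pullback (s a) (hs.dSmooth a) 0 θ := by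
  refine Deligne.ext_value fun x => Units.ext ?_
  rw [value_fiberIntegral]
  set P : {p : E 1 → Y // IsPlot p} := hs.plot (d := 0) ⟨fun _ => x, isPlot_const⟩ with hP
  let G : E 1 → ℂ := fun w => θ.value (P.1 w)
  have hG : ContDiff ℝ ∞ G := (Additive.toMul (α := SmoothUnits Y) θ).2 1 P.1 P.2
  have h1 : ∀ t, HasDerivAt (fun t : ℝ => cons t (0 : E 0)) (cons 1 0) t := fun t => by
    have : (fun t : ℝ => cons t (0 : E 0)) = fun t => t • cons 1 0 + consL 0 0 :=
      funext fun t => cons_eq t 0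
    rw [this]
    simpa using ((hasDerivAt_id t).smul_const (cons 1 (0 : E 0))).add_const (consL 0 0)
  have hcons : Continuous fun t : ℝ => cons t (0 : E 0) :=
    continuous_iff_continuousAt.2 fun t => (h1 t).continuousAt
  have h2 : ∀ t, HasDerivAt (fun t => G (cons t 0)) (fderiv ℝ G (cons t 0) (cons 1 0)) t := fun t =>
    ((hG.differentiable (by simp) _).hasFDerivAt).comp_hasDerivAt t (h1 t)
  have h3 := exp_integral_logDeriv h2 (fun t => Units.ne_zero _)
    (((hG.continuous.comp hcons).inv₀ fun t => Units.ne_zero _).mul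
      (((hG.continuous_fderiv (by simp)).comp hcons).clm_apply continuous_const)) a b
  exact h3.trans (by rw [div_eq_mul_inv, ← Units.val_inv_eq_inv_val, ← Units.val_mul,
    ← div_eq_mul_inv]; rfl)

lemma fiberIntegral_d_succ (a b : ℝ) : ∀ (l : ℕ) (θ : Deligne Y (l + 1)),
    hs.fiberIntegral a b (l + 1) (Deligne.d (l + 1) θ) + Deligne.d l (hs.fiberIntegral a b l θ) =
      Deligne.pullback (s b) (hs.dSmooth b) (l + 1) θ -
        Deligne.pullback (s a) (hs.dSmooth a) (l + 1) θ
  | 0, θ => by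
    change _ + Deligne.d 0 (DForm.exp (hs.integral a b 0 θ)) = _
    rw [DForm.dlog_exp]
    exact hs.integral_d a b θ
  | _ + 1, θ => hs.integral_d a b θ

end SmoothHomotopy

/-! ### The prism identity -/

/-- The two middle terms are the faces omitting one of the two copies of the doubled vertex of the
`j`-th prism simplex. The outer sums are the faces before and after it, which commute with the prism
operator. -/
lemma sum_fin_split {A : Type*} [AddCommGroup A] {n : ℕ} (j : Fin n) (f : Fin (n + 1) → A) :
    ∑ l : Fin (n + 1), f l = (∑ l : Fin n, if l < j then f l.castSucc else 0) + f j.castSucc +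
      f j.succ + ∑ l : Fin n, if j < l then f l.succ else 0 := by
  have h : ∀ l : Fin n, f (j.castSucc.succAbove l) = (if l < j then f l.castSucc else 0) +
      (if l = j then f j.succ else 0) + if j < l then f l.succ else 0 := by
    intro l
    rcases lt_trichotomy l j with h | h | h
    · rw [Fin.succAbove_of_castSucc_lt _ _ (Fin.castSucc_lt_castSucc_iff.2 h)]
      simp [h, h.ne, h.not_gt]
    · subst h
      rw [Fin.succAbove_of_le_castSucc _ _ le_rfl]
      simp
    · rw [Fin.succAbove_of_le_castSucc _ _ (Fin.castSucc_le_castSucc_iff.2 h.le)]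
      simp [h, h.ne', h.not_gt]
  rw [Fin.sum_univ_succAbove _ j.castSucc, Finset.sum_congr rfl fun l _ => h l,
    Finset.sum_add_distrib, Finset.sum_add_distrib, Finset.sum_ite_eq' Finset.univ j,
    if_pos (Finset.mem_univ j)]
  abel

/-- The cancellation in the double sums of the prism operator. -/
lemma prism_sum_cancel {A : Type*} [AddCommGroup A] {n : ℕ} (b : Fin (n + 3) → Fin (n + 2) → A)
    (a : Fin (n + 1) → Fin (n + 2) → A)
    (h₁ : ∀ (l : Fin (n + 2)) (j : Fin (n + 1)), l ≤ j.castSucc → b l.castSucc j.succ = a j l)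
    (h₂ : ∀ (l : Fin (n + 2)) (j : Fin (n + 1)), j.castSucc < l → b l.succ j.castSucc = a j l)
    (h₃ : ∀ j : Fin (n + 1), b j.castSucc.succ j.succ = b j.castSucc.succ j.castSucc) :
    (∑ j : Fin (n + 2), ∑ l : Fin (n + 3), (-1 : ℤ) ^ ((j : ℕ) + (l : ℕ)) • b l j) +
      (∑ j : Fin (n + 1), ∑ l : Fin (n + 2), (-1 : ℤ) ^ ((j : ℕ) + (l : ℕ)) • a j l) =
    b 0 0 - b (Fin.last _) (Fin.last _) := by
  -- By `h₃` neighbouring prism simplices share a face, so the diagonal terms telescope.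
  have hdiag : ∑ j : Fin (n + 2), (b j.castSucc j - b j.succ j) =
      b 0 0 - b (Fin.last _) (Fin.last _) := by
    rw [Finset.sum_sub_distrib, Fin.sum_univ_succ, Fin.sum_univ_castSucc (fun j => b j.succ j)]
    have : ∑ i : Fin (n + 1), b i.succ.castSucc i.succ =
        ∑ i : Fin (n + 1), b i.castSucc.succ i.castSucc :=
      Finset.sum_congr rfl fun i _ => h₃ i
    rw [this, Fin.castSucc_zero, Fin.succ_last]
    abel
  -- Faces before the doubled vertex: there are none for `j = 0`, and the shift of `j` by one
  -- produces the minus sign.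
  have hlow : ∑ j : Fin (n + 2), (∑ l : Fin (n + 2),
      if l < j then (-1 : ℤ) ^ ((j : ℕ) + (l : ℕ)) • b l.castSucc j else 0) =
      -∑ j : Fin (n + 1), ∑ l : Fin (n + 2),
        if l ≤ j.castSucc then (-1 : ℤ) ^ ((j : ℕ) + (l : ℕ)) • a j l else 0 := by
    rw [Fin.sum_univ_succ]
    simp only [Fin.not_lt_zero, if_false, Finset.sum_const_zero, zero_add]
    rw [← Finset.sum_neg_distrib]
    refine Finset.sum_congr rfl fun j _ => ?_
    rw [← Finset.sum_neg_distrib]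
    refine Finset.sum_congr rfl fun l _ => ?_
    simp only [← Fin.le_castSucc_iff]
    split_ifs with h
    · rw [h₁ l j h, Fin.val_succ, add_right_comm, pow_succ]
      simp
    · simp
  -- Faces after the doubled vertex: there are none for the last `j`, and now the shift of `l`
  -- produces the sign.
  have hup : ∑ j : Fin (n + 2), (∑ l : Fin (n + 2),
      if j < l then (-1 : ℤ) ^ ((j : ℕ) + ((l : ℕ) + 1)) • b l.succ j else 0) =
      -∑ j : Fin (n + 1), ∑ l : Fin (n + 2),
        if j.castSucc < l then (-1 : ℤ) ^ ((j : ℕ) + (l : ℕ)) • a j l else 0 := by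
    rw [Fin.sum_univ_castSucc]
    simp only [(Fin.le_last _).not_gt, if_false, Finset.sum_const_zero, add_zero]
    rw [← Finset.sum_neg_distrib]
    refine Finset.sum_congr rfl fun j _ => ?_
    rw [← Finset.sum_neg_distrib]
    refine Finset.sum_congr rfl fun l _ => ?_
    split_ifs with h
    · rw [h₂ l j h, Fin.val_castSucc, ← add_assoc, pow_succ]
      simp
    · simp
  have hsplit : ∑ j : Fin (n + 2), ∑ l : Fin (n + 3), (-1 : ℤ) ^ ((j : ℕ) + (l : ℕ)) • b l j =
      ∑ j : Fin (n + 2), ((∑ l : Fin (n + 2),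
        if l < j then (-1 : ℤ) ^ ((j : ℕ) + (l : ℕ)) • b l.castSucc j else 0) +
        (b j.castSucc j - b j.succ j) + ∑ l : Fin (n + 2),
        if j < l then (-1 : ℤ) ^ ((j : ℕ) + ((l : ℕ) + 1)) • b l.succ j else 0) := by
    refine Finset.sum_congr rfl fun j _ => ?_
    rw [sum_fin_split j]
    have e1 : (-1 : ℤ) ^ ((j : ℕ) + (j : ℕ)) = 1 := Even.neg_one_pow ⟨_, rfl⟩
    simp only [Fin.val_castSucc, Fin.val_succ]
    rw [← add_assoc (j : ℕ) (j : ℕ) 1, pow_succ, e1]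
    simp only [one_mul, one_smul, neg_smul, sub_eq_add_neg, add_assoc]
  have hall : ∑ j : Fin (n + 1), ∑ l : Fin (n + 2), (-1 : ℤ) ^ ((j : ℕ) + (l : ℕ)) • a j l =
      (∑ j : Fin (n + 1), ∑ l : Fin (n + 2),
        if l ≤ j.castSucc then (-1 : ℤ) ^ ((j : ℕ) + (l : ℕ)) • a j l else 0) +
      ∑ j : Fin (n + 1), ∑ l : Fin (n + 2),
        if j.castSucc < l then (-1 : ℤ) ^ ((j : ℕ) + (l : ℕ)) • a j l else 0 := by
    simp only [← Finset.sum_add_distrib]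
    refine Finset.sum_congr rfl fun j _ => Finset.sum_congr rfl fun l _ => ?_
    by_cases h : l ≤ j.castSucc
    · rw [if_pos h, if_neg h.not_gt, add_zero]
    · rw [if_neg h, if_pos (not_le.1 h), zero_add]
  rw [hsplit, Finset.sum_add_distrib, Finset.sum_add_distrib, hlow, hup, hdiag, hall]
  abel

lemma val_succAbove {n : ℕ} (l : Fin (n + 1)) (a : Fin n) :
    (l.succAbove a : ℕ) = if (a : ℕ) < l then (a : ℕ) else a + 1 := by
  simp only [Fin.succAbove, Fin.lt_def, Fin.val_castSucc]
  split_ifs <;> rfl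

lemma val_predAbove {n : ℕ} (j : Fin n) (a : Fin (n + 1)) :
    (j.predAbove a : ℕ) = if (j : ℕ) < a then (a : ℕ) - 1 else a := by
  simp only [Fin.predAbove, Fin.lt_def, Fin.val_castSucc]
  split_ifs <;> simp

/-! ### Faces of the prism over an arrow -/

namespace Simplex

variable {S : DGrpd.{v}} {G : DGrpd.{u}} {r : ℕ}

/-- The `j`-th operation `ϑ_j` over the arrow `g`: the first `j` transformations are evaluated at
the source of `g`, the others at the target. -/
def prismOf (g : S.Ar) (j : Fin (r + 1)) (Λ : Simplex (funGrpd S G) r) : Simplex G (r + 1) :=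
  eval j.predAbove (ofArrow g (r + 1) fun a => decide (j.castSucc < a)) Λ

lemma smooth_prismOf (g : S.Ar) (j : Fin (r + 1)) :
    DSmooth (prismOf g j : Simplex (funGrpd S G) r → Simplex G (r + 1)) :=
  fun _ _ hP => isPlot_eval _ isPlot_const hP

/-- Evaluation of a string of transformations at an object. -/
def evalAt (x : S.Ob) (Λ : Simplex (funGrpd S G) r) : Simplex G r := eval id (const r x) Λ

lemma smooth_evalAt (x : S.Ob) :
    DSmooth (evalAt x : Simplex (funGrpd S G) r → Simplex G r) :=
  fun _ _ hP => isPlot_eval _ isPlot_const hP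

/-- The evaluated string depends only on the vertex map and on the source/target pattern. Each face
relation thus becomes two statements about maps on `Fin`, settled by arithmetic. -/
lemma eval_ofArrow_congr {k j : ℕ} {f f' : Fin (k + 1) → Fin (j + 1)} {c c' : Fin (k + 1) → Bool}
    (g : S.Ar) (hf : f = f') (hc : c = c') (Λ : Simplex (funGrpd S G) j) :
    eval f (ofArrow g k c) Λ = eval f' (ofArrow g k c') Λ := by
  subst hf hc; rfl

/-- The doubled vertex occupies positions `j + 1` and `j + 2`. Position `l ≤ j` lies before both, so
removing it amounts to removing the vertex `l` of `Λ`, after which the doubled vertex has number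
`j`. -/
lemma face_prismOf_castSucc_succ (g : S.Ar) (l : Fin (r + 2)) (j : Fin (r + 1))
    (h : l ≤ j.castSucc) (Λ : Simplex (funGrpd S G) (r + 1)) :
    face l.castSucc (prismOf g j.succ Λ) = prismOf g j (face l Λ) := by
  refine eval_ofArrow_congr g (funext fun a => ?_) (funext fun a => ?_) Λ
  · refine Fin.ext ?_
    simp only [val_succAbove, val_predAbove, Fin.val_succ, Fin.val_castSucc]
    rw [Fin.le_def, Fin.val_castSucc] at h
    split_ifs <;> omega
  · rw [Fin.le_def, Fin.val_castSucc] at h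
    simp only [Fin.lt_def, val_succAbove, Fin.val_succ, Fin.val_castSucc, decide_eq_decide]
    split_ifs <;> omega

lemma face_prismOf_succ_castSucc (g : S.Ar) (l : Fin (r + 2)) (j : Fin (r + 1))
    (h : j.castSucc < l) (Λ : Simplex (funGrpd S G) (r + 1)) :
    face l.succ (prismOf g j.castSucc Λ) = prismOf g j (face l Λ) := by
  refine eval_ofArrow_congr g (funext fun a => ?_) (funext fun a => ?_) Λ
  · refine Fin.ext ?_
    simp only [val_succAbove, val_predAbove, Fin.val_succ, Fin.val_castSucc]
    rw [Fin.lt_def, Fin.val_castSucc] at h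
    split_ifs <;> omega
  · rw [Fin.lt_def, Fin.val_castSucc] at h
    simp only [Fin.lt_def, val_succAbove, Fin.val_succ, Fin.val_castSucc, decide_eq_decide]
    split_ifs <;> omega

/-- Both sides have the vertices `0, …, j` over the source and `j + 1, …` over the target, with no
vertex doubled: this is the wall between consecutive prism simplices. -/
lemma face_prismOf_diagonal (g : S.Ar) (j : Fin (r + 1)) (Λ : Simplex (funGrpd S G) (r + 1)) :
    face j.castSucc.succ (prismOf g j.succ Λ) = face j.castSucc.succ (prismOf g j.castSucc Λ) := by
  refine eval_ofArrow_congr g (funext fun a => ?_) (funext fun a => ?_) Λ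
  · refine Fin.ext ?_
    simp only [val_succAbove, val_predAbove, Fin.val_succ, Fin.val_castSucc]
    split_ifs <;> omega
  · simp only [Fin.lt_def, val_succAbove, Fin.val_succ, Fin.val_castSucc, decide_eq_decide]
    split_ifs <;> omega

/-- For `j = 0` only the first vertex lies over the source; without it the whole string sits over
the target. The last face below is the mirror image. -/
lemma face_zero_prismOf (g : S.Ar) (Λ : Simplex (funGrpd S G) r) :
    face 0 (prismOf g 0 Λ) = evalAt (S.t g) Λ := by
  refine (eval_ofArrow_congr g (f' := id) (c' := fun _ => true) (funext fun a => ?_)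
    (funext fun a => ?_) Λ).trans ?_
  · simp
  · simp
  · rfl

lemma face_last_prismOf (g : S.Ar) (Λ : Simplex (funGrpd S G) r) :
    face (Fin.last _) (prismOf g (Fin.last _) Λ) = evalAt (S.s g) Λ := by
  refine (eval_ofArrow_congr g (f' := id) (c' := fun _ => false) (funext fun a => ?_)
    (funext fun a => ?_) Λ).trans ?_
  · simp
  · simp [Fin.le_last]
  · rfl

end Simplex

/-! ### The prism operator -/

section Prism

variable {S : DGrpd.{v}} {G : DGrpd.{u}}

/-- The operator `∑ⱼ (-1)ʲ ϑ_j^*` of an arrow `g`. -/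
def prismOp (G : DGrpd.{u}) (g : S.Ar) (r l : ℕ) :
    Deligne (Simplex G (r + 1)) l →+ Deligne (Simplex (funGrpd S G) r) l :=
  ∑ j : Fin (r + 1), (-1 : ℤ) ^ (j : ℕ) •
    Deligne.pullback (Simplex.prismOf g j) (Simplex.smooth_prismOf g j) l

lemma prismOp_apply (g : S.Ar) (r l : ℕ) (θ : Deligne (Simplex G (r + 1)) l) :
    prismOp G g r l θ = ∑ j : Fin (r + 1), (-1 : ℤ) ^ (j : ℕ) •
      Deligne.pullback (Simplex.prismOf g j) (Simplex.smooth_prismOf g j) l θ := by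
  simp [prismOp]

lemma cech_apply (G : DGrpd.{u}) (k l : ℕ) (θ : Deligne (Simplex G k) l) :
    Cochain.cech G k l θ = ∑ i : Fin (k + 2), (-1 : ℤ) ^ (i : ℕ) •
      Deligne.pullback (Simplex.face i) (Simplex.smooth_face i) l θ := by
  simp [Cochain.cech]

/-- Pull-back along the evaluation at an object. -/
abbrev evalPullback (G : DGrpd.{u}) (x : S.Ob) (r l : ℕ) :
    Deligne (Simplex G r) l →+ Deligne (Simplex (funGrpd S G) r) l :=
  Deligne.pullback (Simplex.evalAt x) (Simplex.smooth_evalAt x) l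

lemma d_prismOp (g : S.Ar) (r l : ℕ) (θ : Deligne (Simplex G (r + 1)) l) :
    Deligne.d l (prismOp G g r l θ) = prismOp G g r (l + 1) (Deligne.d l θ) := by
  simp only [prismOp_apply, map_sum, map_zsmul, Deligne.d_pullback]

lemma prismOp_cech_zero (g : S.Ar) (l : ℕ) (θ : Deligne (Simplex G 0) l) :
    prismOp G g 0 l (Cochain.cech G 0 l θ) =
      evalPullback G (S.t g) 0 l θ - evalPullback G (S.s g) 0 l θ := by
  simp only [prismOp_apply, cech_apply, map_sum, map_zsmul, Deligne.pullback_pullback]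
  refine (Fin.sum_univ_two _).trans ?_
  refine (congrArg₂ _ (congrArg _ (Fin.sum_univ_one _)) (congrArg _ (Fin.sum_univ_one _))).trans ?_
  have h0 : Simplex.face 0 ∘ Simplex.prismOf (G := G) (r := 0) g 0 = Simplex.evalAt (S.t g) :=
    funext fun Λ => Simplex.face_zero_prismOf g Λ
  have h1 : Simplex.face 1 ∘ Simplex.prismOf (G := G) (r := 0) g 0 = Simplex.evalAt (S.s g) :=
    funext fun Λ => Simplex.face_last_prismOf g Λ
  rw [Deligne.pullback_congr h0 _ (Simplex.smooth_evalAt _),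
    Deligne.pullback_congr h1 _ (Simplex.smooth_evalAt _)]
  simp [sub_eq_add_neg]

/-- The prism homotopy between evaluation at the source and at the target of `g`: inner faces cancel
by the three face relations, and the top and bottom of the prism survive. -/
lemma prismOp_cech_succ (g : S.Ar) (r l : ℕ) (θ : Deligne (Simplex G (r + 1)) l) :
    prismOp G g (r + 1) l (Cochain.cech G (r + 1) l θ) +
      Cochain.cech (funGrpd S G) r l (prismOp G g r l θ) =
      evalPullback G (S.t g) (r + 1) l θ - evalPullback G (S.s g) (r + 1) l θ := by
  have h := prism_sum_cancel (n := r)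
    (fun i j => Deligne.pullback (Simplex.face i ∘ Simplex.prismOf (G := G) g j)
      ((Simplex.smooth_face i).comp (Simplex.smooth_prismOf g j)) l θ)
    (fun j i => Deligne.pullback (Simplex.prismOf (G := G) g j ∘ Simplex.face i)
      ((Simplex.smooth_prismOf g j).comp (Simplex.smooth_face i)) l θ)
    (fun i j hij => Deligne.pullback_congr
      (funext fun Λ => Simplex.face_prismOf_castSucc_succ g i j hij Λ) _ _ _ _)
    (fun i j hij => Deligne.pullback_congr
      (funext fun Λ => Simplex.face_prismOf_succ_castSucc g i j hij Λ) _ _ _ _)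
    (fun j => Deligne.pullback_congr
      (funext fun Λ => Simplex.face_prismOf_diagonal g j Λ) _ _ _ _)
  have h0 : Simplex.face 0 ∘ Simplex.prismOf (G := G) (r := r + 1) g 0 =
    Simplex.evalAt (S.t g) := funext fun Λ => Simplex.face_zero_prismOf g Λ
  have h1 : Simplex.face (Fin.last _) ∘ Simplex.prismOf (G := G) (r := r + 1) g (Fin.last _) =
    Simplex.evalAt (S.s g) := funext fun Λ => Simplex.face_last_prismOf g Λ
  rw [Deligne.pullback_congr h0 _ (Simplex.smooth_evalAt _),
    Deligne.pullback_congr h1 _ (Simplex.smooth_evalAt _)] at h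
  rw [← h]
  simp only [prismOp_apply, cech_apply, map_sum, map_zsmul, Deligne.pullback_pullback,
    Finset.smul_sum, smul_smul, ← pow_add]
  congr 1
  rw [Finset.sum_comm]
  refine Finset.sum_congr rfl fun j _ => Finset.sum_congr rfl fun i _ => ?_
  rw [add_comm (i : ℕ)]

end Prism

/-! ### The transgression over `L𝒢(W)` -/

section TransgressionMap

variable (W : AdmissibleCover) (G : DGrpd.{u})

/-- The object `(t, V_i)` of `S¹_W`, with `t` clamped to `V_i`. -/
def AdmissibleCover.pointAt (i : ℤ) (t : ℝ) : W.circle.Ob := ⟨i, W.clamp i t, W.clamp_mem i t⟩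

lemma AdmissibleCover.pointAt_eq {i : ℤ} {t : ℝ} (ht : t ∈ Icc (W.pt i) (W.pt (i + 1)))
    (h : t ∈ W.V i) : W.pointAt i t = (⟨i, t, h⟩ : W.Pt) :=
  AdmissibleCover.Pt.ext rfl (W.clamp_eq ht)

/-- The plots of this homotopy are definitionally the families `sweep`, so fibre integration along
it reproduces the integrals in `IsTransgression`. -/
lemma smoothHomotopy_evalAt (i : ℤ) (r : ℕ) : SmoothHomotopy fun t =>
    (Simplex.evalAt (W.pointAt i t) : Simplex (loopGrpd W G) r → Simplex G r) :=
  fun _ _ hP => isPlot_sweep W hP i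

/-- Integration over `[a, b]`, for loops restricted to `V_i`. -/
def arcInt (i : ℤ) (a b : ℝ) (r l : ℕ) :
    Deligne (Simplex G r) (l + 1) →+ Deligne (Simplex (loopGrpd W G) r) l :=
  (smoothHomotopy_evalAt W G i r).fiberIntegral a b l

/-- Integration over the circle. -/
def loopInt (r l : ℕ) : Deligne (Simplex G r) (l + 1) →+ Deligne (Simplex (loopGrpd W G) r) l :=
  ∑ i ∈ Finset.range W.N, arcInt W G i (W.pt i) (W.pt (i + 1)) r l

/-- The sum of the prism operators over the division points. -/
def junctionSum (r l : ℕ) :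
    Deligne (Simplex G (r + 1)) l →+ Deligne (Simplex (loopGrpd W G) r) l :=
  ∑ i ∈ Finset.range W.N, prismOp G (W.junction i) r l

/-- The transgression `Č^{m+1}(𝒢, ℂˣ(n+1)) → Č^m(L𝒢(W), ℂˣ(n))`. -/
def transgression (n m : ℕ) : Cochain G (n + 1) (m + 1) →+ Cochain (loopGrpd W G) n m where
  toFun x q := loopInt W G q.1.1 q.1.2 (x ⟨(q.1.1, q.1.2 + 1), by have := q.2; simp only; omega⟩) +
    (-1 : ℤ) ^ (m + 1) • junctionSum W G q.1.1 q.1.2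
      (x ⟨(q.1.1 + 1, q.1.2), by have := q.2; simp only; omega⟩)
  map_zero' := by
    funext q
    simp
  map_add' x y := by
    funext q
    simp only [Pi.add_apply, map_add, smul_add]
    abel

variable {G}

lemma loopInt_apply (r l : ℕ) (θ : Deligne (Simplex G r) (l + 1)) :
    loopInt W G r l θ = ∑ i ∈ Finset.range W.N, arcInt W G i (W.pt i) (W.pt (i + 1)) r l θ := by
  simp [loopInt]

lemma junctionSum_apply (r l : ℕ) (θ : Deligne (Simplex G (r + 1)) l) :
    junctionSum W G r l θ = ∑ i ∈ Finset.range W.N, prismOp G (W.junction i) r l θ := by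
  simp [junctionSum]

lemma loopInt_cech (r l : ℕ) (θ : Deligne (Simplex G r) (l + 1)) :
    loopInt W G (r + 1) l (Cochain.cech G r (l + 1) θ) =
      Cochain.cech (loopGrpd W G) r l (loopInt W G r l θ) := by
  simp only [loopInt_apply, cech_apply, map_sum, map_zsmul]
  rw [Finset.sum_comm]
  refine Finset.sum_congr rfl fun j _ => ?_
  rw [Finset.smul_sum]
  refine Finset.sum_congr rfl fun i _ => ?_
  refine congrArg _ ?_
  exact SmoothHomotopy.fiberIntegral_pullback _ (smoothHomotopy_evalAt W G i r)
    (Simplex.smooth_face j) (Simplex.smooth_face j) (W.pt_lt i).le (fun _ _ _ => rfl) l θ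

lemma d_junctionSum (r l : ℕ) (θ : Deligne (Simplex G (r + 1)) l) :
    Deligne.d l (junctionSum W G r l θ) = junctionSum W G r (l + 1) (Deligne.d l θ) := by
  simp only [junctionSum_apply, map_sum, d_prismOp]

lemma AdmissibleCover.N_pos : 0 < W.N := by
  rcases Nat.eq_zero_or_pos W.N with h | h
  · have := W.pt_add 0
    simp [h] at this
  · exact h

lemma AdmissibleCover.pt_N : W.pt W.N = 1 := by
  have := W.pt_add 0
  rwa [zero_add, W.pt_zero, zero_add] at this

lemma AdmissibleCover.pointAt_left (i : ℤ) : W.pointAt i (W.pt i) =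
    (⟨i, W.pt i, by have := W.pt_lt i; have := W.ε_pos; constructor <;> linarith⟩ : W.Pt) :=
  W.pointAt_eq ⟨le_rfl, (W.pt_lt i).le⟩ _

lemma AdmissibleCover.s_junction (i : ℕ) :
    W.circle.s (W.junction i) = W.pointAt i (W.pt (i + 1)) :=
  (W.pointAt_eq ⟨(W.pt_lt i).le, le_rfl⟩ _).symm

lemma AdmissibleCover.t_junction {i : ℕ} (h : i + 1 ≠ W.N) :
    W.circle.t (W.junction i) = W.pointAt (i + 1) (W.pt (i + 1)) := by
  rw [W.pointAt_left]
  refine AdmissibleCover.Pt.ext ?_ ?_ <;> simp [circle, junction, h]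

/-- The last junction carries the winding number `m = -1`, which takes index `N` to `0` and the
point `1` to `0`: this closes the circle. -/
lemma AdmissibleCover.t_junction_last {i : ℕ} (h : i + 1 = W.N) :
    W.circle.t (W.junction i) = W.pointAt 0 (W.pt 0) := by
  have h' : (i : ℤ) + 1 = W.N := by exact_mod_cast h
  rw [W.pointAt_left]
  refine AdmissibleCover.Pt.ext ?_ ?_
  · simp [circle, junction, h, h']
  · simp [circle, junction, h, h', W.pt_N, W.pt_zero]

/-- The boundary terms of the intervals and of the division points cancel. -/
lemma sum_boundary {A : Type*} [AddCommGroup A] (f : W.circle.Ob → A) :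
    (∑ i ∈ Finset.range W.N, (f (W.pointAt i (W.pt (i + 1))) - f (W.pointAt i (W.pt i)))) +
      ∑ i ∈ Finset.range W.N, (f (W.circle.t (W.junction i)) - f (W.circle.s (W.junction i))) =
      0 := by
  obtain ⟨N, hN⟩ : ∃ N, W.N = N + 1 := ⟨W.N - 1, by have := W.N_pos; omega⟩
  -- The junction targets are the starting points of the arcs, cyclically shifted by one.
  have h1 : ∑ i ∈ Finset.range W.N, f (W.circle.t (W.junction i)) =
      ∑ i ∈ Finset.range W.N, f (W.pointAt i (W.pt i)) := by
    rw [hN, Finset.sum_range_succ, Finset.sum_range_succ', W.t_junction_last hN.symm]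
    congr 1
    refine Finset.sum_congr rfl fun i hi => ?_
    rw [W.t_junction (by have := Finset.mem_range.1 hi; omega)]
    push_cast
    rfl
  simp only [W.s_junction, Finset.sum_sub_distrib, h1]
  abel

lemma loopInt_d_zero (r : ℕ) (θ : Deligne (Simplex G r) 0) :
    loopInt W G r 0 (Deligne.d 0 θ) = ∑ i ∈ Finset.range W.N,
      (evalPullback G (W.pointAt i (W.pt (i + 1))) r 0 θ -
        evalPullback G (W.pointAt i (W.pt i)) r 0 θ) := by
  rw [loopInt_apply]
  exact Finset.sum_congr rfl fun i _ => SmoothHomotopy.fiberIntegral_d_zero _ _ _ _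

lemma loopInt_d_succ (r l : ℕ) (θ : Deligne (Simplex G r) (l + 1)) :
    loopInt W G r (l + 1) (Deligne.d (l + 1) θ) + Deligne.d l (loopInt W G r l θ) =
      ∑ i ∈ Finset.range W.N, (evalPullback G (W.pointAt i (W.pt (i + 1))) r (l + 1) θ -
        evalPullback G (W.pointAt i (W.pt i)) r (l + 1) θ) := by
  rw [loopInt_apply, loopInt_apply, map_sum, ← Finset.sum_add_distrib]
  exact Finset.sum_congr rfl fun i _ => SmoothHomotopy.fiberIntegral_d_succ _ _ _ _ _

lemma junctionSum_cech_zero (l : ℕ) (θ : Deligne (Simplex G 0) l) :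
    junctionSum W G 0 l (Cochain.cech G 0 l θ) = ∑ i ∈ Finset.range W.N,
      (evalPullback G (W.circle.t (W.junction i)) 0 l θ -
        evalPullback G (W.circle.s (W.junction i)) 0 l θ) := by
  rw [junctionSum_apply]
  exact Finset.sum_congr rfl fun i _ => prismOp_cech_zero _ _ _

lemma junctionSum_cech_succ (r l : ℕ) (θ : Deligne (Simplex G (r + 1)) l) :
    junctionSum W G (r + 1) l (Cochain.cech G (r + 1) l θ) +
      Cochain.cech (loopGrpd W G) r l (junctionSum W G r l θ) =
      ∑ i ∈ Finset.range W.N, (evalPullback G (W.circle.t (W.junction i)) (r + 1) l θ -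
        evalPullback G (W.circle.s (W.junction i)) (r + 1) l θ) := by
  rw [junctionSum_apply, junctionSum_apply, map_sum, ← Finset.sum_add_distrib]
  exact Finset.sum_congr rfl fun i _ => prismOp_cech_succ _ _ _ _

/-- Write `P` for `junctionSum`. The terms `∫ δ` and `δ ∫` agree, and so do `P d` and `d P`. The
rest of `τ D x - D τ x` is `(-1)^m` times `(∫ d + d ∫) x + (P δ + δ P) x`, the total of the boundary
values around the circle. The cases differ only in which terms are missing: `δ P` for `r = 0`, and
`d ∫` for `l = 0`. -/
lemma transgression_D (n m : ℕ) (x : Cochain G (n + 1) (m + 1)) :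
    transgression W G n (m + 1) (Cochain.D G (n + 1) (m + 1) x) =
      Cochain.D (loopGrpd W G) n m (transgression W G n m x) := by
  funext ⟨⟨r, l⟩, h⟩
  have e1 : (-1 : ℤ) ^ (m + 1 + 1) = (-1) ^ m := by ring
  have e2 : (-1 : ℤ) ^ (m + 1) = -(-1) ^ m := by ring
  have e3 : (-1 : ℤ) ^ m * (-1) ^ m = 1 := by rw [← mul_pow]; simp
  rcases r with _ | r <;> rcases l with _ | l
  · simp only at h; omega
  · have hk := sum_boundary W fun o => evalPullback G o 0 (l + 1) (x ⟨(0, l + 1), by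
      simp only at h ⊢; omega⟩)
    rw [← loopInt_d_succ, ← junctionSum_cech_zero] at hk
    simp only [transgression, Cochain.D, AddMonoidHom.coe_mk, ZeroHom.coe_mk, Cochain.horizontal,
      Cochain.vertical, map_add, map_zsmul, d_junctionSum, smul_add, smul_smul, e1, e2, e3, neg_smul,
      one_smul, zero_add, smul_neg, map_neg]
    have h0 := congrArg (fun z => (-1 : ℤ) ^ m • z) hk
    simp only [smul_add, smul_zero] at h0
    rw [← sub_eq_zero]
    refine Eq.trans ?_ h0
    abel
  · have hk := sum_boundary W fun o => evalPullback G o (r + 1) 0 (x ⟨(r + 1, 0), by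
      simp only at h ⊢; omega⟩)
    rw [← loopInt_d_zero, ← junctionSum_cech_succ] at hk
    simp only [transgression, Cochain.D, AddMonoidHom.coe_mk, ZeroHom.coe_mk, Cochain.horizontal,
      Cochain.vertical, map_add, map_zsmul, e1, e2, neg_smul, loopInt_cech,
      smul_zero, add_zero, map_neg]
    have h0 := congrArg (fun z => (-1 : ℤ) ^ m • z) hk
    simp only [smul_add, smul_zero] at h0
    rw [← sub_eq_zero]
    refine Eq.trans ?_ h0
    abel
  · have hk := sum_boundary W fun o => evalPullback G o (r + 1) (l + 1) (x ⟨(r + 1, l + 1), by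
      simp only at h ⊢; omega⟩)
    rw [← loopInt_d_succ, ← junctionSum_cech_succ] at hk
    simp only [transgression, Cochain.D, AddMonoidHom.coe_mk, ZeroHom.coe_mk, Cochain.horizontal,
      Cochain.vertical, map_add, map_zsmul, d_junctionSum, smul_add, smul_smul, e1, e2, e3, neg_smul,
      one_smul, loopInt_cech, map_neg, smul_neg]
    have h0 := congrArg (fun z => (-1 : ℤ) ^ m • z) hk
    simp only [smul_add, smul_zero] at h0
    rw [← sub_eq_zero]
    refine Eq.trans ?_ h0
    abel

/-- Only bidegree `(0, 0)` occurs, and the value is minus the sum of the boundary values of the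
function `x` around the circle. -/
lemma transgression_D_zero (n : ℕ) (x : Cochain G (n + 1) 0) :
    transgression W G n 0 (Cochain.D G (n + 1) 0 x) = 0 := by
  funext ⟨⟨r, l⟩, h⟩
  obtain ⟨rfl, rfl⟩ : r = 0 ∧ l = 0 := by simp only at h; omega
  have hk := sum_boundary W fun o => evalPullback G o 0 0 (x ⟨(0, 0), by simp⟩)
  rw [← loopInt_d_zero, ← junctionSum_cech_zero] at hk
  simp only [transgression, Cochain.D, AddMonoidHom.coe_mk, ZeroHom.coe_mk, Cochain.horizontal,
    Cochain.vertical, zero_add, pow_one, neg_smul, one_smul, neg_zero, add_zero, map_neg]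
  rw [← neg_add, hk, neg_zero]
  rfl

lemma isCochainMap_transgression (n : ℕ) : IsCochainMap (Cochain.D G (n + 1))
    (Cochain.D (loopGrpd W G) n) (transgression W G n) :=
  ⟨transgression_D_zero W n, transgression_D W n⟩

lemma transgression_pullback {H : DGrpd.{u}} (F : DFunctor G H) (n m : ℕ)
    (x : Cochain H (n + 1) (m + 1)) :
    transgression W G n m (Cochain.pullback F (n + 1) (m + 1) x) =
      Cochain.pullback (loopMap W F) n m (transgression W H n m x) := by
  funext ⟨⟨r, l⟩, h⟩
  simp only [transgression, Cochain.pullback, AddMonoidHom.coe_mk, ZeroHom.coe_mk, map_add,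
    map_zsmul, loopInt_apply, junctionSum_apply, prismOp_apply, map_sum]
  congr 1
  · refine Finset.sum_congr rfl fun i _ => ?_
    exact SmoothHomotopy.fiberIntegral_pullback _ (smoothHomotopy_evalAt W H i r)
      (Simplex.smooth_map (loopMap W F) r) (Simplex.smooth_map F r) (W.pt_lt i).le
      (fun _ _ _ => rfl) l _
  · simp only [Deligne.pullback_pullback]
    rfl

lemma isTransgression_transgression (n m : ℕ) (x : Cochain G (n + 1) (m + 1)) :
    IsTransgression W x (transgression W G n m x) where
  function r h Λ := by
    have hI : (Deligne.value (loopInt W G r 0 (x ⟨(r, 1), by simp only; omega⟩)) Λ : ℂ) =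
        Complex.exp (loopIntegral W (l := 0) (x ⟨(r, 1), by simp only; omega⟩)
          (fun _ : E 0 => Λ) isPlot_const 0 Fin.elim0) := by
      change ((Additive.toMul (Deligne.valueHom Λ _) : ℂˣ) : ℂ) = _
      -- The sum over arcs in the additively written group is a product in `ℂˣ`, which matches the
      -- exponential of the sum of integrals.
      rw [loopInt_apply, map_sum, toMul_sum, Units.coe_prod, loopIntegral, Complex.exp_sum]
      exact Finset.prod_congr rfl fun i _ => SmoothHomotopy.value_fiberIntegral _ _ _ _ _
    have hP : Additive.toMul (Deligne.valueHom Λ ((-1 : ℤ) ^ (m + 1) •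
        junctionSum W G r 0 (x ⟨(r + 1, 0), by simp only; omega⟩))) =
        ∏ i ∈ Finset.range W.N, ∏ j : Fin (r + 1),
          Deligne.value (x ⟨(r + 1, 0), by simp only; omega⟩) (prism W i j Λ) ^
          ((-1 : ℤ) ^ ((j : ℕ) + (m + 1))) := by
      simp only [junctionSum_apply, prismOp_apply, Finset.smul_sum, smul_smul, ← pow_add, map_sum,
        map_zsmul, toMul_sum, toMul_zsmul]
      refine Finset.prod_congr rfl fun i _ => Finset.prod_congr rfl fun j _ => ?_
      rw [add_comm (m + 1)]
      rfl
    rw [← hI, ← hP]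
    rfl
  form r l h d P hP c v := by
    change Deligne.evalHom P hP c v (loopInt W G r (l + 1) _ + (-1 : ℤ) ^ (m + 1) •
      junctionSum W G r (l + 1) _) = _
    rw [map_add]
    congr 1
    · rw [loopInt_apply, map_sum]
      exact Finset.sum_congr rfl fun i _ => SmoothHomotopy.eval_fiberIntegral _ _ _ _ _ _ _ _
    · simp only [junctionSum_apply, prismOp_apply, Finset.smul_sum, smul_smul, ← pow_add, map_sum,
        map_zsmul]
      refine Finset.sum_congr rfl fun i _ => Finset.sum_congr rfl fun j _ => ?_
      rw [add_comm (m + 1), zsmul_eq_mul]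
      push_cast
      rfl

end TransgressionMap

/-! ### Refinements -/

section RefinementInvariance

namespace AdmissibleCover.Refinement

variable {W W' : AdmissibleCover} (ρ : W.Refinement W')

lemma idx_zero : ρ.idx 0 = 0 := by
  have h1 := ρ.le_pt 0
  have h2 := ρ.pt_le 0
  have h3 := W'.pt_lt 0
  rw [W'.pt_zero] at h1 h3
  have h1' : W.pt (ρ.idx 0) ≤ W.pt 0 := by rw [W.pt_zero]; exact h1
  have h2' : W.pt 0 < W.pt (ρ.idx 0 + 1) := by rw [W.pt_zero]; linarith
  rw [W.strictMono_pt.le_iff_le] at h1'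
  rw [W.strictMono_pt.lt_iff_lt] at h2'
  omega

lemma idx_N : ρ.idx W'.N = W.N := by
  have := ρ.idx_add 0 1
  rw [zero_add, one_mul, idx_zero] at this
  simpa using this

/-- Consecutive fine intervals lie in the same coarse interval or in adjacent ones. In the latter
case their common end is a division point of the coarse subdivision. -/
lemma idx_succ (i : ℤ) : ρ.idx (i + 1) = ρ.idx i ∨
    ρ.idx (i + 1) = ρ.idx i + 1 ∧ W'.pt (i + 1) = W.pt (ρ.idx i + 1) := by
  have h1 := ρ.le_pt (i + 1)
  have h2 := ρ.pt_le i
  have h3 := ρ.le_pt i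
  have h4 := ρ.pt_le (i + 1)
  have h5 := W'.pt_lt i
  have h6 := W'.pt_lt (i + 1)
  have a := W.strictMono_pt.le_iff_le.1 (h1.trans h2)
  have b := W.strictMono_pt.lt_iff_lt.1 ((h3.trans_lt h5).trans (h6.trans_le h4))
  have c : ρ.idx (i + 1) = ρ.idx i ∨ ρ.idx (i + 1) = ρ.idx i + 1 := by omega
  refine c.imp_right fun c => ⟨c, le_antisymm h2 ?_⟩
  rwa [c] at h1

lemma idx_nonneg (i : ℕ) : 0 ≤ ρ.idx i := by
  induction i with
  | zero => exact ρ.idx_zero.ge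
  | succ i ih =>
    push_cast
    rcases ρ.idx_succ i with h | ⟨h, -⟩ <;> omega

/-- A sum over the intervals of the finer subdivision. -/
lemma sum_intervals {A : Type*} [AddCommGroup A] (J : ℤ → ℝ → ℝ → A)
    (hJ : ∀ i a b c, J i a b + J i b c = J i a c) :
    ∑ i ∈ Finset.range W'.N, J (ρ.idx i) (W'.pt i) (W'.pt (i + 1)) =
      ∑ i ∈ Finset.range W.N, J i (W.pt i) (W.pt (i + 1)) := by
  have hJ0 : ∀ i a, J i a a = 0 := fun i a => by simpa using hJ i a a a
  -- After `k` fine intervals one has covered all coarse intervals before number `idx k`, and that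
  -- one up to `W'.pt k`. The remainder is empty whenever `idx` has just advanced.
  have key : ∀ k : ℕ, ∑ i ∈ Finset.range k, J (ρ.idx i) (W'.pt i) (W'.pt (i + 1)) =
      ∑ i ∈ Finset.range (ρ.idx k).toNat, J i (W.pt i) (W.pt (i + 1)) +
        J (ρ.idx k) (W.pt (ρ.idx k)) (W'.pt k) := by
    intro k
    induction k with
    | zero => simp [ρ.idx_zero, W.pt_zero, W'.pt_zero, hJ0]
    | succ k ih =>
      rw [Finset.sum_range_succ, ih, add_assoc, hJ]
      push_cast
      rcases ρ.idx_succ k with h | ⟨h, h'⟩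
      · rw [h]
      · have hk := ρ.idx_nonneg k
        rw [h, h', hJ0, add_zero, Int.toNat_add hk zero_le_one, Int.toNat_one,
          Finset.sum_range_succ, Int.toNat_of_nonneg hk]
  rw [key, ρ.idx_N, Int.toNat_natCast, W.pt_N, W'.pt_N, hJ0, add_zero]

/-- A sum over those division points of the finer subdivision which belong to the coarser one. -/
lemma sum_junctions {A : Type*} [AddCommGroup A] (f' f : ℕ → A)
    (h₀ : ∀ i : ℕ, ρ.idx (i + 1) = ρ.idx i → f' i = 0)
    (h₁ : ∀ i j : ℕ, ρ.idx i = j → ρ.idx (i + 1) = j + 1 → f' i = f j) :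
    ∑ i ∈ Finset.range W'.N, f' i = ∑ i ∈ Finset.range W.N, f i := by
  have key : ∀ k : ℕ, ∑ i ∈ Finset.range k, f' i =
      ∑ i ∈ Finset.range (ρ.idx k).toNat, f i := by
    intro k
    induction k with
    | zero => simp [ρ.idx_zero]
    | succ k ih =>
      rw [Finset.sum_range_succ, ih]
      push_cast
      have hk := ρ.idx_nonneg k
      rcases ρ.idx_succ k with h | ⟨h, -⟩
      · rw [h, h₀ k h, add_zero]
      · have e := Int.toNat_of_nonneg hk
        rw [h, Int.toNat_add hk zero_le_one, Int.toNat_one, Finset.sum_range_succ,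
          h₁ k _ e.symm (by rw [h, e])]
  rw [key, ρ.idx_N, Int.toNat_natCast]

lemma functor_pointAt (i : ℤ) {t : ℝ} (ht : t ∈ Icc (W'.pt i) (W'.pt (i + 1))) :
    ρ.functor.ob (W'.pointAt i t) = W.pointAt (ρ.idx i) t := by
  refine Pt.ext rfl ?_
  exact (W'.clamp_eq ht).trans
    (W.clamp_eq ⟨(ρ.le_pt i).trans ht.1, ht.2.trans (ρ.pt_le i)⟩).symm

/-- A division point inserted inside a coarse interval joins that interval to itself. The winding
number is zero there, because at `i + 1 = N'` the index must advance to `N`. -/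
lemma functor_junction_of_eq {i : ℕ} (h : ρ.idx (i + 1) = ρ.idx i) :
    ∃ o : W.circle.Ob, ρ.functor.ar (W'.junction i) = W.circle.e o := by
  refine ⟨W.circle.s (ρ.functor.ar (W'.junction i)), Arr.ext rfl h ?_ rfl⟩
  have hN : i + 1 ≠ W'.N := fun hN => by
    have hN' : (i : ℤ) + 1 = W'.N := by exact_mod_cast hN
    have h1 := ρ.le_pt i
    have h2 := W'.pt_lt i
    rw [hN', W'.pt_N] at h2
    rw [← h, hN', ρ.idx_N, W.pt_N] at h1
    linarith
  exact if_neg hN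

/-- The division points coincide, and the winding numbers agree because each is `-1` exactly when
the common point is `1`. -/
lemma functor_junction_of_succ {i j : ℕ} (hi : ρ.idx i = j) (h : ρ.idx (i + 1) = j + 1) :
    ρ.functor.ar (W'.junction i) = W.junction j := by
  refine Arr.ext hi h ?_ ?_
  · have hN : i + 1 = W'.N ↔ j + 1 = W.N := by
      rcases ρ.idx_succ i with h' | ⟨-, h'⟩
      · omega
      rw [hi] at h'
      have e1 : i + 1 = W'.N ↔ W'.pt (i + 1) = 1 := by
        rw [← W'.pt_N, W'.strictMono_pt.injective.eq_iff]; norm_cast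
      have e2 : j + 1 = W.N ↔ W.pt (j + 1) = 1 := by
        rw [← W.pt_N, W.strictMono_pt.injective.eq_iff]; norm_cast
      rw [e1, e2, h']
    change (if i + 1 = W'.N then -1 else 0 : ℤ) = if j + 1 = W.N then -1 else 0
    simp only [hN]
  · rcases ρ.idx_succ i with h' | ⟨-, h'⟩
    · omega
    · rw [hi] at h'
      exact h'

end AdmissibleCover.Refinement

/-! ### Compatibility of the transgression with refinements -/

variable {W W' : AdmissibleCover} (ρ : W.Refinement W') {G : DGrpd.{u}}

lemma pullback_arcInt (i : ℤ) (r l : ℕ) (θ : Deligne (Simplex G r) (l + 1)) :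
    Deligne.pullback (Simplex.map (loopIncl ρ G) r) (Simplex.smooth_map _ r) l
      (arcInt W' G i (W'.pt i) (W'.pt (i + 1)) r l θ) =
    arcInt W G (ρ.idx i) (W'.pt i) (W'.pt (i + 1)) r l θ := by
  have h := SmoothHomotopy.fiberIntegral_pullback (smoothHomotopy_evalAt W G (ρ.idx i) r)
    (smoothHomotopy_evalAt W' G i r) (Simplex.smooth_map (loopIncl ρ G) r) dSmooth_id
    (W'.pt_lt i).le (fun t ht Λ => by rw [← ρ.functor_pointAt i ht]; rfl) l θ
  rw [Deligne.pullback_id] at h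
  exact h.symm

lemma pullback_loopInt (r l : ℕ) (θ : Deligne (Simplex G r) (l + 1)) :
    Deligne.pullback (Simplex.map (loopIncl ρ G) r) (Simplex.smooth_map _ r) l
      (loopInt W' G r l θ) = loopInt W G r l θ := by
  rw [loopInt_apply, loopInt_apply, map_sum]
  simp only [pullback_arcInt]
  exact ρ.sum_intervals (fun i a b => arcInt W G i a b r l θ)
    fun i a b c => SmoothHomotopy.fiberIntegral_add_adjacent _ a b c l θ

lemma pullback_prismOp (g : W'.circle.Ar) (r l : ℕ) (θ : Deligne (Simplex G (r + 1)) l) :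
    Deligne.pullback (Simplex.map (loopIncl ρ G) r) (Simplex.smooth_map _ r) l
      (prismOp G g r l θ) = prismOp G (ρ.functor.ar g) r l θ := by
  simp only [prismOp_apply, map_sum, map_zsmul, Deligne.pullback_pullback]
  refine Finset.sum_congr rfl fun j _ => congrArg _ (Deligne.pullback_congr (funext fun Λ => ?_)
    _ _ _ _)
  refine Simplex.ext ?_ ?_
  · funext a
    change DFunctor.ob (Λ.ob _) (ρ.functor.ob _) = DFunctor.ob (Λ.ob _) _
    refine congrArg _ ?_
    simp only [Simplex.ofArrow]
    split_ifs
    · exact (ρ.functor.t_ar g).symm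
    · exact (ρ.functor.s_ar g).symm
  · funext a b
    change DTrans.map (Λ.arr _ _) (ρ.functor.ar _) = DTrans.map (Λ.arr _ _) _
    refine congrArg _ ?_
    simp only [Simplex.ofArrow]
    split_ifs
    · rw [ρ.functor.map_e, ρ.functor.t_ar]
    -- The inverse arrow has its indices shifted by multiples of `N'`, which `idx` turns into
    -- multiples of `N`.
    · refine AdmissibleCover.Arr.ext ?_ ?_ rfl rfl <;> exact ρ.idx_add _ _
    · rfl
    · rw [ρ.functor.map_e, ρ.functor.s_ar]

/-- Over an identity arrow `ϑ_j` inserts an identity at the vertex `j`, so `ϑ_j^*` factors through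
the pull-back along a degeneracy. -/
lemma prismOp_e {S : DGrpd.{v}} (o : S.Ob) (r l : ℕ) (θ : Deligne (Simplex G (r + 1)) l)
    (hθ : ∀ j : Fin (r + 1), Deligne.pullback (Simplex.degen j) (Simplex.smooth_degen j) l θ = 0) :
    prismOp G (S.e o) r l θ = 0 := by
  rw [prismOp_apply]
  refine Finset.sum_eq_zero fun j _ => ?_
  have hinv : S.inv (S.e o) = S.e o := by
    have h := S.mul_inv (S.e o)
    rw [S.e_mul] at h
    rw [h, S.s_e]
  have h : Simplex.prismOf (G := G) (S.e o) j = Simplex.degen j ∘ Simplex.evalAt o := by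
    funext Λ
    refine Simplex.ext ?_ ?_
    · funext a
      change DFunctor.ob (Λ.ob _) _ = DFunctor.ob (Λ.ob _) _
      refine congrArg _ ?_
      simp only [Simplex.ofArrow, Simplex.const, S.s_e, S.t_e, ite_self]
    · funext a b
      change DTrans.map (Λ.arr _ _) _ = DTrans.map (Λ.arr _ _) _
      refine congrArg _ ?_
      simp only [Simplex.ofArrow, Simplex.const, S.s_e, S.t_e, hinv, ite_self]
  rw [Deligne.pullback_congr h _ ((Simplex.smooth_degen j).comp (Simplex.smooth_evalAt o)),
    ← Deligne.pullback_pullback _ (Simplex.smooth_evalAt o) _ (Simplex.smooth_degen j), hθ,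
    map_zero, smul_zero]

/-- Junctions at coarse division points match one to one; those at new points become identities.
Normalization is what removes the latter. -/
lemma pullback_junctionSum (r l : ℕ) (θ : Deligne (Simplex G (r + 1)) l)
    (hθ : ∀ j : Fin (r + 1), Deligne.pullback (Simplex.degen j) (Simplex.smooth_degen j) l θ = 0) :
    Deligne.pullback (Simplex.map (loopIncl ρ G) r) (Simplex.smooth_map _ r) l
      (junctionSum W' G r l θ) = junctionSum W G r l θ := by
  rw [junctionSum_apply, junctionSum_apply, map_sum]
  simp only [pullback_prismOp]
  refine ρ.sum_junctions _ _ (fun i hi => ?_) (fun i j hi hj => ?_)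
  · obtain ⟨o, ho⟩ := ρ.functor_junction_of_eq hi
    rw [ho]
    exact prismOp_e o r l θ hθ
  · rw [ρ.functor_junction_of_succ hi hj]

/-- On normalized cochains the transgression is compatible with refinements. -/
lemma pullback_transgression (n m : ℕ) (x : Cochain G (n + 1) (m + 1)) (hx : x.IsNormalized) :
    Cochain.pullback (loopIncl ρ G) n m (transgression W' G n m x) = transgression W G n m x := by
  funext ⟨⟨r, l⟩, h⟩
  simp only [transgression, Cochain.pullback, AddMonoidHom.coe_mk, ZeroHom.coe_mk, map_add,
    map_zsmul]
  rw [pullback_loopInt, pullback_junctionSum]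
  exact hx r l (by simp only at h; omega)

end RefinementInvariance

/-! ### Normalization of cosimplicial objects -/

section Cosimplicial

open CategoryTheory AlgebraicTopology Opposite
open scoped Simplicial

variable {C : Type v} [Category.{w} C] [Preadditive C] (A : SimplexCategory ⥤ C)

/-- The alternating sum of the cofaces. -/
def alternatingCoface (k : ℕ) : A.obj ⦋k⦌ ⟶ A.obj ⦋k + 1⦌ :=
  ∑ i : Fin (k + 2), (-1 : ℤ) ^ (i : ℕ) • A.map (SimplexCategory.δ i)

/-- The projection of a cosimplicial object onto the common kernel of its codegeneracies. -/
def normMap (k : ℕ) : A.obj ⦋k⦌ ⟶ A.obj ⦋k⦌ :=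
  ((DoldKan.PInfty (X := (A.op : SimplicialObject Cᵒᵖ))).f k).unop

/-- The homotopy between the normalization and the identity. -/
def normHomotopy (k : ℕ) : A.obj ⦋k + 1⦌ ⟶ A.obj ⦋k⦌ :=
  ((DoldKan.homotopyPInftyToId (A.op : SimplicialObject Cᵒᵖ)).hom k (k + 1)).unop

/-- A cosimplicial object of `C` is a simplicial object of `Cᵒᵖ`. This identity translates the
Dold–Kan statements for the alternating face map complex of `A.op` into statements about cofaces. -/
lemma unop_d (k : ℕ) :
    ((AlternatingFaceMapComplex.obj (A.op : SimplicialObject Cᵒᵖ)).d (k + 1) k).unop =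
      alternatingCoface A k := by
  rw [AlternatingFaceMapComplex.obj_d_eq]
  simp [alternatingCoface, unop_sum]
  rfl

lemma normMap_zero : normMap A 0 = 𝟙 _ := rfl

lemma normMap_comp_coface (k : ℕ) :
    normMap A k ≫ alternatingCoface A k = alternatingCoface A k ≫ normMap A (k + 1) := by
  rw [← unop_d]
  exact (congrArg Quiver.Hom.unop
    ((DoldKan.PInfty (X := (A.op : SimplicialObject Cᵒᵖ))).comm (k + 1) k)).symm

lemma normMap_comp_codegeneracy (k : ℕ) (i : Fin (k + 1)) :
    normMap A (k + 1) ≫ A.map (SimplexCategory.σ i) = 0 :=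
  congrArg Quiver.Hom.unop (DoldKan.σ_comp_PInfty (A.op : SimplicialObject Cᵒᵖ) i)

/-- The complement `QInfty` of the Dold–Kan projector is a sum of maps factoring through
degeneracies. Dually, each summand begins with a codegeneracy, so `normMap` fixes everything the
codegeneracies kill. -/
lemma exists_normMap_add (k : ℕ) : ∃ c : Fin (k + 1) → (A.obj ⦋k⦌ ⟶ A.obj ⦋k + 1⦌),
    normMap A (k + 1) + ∑ i, A.map (SimplexCategory.σ i) ≫ c i = 𝟙 _ := by
  have h := DoldKan.PInfty_f_add_QInfty_f (X := (A.op : SimplicialObject Cᵒᵖ)) (k + 1)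
  rw [DoldKan.QInfty_f, DoldKan.decomposition_Q] at h
  refine ⟨fun i => (((DoldKan.P (X := (A.op : SimplicialObject Cᵒᵖ)) (i.rev : Fin (k + 1))).f
    (k + 1)) ≫
      SimplicialObject.δ (A.op : SimplicialObject Cᵒᵖ) i.succ).unop, ?_⟩
  have h' := congrArg Quiver.Hom.unop h
  rw [unop_add, unop_sum] at h'
  refine Eq.trans (congrArg (normMap A (k + 1) + ·) ?_) h'
  rw [Finset.filter_true_of_mem fun i _ => i.2]
  -- The decomposition of `Q` indexes the degeneracies in reverse order.
  · refine Fintype.sum_equiv Fin.revPerm _ _ fun i => ?_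
    simp only [Fin.revPerm_apply, Fin.rev_rev, ← Category.assoc]
    rfl

lemma normMap_naturality {A B : SimplexCategory ⥤ C} (α : A ⟶ B) (k : ℕ) :
    α.app ⦋k⦌ ≫ normMap B k = normMap A k ≫ α.app ⦋k⦌ :=
  congrArg Quiver.Hom.unop (DoldKan.PInfty_f_naturality k (NatTrans.op α)).symm

lemma normMap_zero_eq : normMap A 0 =
    alternatingCoface A 0 ≫ normHomotopy A 0 + 𝟙 _ := by
  have h := (DoldKan.homotopyPInftyToId (A.op : SimplicialObject Cᵒᵖ)).comm 0
  rw [Homotopy.dNext_zero_chainComplex, Homotopy.prevD_chainComplex, zero_add] at h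
  rw [← unop_d]
  exact congrArg Quiver.Hom.unop h

lemma normMap_succ_eq (k : ℕ) : normMap A (k + 1) =
    normHomotopy A k ≫ alternatingCoface A k +
      alternatingCoface A (k + 1) ≫ normHomotopy A (k + 1) + 𝟙 _ := by
  have h := (DoldKan.homotopyPInftyToId (A.op : SimplicialObject Cᵒᵖ)).comm (k + 1)
  rw [Homotopy.dNext_succ_chainComplex, Homotopy.prevD_chainComplex] at h
  rw [← unop_d, ← unop_d]
  exact congrArg Quiver.Hom.unop h

end Cosimplicial

/-! ### Normalization of cochains -/

section Normalization

open CategoryTheory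

/-- The complex `ℂˣ → 𝒜¹ → 𝒜² → ⋯` as a sequence of groups. -/
def deligneSequence (X : Type u) [DiffeologicalSpace X] : ℕ ⥤ AddCommGrpCat.{u} :=
  Functor.ofSequence (X := fun l => AddCommGrpCat.of (Deligne X l))
    fun l => AddCommGrpCat.ofHom (Deligne.d l)

/-- The map of sequences induced by a smooth map. -/
def deligneSequenceMap {X Y : Type u} [DiffeologicalSpace X] [DiffeologicalSpace Y] (g : X → Y)
    (hg : DSmooth g) : deligneSequence Y ⟶ deligneSequence X :=
  NatTrans.ofSequence (F := deligneSequence Y) (G := deligneSequence X)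
    (fun l => AddCommGrpCat.ofHom (Deligne.pullback g hg l)) fun l => by
      have hd (X : Type u) [DiffeologicalSpace X] :
          (deligneSequence X).map (homOfLE (Nat.le_add_right l 1)) =
            AddCommGrpCat.ofHom (Deligne.d l) := Functor.ofSequence_map_homOfLE_succ _ _
      rw [hd, hd]
      exact AddCommGrpCat.hom_ext (AddMonoidHom.ext fun x =>
        (Deligne.d_pullback g hg l x).symm)

variable (G : DGrpd.{u})

/-- The cosimplicial sequence of groups `Γ(𝒢_k, 𝒜ˡ)`. -/
def cosimplicialForms : SimplexCategory ⥤ ℕ ⥤ AddCommGrpCat.{u} where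
  obj K := deligneSequence (Simplex G K.len)
  map f := deligneSequenceMap (Simplex.reindex f.toOrderHom) (Simplex.smooth_reindex _)
  map_id K := NatTrans.ext (funext fun l => AddCommGrpCat.hom_ext (AddMonoidHom.ext fun x =>
    Deligne.pullback_id (X := Simplex G K.len) l x))
  map_comp {K L M} f g := NatTrans.ext (funext fun l => AddCommGrpCat.hom_ext
    (AddMonoidHom.ext fun x => (Deligne.pullback_pullback
      (Simplex.reindex g.toOrderHom : Simplex G M.len → Simplex G L.len) (Simplex.smooth_reindex _)
      (Simplex.reindex f.toOrderHom : Simplex G L.len → Simplex G K.len)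
      (Simplex.smooth_reindex _) l x).symm))

variable {G} in
/-- The components of a morphism of sequences of forms. -/
def formsHom {K L : SimplexCategory} (l : ℕ) :
    ((cosimplicialForms G).obj K ⟶ (cosimplicialForms G).obj L) →+
      Deligne (Simplex G K.len) l →+ Deligne (Simplex G L.len) l where
  toFun f := (f.app l).hom
  map_zero' := rfl
  map_add' _ _ := rfl

/-- The normalization of forms on the space of strings. -/
def normOp (k l : ℕ) : Deligne (Simplex G k) l →+ Deligne (Simplex G k) l :=
  formsHom l (normMap (cosimplicialForms G) k)

/-- The homotopy between the normalization and the identity. -/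
def homOp (k l : ℕ) : Deligne (Simplex G (k + 1)) l →+ Deligne (Simplex G k) l :=
  formsHom l (normHomotopy (cosimplicialForms G) k)

variable {G}

lemma alternatingCoface_apply (k l : ℕ) (x : Deligne (Simplex G k) l) :
    formsHom l (alternatingCoface (cosimplicialForms G) k) x = Cochain.cech G k l x := by
  rw [alternatingCoface, cech_apply, map_sum, AddMonoidHom.finsetSum_apply]
  refine Finset.sum_congr rfl fun i _ => ?_
  rw [map_zsmul]
  rfl

lemma normOp_zero (l : ℕ) (x : Deligne (Simplex G 0) l) : normOp G 0 l x = x := by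
  rw [normOp, normMap_zero]
  rfl

lemma normOp_cech (k l : ℕ) (x : Deligne (Simplex G k) l) :
    normOp G (k + 1) l (Cochain.cech G k l x) = Cochain.cech G k l (normOp G k l x) := by
  have h := congrArg (fun f => formsHom l f x) (normMap_comp_coface (cosimplicialForms G) k)
  rw [← alternatingCoface_apply, ← alternatingCoface_apply]
  exact h.symm

/-- Naturality of a morphism of sequences at `l ≤ l + 1` is commutation with `d`. Because the
cosimplicial object takes values in sequences rather than single groups, the normalization and its
homotopy commute with `d` automatically. -/
lemma formsHom_d {K L : SimplexCategory} (f : (cosimplicialForms G).obj K ⟶ (cosimplicialForms G).obj L)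
    (l : ℕ) (x : Deligne (Simplex G K.len) l) :
    formsHom (l + 1) f (Deligne.d l x) = Deligne.d l (formsHom l f x) := by
  have h := f.naturality (homOfLE (Nat.le_add_right l 1))
  have hd (K : SimplexCategory) : ((cosimplicialForms G).obj K).map (homOfLE (Nat.le_add_right l 1)) =
      AddCommGrpCat.ofHom (Deligne.d l) := Functor.ofSequence_map_homOfLE_succ _ _
  rw [hd, hd] at h
  exact congrArg (fun g => g.hom x) h

lemma normOp_d (k l : ℕ) (x : Deligne (Simplex G k) l) :
    normOp G k (l + 1) (Deligne.d l x) = Deligne.d l (normOp G k l x) :=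
  formsHom_d _ l x

lemma homOp_d (k l : ℕ) (x : Deligne (Simplex G (k + 1)) l) :
    homOp G k (l + 1) (Deligne.d l x) = Deligne.d l (homOp G k l x) :=
  formsHom_d _ l x

lemma pullback_degen_normOp (k l : ℕ) (i : Fin (k + 1)) (x : Deligne (Simplex G (k + 1)) l) :
    Deligne.pullback (Simplex.degen i) (Simplex.smooth_degen i) l (normOp G (k + 1) l x) = 0 :=
  congrArg (fun f => formsHom l f x) (normMap_comp_codegeneracy (cosimplicialForms G) k i)

lemma normOp_eq_self (k l : ℕ) (x : Deligne (Simplex G (k + 1)) l)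
    (hx : ∀ i, Deligne.pullback (Simplex.degen i) (Simplex.smooth_degen i) l x = 0) :
    normOp G (k + 1) l x = x := by
  obtain ⟨c, hc⟩ := exists_normMap_add (cosimplicialForms G) k
  have h := congrArg (fun f => formsHom l f x) hc
  have h' : normOp G (k + 1) l x + ∑ i, formsHom l (c i) (Deligne.pullback (Simplex.degen i)
      (Simplex.smooth_degen i) l x) = x := by
    refine Eq.trans ?_ h
    simp only [map_add, map_sum, AddMonoidHom.add_apply, AddMonoidHom.finsetSum_apply]
    rfl
  simpa only [hx, map_zero, Finset.sum_const_zero, add_zero] using h'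

/-- The map of cosimplicial groups induced by a functor. -/
def cosimplicialFormsMap {H : DGrpd.{u}} (F : DFunctor G H) :
    cosimplicialForms H ⟶ cosimplicialForms G where
  app K := deligneSequenceMap (Simplex.map F K.len) (Simplex.smooth_map F K.len)
  naturality K L f := by
    refine NatTrans.ext (funext fun l => AddCommGrpCat.hom_ext (AddMonoidHom.ext fun x => ?_))
    refine Eq.trans (Deligne.pullback_pullback (Simplex.map F L.len) (Simplex.smooth_map F _)
      (Simplex.reindex f.toOrderHom) (Simplex.smooth_reindex _) l x) ?_
    exact (Deligne.pullback_pullback (Simplex.reindex f.toOrderHom) (Simplex.smooth_reindex _)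
      (Simplex.map F K.len) (Simplex.smooth_map F _) l x).symm

lemma normOp_pullback {H : DGrpd.{u}} (F : DFunctor G H) (k l : ℕ) (x : Deligne (Simplex H k) l) :
    normOp G k l (Deligne.pullback (Simplex.map F k) (Simplex.smooth_map F k) l x) =
      Deligne.pullback (Simplex.map F k) (Simplex.smooth_map F k) l (normOp H k l x) :=
  congrArg (fun f => (f.app l).hom x) (normMap_naturality (cosimplicialFormsMap F) k)

lemma homOp_cech_zero (l : ℕ) (x : Deligne (Simplex G 0) l) :
    normOp G 0 l x = homOp G 0 l (Cochain.cech G 0 l x) + x := by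
  have h := congrArg (fun f => formsHom l f x) (normMap_zero_eq (cosimplicialForms G))
  rw [← alternatingCoface_apply]
  exact h

lemma homOp_cech_succ (k l : ℕ) (x : Deligne (Simplex G (k + 1)) l) :
    normOp G (k + 1) l x = Cochain.cech G k l (homOp G k l x) +
      homOp G (k + 1) l (Cochain.cech G (k + 1) l x) + x := by
  have h := congrArg (fun f => formsHom l f x) (normMap_succ_eq (cosimplicialForms G) k)
  rw [← alternatingCoface_apply, ← alternatingCoface_apply]
  exact h

end Normalization

/-! ### Normalization of the total complex -/

namespace Cochain

variable {G : DGrpd.{u}} (p m : ℕ)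

/-- The normalization of cochains. -/
def normalize : Cochain G p m →+ Cochain G p m where
  toFun x q := normOp G q.1.1 q.1.2 (x q)
  map_zero' := funext fun _ => map_zero _
  map_add' _ _ := funext fun _ => map_add _ _ _

/-- The homotopy between the normalization of cochains and the identity. -/
def normalizeHomotopy : Cochain G p (m + 1) →+ Cochain G p m where
  toFun x q := homOp G q.1.1 q.1.2 (x ⟨(q.1.1 + 1, q.1.2), by have := q.2; simp only; omega⟩)
  map_zero' := funext fun _ => map_zero _
  map_add' _ _ := funext fun _ => map_add _ _ _

variable {p m}

lemma isNormalized_normalize (x : Cochain G p m) : (normalize p m x).IsNormalized :=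
  fun k l _ i => pullback_degen_normOp k l i _

lemma normalize_eq_self (x : Cochain G p m) (hx : x.IsNormalized) : normalize p m x = x := by
  funext ⟨⟨k, l⟩, h⟩
  cases k with
  | zero => exact normOp_zero l _
  | succ k => exact normOp_eq_self k l _ fun i => hx k l h i

lemma normalize_pullback {H : DGrpd.{u}} (F : DFunctor G H) (x : Cochain H p m) :
    normalize p m (pullback F p m x) = pullback F p m (normalize p m x) :=
  funext fun _ => normOp_pullback F _ _ _

lemma normalize_D (x : Cochain G p m) :
    normalize p (m + 1) (D G p m x) = D G p m (normalize p m x) := by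
  funext ⟨⟨k, l⟩, h⟩
  cases k <;> cases l <;>
    simp [D, horizontal, vertical, normalize, normOp_cech, normOp_d]

/-- On cocycles, the normalization differs from the identity by a coboundary. -/
lemma normalize_sub (x : Cochain G p (m + 1)) (hx : D G p (m + 1) x = 0) :
    normalize p (m + 1) x - x = D G p m (normalizeHomotopy p m x) := by
  -- The cocycle condition trades `δ x` for `-(-1)^(m+2) d x`. Hence the term `homOp (δ x)` of the
  -- homotopy formula becomes `(-1)^(m+1) d (homOp x)`, the vertical part of `D (normalizeHomotopy
  -- x)`.
  have hv (k l : ℕ) (h : k + 1 + l = m + 2 ∧ l < p) :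
      horizontal x ⟨(k + 1, l), h⟩ = -((-1 : ℤ) ^ (m + 2) • vertical x ⟨(k + 1, l), h⟩) :=
    eq_neg_of_add_eq_zero_left (congrFun hx ⟨(k + 1, l), h⟩)
  funext ⟨⟨k, l⟩, h⟩
  have hN : normOp G k l (x ⟨(k, l), h⟩) - x ⟨(k, l), h⟩ =
      horizontal (normalizeHomotopy p m x) ⟨(k, l), h⟩ +
      homOp G k l (Cochain.cech G k l (x ⟨(k, l), h⟩)) := by
    cases k with
    | zero => rw [homOp_cech_zero, add_sub_cancel_right]; exact (zero_add _).symm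
    | succ k => rw [homOp_cech_succ, add_sub_cancel_right]; rfl
  have hK : homOp G k l (Cochain.cech G k l (x ⟨(k, l), h⟩)) =
      (-1 : ℤ) ^ (m + 1) • vertical (normalizeHomotopy p m x) ⟨(k, l), h⟩ := by
    have e : Cochain.cech G k l (x ⟨(k, l), h⟩) = _ :=
      hv k l ⟨by simp only at h; omega, h.2⟩
    rw [e, pow_succ]
    cases l with
    | zero => simp [vertical]
    | succ l => simp [vertical, homOp_d, normalizeHomotopy]
  exact hN.trans (by rw [hK]; rfl)

end Cochain

/-! ### The transgression to the loop groupoid -/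

section LoopTransgression

/-- The transgression of the normalization, as a cochain of the loop groupoid. -/
def loopTransgression (G : DGrpd.{u}) (n m : ℕ) :
    Cochain G (n + 1) (m + 1) →+ LoopCochain G n m where
  toFun x := ⟨fun W => transgression W G n m (Cochain.normalize (n + 1) (m + 1) x),
    fun _ _ ρ => pullback_transgression ρ n m _ (Cochain.isNormalized_normalize x)⟩
  map_zero' := Subtype.ext (funext fun W =>
    map_zero ((transgression W G n m).comp (Cochain.normalize (n + 1) (m + 1))))
  map_add' _ _ := Subtype.ext (funext fun W =>
    map_add ((transgression W G n m).comp (Cochain.normalize (n + 1) (m + 1))) _ _)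

variable {G : DGrpd.{u}}

lemma restrict_loopTransgression (W : AdmissibleCover) (n m : ℕ) (x : Cochain G (n + 1) (m + 1)) :
    LoopCochain.restrict G n m W (loopTransgression G n m x) =
      transgression W G n m (Cochain.normalize (n + 1) (m + 1) x) := rfl

lemma isCochainMap_loopTransgression (G : DGrpd.{u}) (n : ℕ) :
    IsCochainMap (Cochain.D G (n + 1)) (C' := fun m => LoopCochain G n m)
      (LoopCochain.D G n) (loopTransgression G n) where
  zero x := Subtype.ext (funext fun W => by
    change transgression W G n 0 (Cochain.normalize (n + 1) 1 (Cochain.D G (n + 1) 0 x)) = 0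
    rw [Cochain.normalize_D, transgression_D_zero])
  succ m x := Subtype.ext (funext fun W => by
    change transgression W G n (m + 1)
        (Cochain.normalize (n + 1) (m + 2) (Cochain.D G (n + 1) (m + 1) x)) =
      Cochain.D _ n m (transgression W G n m (Cochain.normalize (n + 1) (m + 1) x))
    rw [Cochain.normalize_D, transgression_D])

lemma loopTransgression_pullback {H : DGrpd.{u}} (F : DFunctor G H) (n m : ℕ)
    (x : Cochain H (n + 1) (m + 1)) :
    loopTransgression G n m (Cochain.pullback F (n + 1) (m + 1) x) =
      LoopCochain.pullback F n m (loopTransgression H n m x) :=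
  Subtype.ext (funext fun W => by
    change transgression W G n m (Cochain.normalize (n + 1) (m + 1)
        (Cochain.pullback F (n + 1) (m + 1) x)) =
      Cochain.pullback (loopMap W F) n m
        (transgression W H n m (Cochain.normalize (n + 1) (m + 1) x))
    rw [Cochain.normalize_pullback, transgression_pullback])

/-- On cocycles, the transgression of the normalization differs from the transgression by a
coboundary. -/
lemma restrict_loopTransgression_sub_mem (W : AdmissibleCover) (n m : ℕ)
    (x : Cochain G (n + 1) (m + 1)) (hx : x ∈ (Cochain.D G (n + 1) (m + 1)).ker) :
    LoopCochain.restrict G n m W (loopTransgression G n m x) - transgression W G n m x ∈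
      coboundaries (Cochain.D (loopGrpd W G) n) m := by
  rw [restrict_loopTransgression, ← map_sub, Cochain.normalize_sub x hx]
  cases m with
  -- Degree `0` has no nonzero coboundaries, so here the difference itself must vanish.
  | zero => exact transgression_D_zero W n _
  | succ m => exact ⟨_, (transgression_D W n m _).symm⟩

end LoopTransgression

/-! ### Induced maps in cohomology -/

section CochainMap

variable {C : ℕ → Type u} [∀ m, AddCommGroup (C m)] {C' : ℕ → Type v} [∀ m, AddCommGroup (C' m)]
  {d : ∀ m, C m →+ C (m + 1)} {d' : ∀ m, C' m →+ C' (m + 1)} {f : ∀ m, C (m + 1) →+ C' m}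

lemma IsCochainMap.mem_ker (hf : IsCochainMap d d' f) (m : ℕ) {z : C (m + 1)}
    (hz : z ∈ (d (m + 1)).ker) : f m z ∈ (d' m).ker := by
  rw [AddMonoidHom.mem_ker, ← hf.succ, AddMonoidHom.mem_ker.1 hz, map_zero]

lemma IsCochainMap.map_mem_coboundaries (hf : IsCochainMap d d' f) (m : ℕ) {z : C (m + 1)}
    (hz : z ∈ coboundaries d (m + 1)) : f m z ∈ coboundaries d' m := by
  obtain ⟨y, rfl⟩ := hz
  cases m with
  -- The coboundaries of degree `0` are trivial: this is where the condition `f 0 (d 0 y) = 0` is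
  -- needed.
  | zero => exact hf.zero y
  | succ m => exact ⟨f m y, (hf.succ m y).symm⟩

lemma IsCochainMap.exists_induces (hf : IsCochainMap d d' f) :
    ∃ T : ∀ m, Cohomology d (m + 1) →+ Cohomology d' m, Induces f T :=
  ⟨fun m => QuotientAddGroup.map _ _
    (((f m).comp (d (m + 1)).ker.subtype).codRestrict _ fun z => hf.mem_ker m z.2)
    fun _ hz => hf.map_mem_coboundaries m hz, fun m z => ⟨hf.mem_ker m z.2, rfl⟩⟩

end CochainMap

end LoopDeligne

end

/-- With `n = k + 1`. -/
theorem mainTheorem6 (k : ℕ) :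
    ∃ (τ : ∀ (G : LerayGroupoid.{u}) (m : ℕ),
          Cochain G.toDGrpd (k + 2) (m + 1) →+ LoopCochain G.toDGrpd (k + 1) m)
      (τW : ∀ (G : LerayGroupoid.{u}) (W : AdmissibleCover) (m : ℕ),
          Cochain G.toDGrpd (k + 2) (m + 1) →+ Cochain (loopGrpd W G.toDGrpd) (k + 1) m),
      -- the maps `τW` are given by the explicit formula
      (∀ G W m x, IsTransgression W x (τW G W m x)) ∧
      -- they are natural cochain maps of degree `-1`
      (∀ G W, IsCochainMap (Cochain.D G.toDGrpd (k + 2))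
        (Cochain.D (loopGrpd W G.toDGrpd) (k + 1)) (τW G W)) ∧
      (∀ (G H : LerayGroupoid.{u}) (F : DFunctor G.toDGrpd H.toDGrpd) W m x,
        τW G W m (Cochain.pullback F (k + 2) (m + 1) x) =
          Cochain.pullback (loopMap W F) (k + 1) m (τW H W m x)) ∧
      -- `τ` is given by the explicit formula on normalized cochains
      (∀ G m x, Cochain.IsNormalized x →
        ∀ W, LoopCochain.restrict G.toDGrpd (k + 1) m W (τ G m x) = τW G W m x) ∧
      -- `τ` is a natural cochain map of degree `-1`
      (∀ G, IsCochainMap (Cochain.D G.toDGrpd (k + 2))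
        (C' := fun m => LoopCochain G.toDGrpd (k + 1) m)
        (LoopCochain.D G.toDGrpd (k + 1)) (τ G)) ∧
      (∀ (G H : LerayGroupoid.{u}) (F : DFunctor G.toDGrpd H.toDGrpd) m x,
        τ G m (Cochain.pullback F (k + 2) (m + 1) x) =
          LoopCochain.pullback F (k + 1) m (τ H m x)) ∧
      -- it sends gerbes to gerbes
      (∀ (G : LerayGroupoid.{u}) (x : Cochain G.toDGrpd (k + 2) (k + 1)),
        x ∈ gerbes G.toDGrpd (k + 1) → τ G k x ∈ loopGerbes G.toDGrpd k) ∧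
      -- it induces maps in Deligne cohomology
      (∀ G : LerayGroupoid.{u}, ∃ T : ∀ m,
          DeligneCohomology G.toDGrpd (k + 2) (m + 1) →+
            LoopDeligneCohomology G.toDGrpd (k + 1) m,
        Induces (C' := fun m => LoopCochain G.toDGrpd (k + 1) m) (τ G) T) ∧
      -- over `L𝒢(W)` these maps are induced by the explicit formula on all cocycles
      (∀ (G : LerayGroupoid.{u}) m (x : Cochain G.toDGrpd (k + 2) (m + 1)),
        x ∈ (Cochain.D G.toDGrpd (k + 2) (m + 1)).ker → ∀ W : AdmissibleCover,
        LoopCochain.restrict G.toDGrpd (k + 1) m W (τ G m x) - τW G W m x ∈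
          coboundaries (Cochain.D (loopGrpd W G.toDGrpd) (k + 1)) m) := by
  exact ⟨fun G m => loopTransgression G.toDGrpd (k + 1) m,
    fun G W m => transgression W G.toDGrpd (k + 1) m,
    fun _ W m x => isTransgression_transgression W (k + 1) m x,
    fun _ W => isCochainMap_transgression W (k + 1),
    fun _ _ F W m x => transgression_pullback W F (k + 1) m x,
    fun G m x hx W => by rw [restrict_loopTransgression, Cochain.normalize_eq_self x hx],
    fun G => isCochainMap_loopTransgression G.toDGrpd (k + 1),
    fun _ _ F m x => loopTransgression_pullback F (k + 1) m x,
    -- Gerbes are cocycles, and lowering both the degree and the truncation by one matches their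
    -- definition over the loop groupoid.
    fun G _ hx => (isCochainMap_loopTransgression G.toDGrpd (k + 1)).mem_ker k hx,
    fun G => (isCochainMap_loopTransgression G.toDGrpd (k + 1)).exists_induces,
    fun _ m x hx W => restrict_loopTransgression_sub_mem W (k + 1) m x hx⟩
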